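/- **Conventions.** A Feynman graph is a finite graph given by vertices and half-edges; two half-edges may be joined to form an internal line (self-loops and multiple lines are allowed), and an unjoined half-edge is an external leg. An *assigned graph* $(G,\mu)$ is a Feynman graph, up to isomorphism, with a scale $\mu(\ell)\in\{0,1,2,\dots\}$ for each internal line $\ell$; external legs count as lying below all scales. Fix a cutoff $\rho\in\mathbb N\cup\{\infty\}$, a set $W\supseteq\{2,4\}$ of valences, and let $\mathcal G$ be the class of connected assigned graphs with at least one internal line, all scales $\le\rho$ and all valences in $W$; alternatively let $\mathcal G$ be the class of one particle irreducible (1PI, i.e. connected and not disconnected by cutting any one internal line) such graphs. The result holds for either choice. A subgraph $g$ of $G$ is a set of internal lines with their end vertices; its external legs are the half-edges of $G$ at these vertices that do not belong to lines of $g$, and it is an assigned graph by restriction of $\mu$. It is *high* if it is nonempty and connected and each of its internal lines has a strictly larger scale than each of its external legs. The *Gallavotti–Nicolò tree* $T_{(G,\mu)}$ of $(G,\mu)\in\mathcal G$ is the rooted tree whose nodes at distance $i$ from the root are decorated with the connected components (with at least one line) of the subgraph of lines of scale $\ge i$, that is, with the high subgraphs whose lines have scale $\ge i$ and whose external legs have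 scale $<i$; an arrow joins a node at distance $i$ to the node at distance $i-1$ whose subgraph contains its own. Trees are taken up to isomorphism of decorated rooted trees. An *admissible cut* $C$ of $T=T_{(G,\mu)}$ is a nonempty set of arrows, each joining nodes decorated with two different graphs, the graph farther from the root having two or four external legs (and being 1PI if $\mathcal G$ consists of 1PI graphs), such that no path from a leaf to the root contains two arrows of $C$. Removing $C$ leaves a subtree $T_<$ containing the root and subtrees $T_>^{1},\dots,T_>^{|C|}$ not containing it. If the root of $T_>^n$ is decorated with $(g_n,\nu_n)$, its completion is $\overline{T_>^n}=T_{(g_n,\nu_n)}$. The completion of $T_<$ is the tree of its root graph after the removed subgraphs have been shrunk: $\overline{T_<}=T_{(G',\mu')}$, where $G'$ is obtained from $G$ by shrinking each $g_n$ to a vertex and $\mu'$ is the restriction of $\mu$ to the remaining lines. **Proposition.** Let $\mathbb K$ be a field and let $\mathcal H_{\mathrm{GN}}$ be the free commutative $\mathbb K$-algebra generated by the Gallavotti–Nicolò trees of all graphs in $\mathcal G$. For every such tree and every admissible cut, the completed trees above are again trees of graphs in $\mathcal G$, and there are algebra morphisms $\Delta:\mathcal H_{\mathrm{GN}}\to\mathcal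 H_{\mathrm{GN}}\otimes\mathcal H_{\mathrm{GN}}$ and $\epsilon:\mathcal H_{\mathrm{GN}}\to\mathbb K$ with $$\epsilon(T)=0,\qquad \Delta(T)=T\otimes 1+1\otimes T+\sum_{C\ \text{admissible cut of }T}\Big(\prod_{1\le n\le |C|}\overline{T_>^{n}}\Big)\otimes\overline{T_<}$$ for every Gallavotti–Nicolò tree $T$. With them $\mathcal H_{\mathrm{GN}}$ is a Hopf algebra ($\Delta$ is coassociative, $\epsilon$ is a counit, and there is an antipode $S$). It is graded by giving each tree $T$ the degree $$n(T)=\#\{\text{arrows of }T\text{ joining nodes decorated with different graphs}\}+1 ,$$ and a product of trees the sum of the degrees: with $\mathcal H^{(n)}$ the span of the products of degree $n$, one has $\mathcal H_{\mathrm{GN}}=\bigoplus_{n\ge0}\mathcal H^{(n)}$, $\mathcal H^{(n)}\mathcal H^{(m)}\subseteq\mathcal H^{(n+m)}$, $\Delta\mathcal H^{(n)}\subseteq\bigoplus_{k=0}^n\mathcal H^{(k)}\otimes\mathcal H^{(n-k)}$ and $S(\mathcal H^{(n)})\subseteq\mathcal H^{(n)}$. -/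

import Mathlib

open scoped TensorProduct

namespace GallavottiNicolo

/-- A Feynman graph with a scale assignment, presented by half-edges. `vert` sends a half-edge to
the vertex it is attached to. The two halves of an internal line are exchanged by `inv`; the fixed
points of `inv` are the external legs. Internal lines carry a scale in `ℕ`; external legs carry the
value `⊥`, which is below all scales. Self-loops and multiple lines are allowed. -/
structure AssignedGraph : Type 1 where
  Vertex : Type
  HalfEdge : Type
  finite_vertex : Finite Vertex
  finite_halfEdge : Finite HalfEdge
  vert : HalfEdge → Vertex
  inv : HalfEdge → HalfEdge
  inv_inv : ∀ h, inv (inv h) = h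
  scale : HalfEdge → WithBot ℕ
  scale_inv : ∀ h, scale (inv h) = scale h
  scale_eq_bot_iff : ∀ h, scale h = ⊥ ↔ inv h = h

namespace AssignedGraph

attribute [instance] finite_vertex finite_halfEdge

/-- Isomorphism of assigned graphs: relabelling of vertices and half-edges. -/
structure Iso (X Y : AssignedGraph) where
  onVertex : X.Vertex ≃ Y.Vertex
  onHalfEdge : X.HalfEdge ≃ Y.HalfEdge
  vert_map : ∀ h, Y.vert (onHalfEdge h) = onVertex (X.vert h)
  inv_map : ∀ h, Y.inv (onHalfEdge h) = onHalfEdge (X.inv h)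
  scale_map : ∀ h, Y.scale (onHalfEdge h) = X.scale h

/-- Two assigned graphs are isomorphic. -/
def IsIso (X Y : AssignedGraph) : Prop := Nonempty (Iso X Y)

theorem IsIso.refl (X : AssignedGraph) : IsIso X X :=
  ⟨⟨Equiv.refl _, Equiv.refl _, fun _ => rfl, fun _ => rfl, fun _ => rfl⟩⟩

theorem IsIso.symm {X Y : AssignedGraph} : IsIso X Y → IsIso Y X := by
  rintro ⟨f⟩
  refine ⟨⟨f.onVertex.symm, f.onHalfEdge.symm, fun h => ?_, fun h => ?_, fun h => ?_⟩⟩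
  · rw [Equiv.eq_symm_apply, ← f.vert_map, Equiv.apply_symm_apply]
  · rw [Equiv.eq_symm_apply, ← f.inv_map, Equiv.apply_symm_apply]
  · rw [← f.scale_map, Equiv.apply_symm_apply]

theorem IsIso.trans {X Y Z : AssignedGraph} : IsIso X Y → IsIso Y Z → IsIso X Z := by
  rintro ⟨f⟩ ⟨g⟩
  refine ⟨⟨f.onVertex.trans g.onVertex, f.onHalfEdge.trans g.onHalfEdge, fun h => ?_, fun h => ?_,
    fun h => ?_⟩⟩
  · simp [g.vert_map, f.vert_map]
  · simp [g.inv_map, f.inv_map]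
  · simp [g.scale_map, f.scale_map]

variable (X : AssignedGraph)

/-- The halves of internal lines. -/
def internal : Set X.HalfEdge := {h | X.inv h ≠ h}

/-- The number of external legs. -/
noncomputable def numLegs : ℕ := Nat.card {h : X.HalfEdge // X.inv h = h}

/-- The number of half-edges attached to a vertex. -/
noncomputable def valence (v : X.Vertex) : ℕ := Nat.card {h : X.HalfEdge // X.vert h = v}

/-- One can walk from one vertex to another along the lines in `E`. -/
def Reach (E : Set X.HalfEdge) : X.Vertex → X.Vertex → Prop :=
  Relation.ReflTransGen fun v w => ∃ h ∈ E, X.vert h = v ∧ X.vert (X.inv h) = w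

/-- The graph is connected and has at least one internal line. -/
def IsConnected : Prop := X.internal.Nonempty ∧ ∀ v w, X.Reach X.internal v w

/-- One particle irreducible: connected, and still connected when any one internal line is cut. -/
def IsOnePI : Prop :=
  X.IsConnected ∧ ∀ h ∈ X.internal, ∀ v w, X.Reach (X.internal \ {h, X.inv h}) v w

/-- A set of internal lines, given by the set of their halves. This is how subgraphs are given. -/
structure IsSubgraph (E : Set X.HalfEdge) : Prop where
  internal : ∀ h ∈ E, X.inv h ≠ h
  inv_mem : ∀ h ∈ E, X.inv h ∈ E

/-- The vertices of the subgraph with internal lines `E`. -/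
def verts (E : Set X.HalfEdge) : Set X.Vertex := X.vert '' E

/-- The external legs of the subgraph with internal lines `E`: the half-edges attached to its
vertices that do not belong to its internal lines. -/
def legs (E : Set X.HalfEdge) : Set X.HalfEdge := {h | X.vert h ∈ X.verts E ∧ h ∉ E}

/-- `E` is a high subgraph: connected, and each internal line has a strictly larger scale than each
external leg. -/
structure IsHigh (E : Set X.HalfEdge) : Prop where
  isSubgraph : X.IsSubgraph E
  nonempty : E.Nonempty
  connected : ∀ v ∈ X.verts E, ∀ w ∈ X.verts E, X.Reach E v w
  high : ∀ h ∈ E, ∀ l ∈ X.legs E, X.scale l < X.scale h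

/-- `E` is a connected component of the subgraph of all lines of scale at least `i`, that is,
a high subgraph whose internal lines have scale `≥ i` and whose external legs have scale `< i`. -/
structure IsComponent (i : ℕ) (E : Set X.HalfEdge) : Prop where
  isHigh : X.IsHigh E
  le_scale : ∀ h ∈ E, (i : WithBot ℕ) ≤ X.scale h
  scale_lt : ∀ l ∈ X.legs E, X.scale l < (i : WithBot ℕ)

variable {X}

open Classical in
/-- The subgraph with internal lines `E` as an assigned graph: it has all half-edges at its vertices,
and those that are not in `E` become external legs. -/
noncomputable def sub {E : Set X.HalfEdge} (hE : X.IsSubgraph E) : AssignedGraph where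
  Vertex := X.verts E
  HalfEdge := {h : X.HalfEdge // X.vert h ∈ X.verts E}
  finite_vertex := inferInstance
  finite_halfEdge := inferInstance
  vert h := ⟨X.vert h.1, h.2⟩
  inv h := if hh : h.1 ∈ E then ⟨X.inv h.1, X.inv h.1, hE.inv_mem _ hh, rfl⟩ else h
  inv_inv h := by
    by_cases hh : h.1 ∈ E
    · simp [hh, hE.inv_mem _ hh, X.inv_inv]
    · simp [hh]
  scale h := if h.1 ∈ E then X.scale h.1 else ⊥
  scale_inv h := by
    by_cases hh : h.1 ∈ E
    · simp [hh, hE.inv_mem _ hh, X.scale_inv]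
    · simp [hh]
  scale_eq_bot_iff h := by
    by_cases hh : h.1 ∈ E
    · simp [hh, X.scale_eq_bot_iff, Subtype.ext_iff]
    · simp [hh]

/-- The graph obtained by shrinking each connected component of the subgraph `E` to a vertex. The
lines of `E` are erased, all other lines keep their scale. -/
def shrink {E : Set X.HalfEdge} (hE : X.IsSubgraph E) : AssignedGraph where
  Vertex := Quot fun v w => ∃ h ∈ E, X.vert h = v ∧ X.vert (X.inv h) = w
  HalfEdge := {h : X.HalfEdge // h ∉ E}
  finite_vertex := inferInstance
  finite_halfEdge := inferInstance
  vert h := Quot.mk _ (X.vert h.1)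
  inv h := ⟨X.inv h.1, fun hh => h.2 (by simpa [X.inv_inv] using hE.inv_mem _ hh)⟩
  inv_inv h := by simp [X.inv_inv]
  scale h := X.scale h.1
  scale_inv h := by simp [X.scale_inv]
  scale_eq_bot_iff h := by simp [X.scale_eq_bot_iff, Subtype.ext_iff]

theorem isSubgraph_iUnion {ι : Type*} (F : ι → Set X.HalfEdge)
    (hF : ∀ a, X.IsSubgraph (F a)) : X.IsSubgraph (⋃ a, F a) := by
  constructor
  · intro h hh
    simp only [Set.mem_iUnion] at hh
    obtain ⟨a, ha⟩ := hh
    exact (hF a).internal h ha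
  · intro h hh
    simp only [Set.mem_iUnion] at hh ⊢
    obtain ⟨a, ha⟩ := hh
    exact ⟨a, (hF a).inv_mem h ha⟩

theorem scale_eq_coe_of_mem_internal {h : X.HalfEdge} (hh : h ∈ X.internal) :
    ∃ n : ℕ, X.scale h = (n : WithBot ℕ) := by
  have h1 : X.scale h ≠ ⊥ := fun h0 => hh ((X.scale_eq_bot_iff h).1 h0)
  obtain ⟨n, hn⟩ := WithBot.ne_bot_iff_exists.1 h1
  exact ⟨n, hn.symm⟩

theorem scale_eq_bot_of_not_mem_internal {h : X.HalfEdge} (hh : h ∉ X.internal) :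
    X.scale h = ⊥ :=
  (X.scale_eq_bot_iff h).2 (not_not.1 hh)

variable (X)

/-- The nodes of the tree: a distance from the root, and a connected component of the subgraph of
lines of at least that scale. -/
def Node : Type := {p : ℕ × Set X.HalfEdge // X.IsComponent p.1 p.2}

variable {X}

/-- The distance of a node from the root. -/
def Node.level (a : X.Node) : ℕ := a.1.1

/-- The lines of the subgraph that decorates a node. -/
def Node.lines (a : X.Node) : Set X.HalfEdge := a.1.2

theorem Node.isComponent (a : X.Node) : X.IsComponent a.level a.lines := a.2

/-- The assigned subgraph that decorates a node. -/
noncomputable def Node.graph (a : X.Node) : AssignedGraph := sub a.isComponent.isHigh.isSubgraph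

/-- An arrow joins a node to a node one step closer to the root whose subgraph contains its own. -/
def Node.Arrow (a b : X.Node) : Prop := a.level = b.level + 1 ∧ a.lines ⊆ b.lines

instance : Finite X.Node := by
  classical
  have h1 : (⋃ h : X.HalfEdge, {i : ℕ | (i : WithBot ℕ) ≤ X.scale h}).Finite := by
    refine Set.finite_iUnion fun h => ?_
    by_cases hh : h ∈ X.internal
    · obtain ⟨n, hn⟩ := scale_eq_coe_of_mem_internal hh
      refine (Set.finite_Iic n).subset fun i hi => ?_
      simpa [hn] using hi
    · have h0 := scale_eq_bot_of_not_mem_internal hh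
      refine Set.finite_empty.subset fun i hi => ?_
      simp [h0] at hi
  have h2 : {p : ℕ × Set X.HalfEdge | X.IsComponent p.1 p.2}.Finite := by
    refine (h1.prod (Set.finite_univ (α := Set X.HalfEdge))).subset ?_
    rintro ⟨i, E⟩ hE
    obtain ⟨h, hh⟩ := hE.isHigh.nonempty
    exact ⟨Set.mem_iUnion.2 ⟨h, hE.le_scale h hh⟩, Set.mem_univ _⟩
  exact h2.to_subtype

/-- If a set of lines `E` contains all lines of scale `≥ i` touching its vertices, it contains all
vertices and lines of scale `≥ i` that can be reached from it. -/
theorem mem_verts_of_reach {i : ℕ} {E F : Set X.HalfEdge} (hE : X.IsSubgraph E)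
    (hl : ∀ l ∈ X.legs E, X.scale l < (i : WithBot ℕ))
    (hF : ∀ h ∈ F, (i : WithBot ℕ) ≤ X.scale h) {v w : X.Vertex} (hv : v ∈ X.verts E)
    (hr : X.Reach F v w) : w ∈ X.verts E := by
  induction hr with
  | refl => exact hv
  | tail _ hs ih =>
    obtain ⟨h, hh, rfl, rfl⟩ := hs
    have : h ∈ E := by
      by_contra hn
      exact absurd (hl h ⟨ih, hn⟩) (not_lt.2 (hF h hh))
    exact ⟨_, hE.inv_mem h this, rfl⟩

theorem mem_of_mem_verts {i : ℕ} {E : Set X.HalfEdge}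
    (hl : ∀ l ∈ X.legs E, X.scale l < (i : WithBot ℕ)) {h : X.HalfEdge}
    (hv : X.vert h ∈ X.verts E) (hs : (i : WithBot ℕ) ≤ X.scale h) : h ∈ E := by
  by_contra hn
  exact absurd (hl h ⟨hv, hn⟩) (not_lt.2 hs)

theorem reach_symm {F : Set X.HalfEdge} (hF : ∀ h ∈ F, X.inv h ∈ F) {v w : X.Vertex}
    (h : X.Reach F v w) : X.Reach F w v := by
  induction h with
  | refl => exact .refl
  | tail _ hs ih =>
    obtain ⟨e, he, rfl, rfl⟩ := hs
    exact Relation.ReflTransGen.head ⟨X.inv e, hF e he, rfl, by rw [X.inv_inv]⟩ ih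

/-- Components that share a line are nested. -/
theorem IsComponent.subset {i j : ℕ} (hij : i ≤ j) {E F : Set X.HalfEdge}
    (hE : X.IsComponent i E) (hF : X.IsComponent j F) {h : X.HalfEdge} (h1 : h ∈ E) (h2 : h ∈ F) :
    F ⊆ E := by
  intro k hk
  have hs : ∀ h ∈ F, (i : WithBot ℕ) ≤ X.scale h := fun h hh =>
    le_trans (by exact_mod_cast hij) (hF.le_scale h hh)
  refine mem_of_mem_verts hE.scale_lt ?_ (hs k hk)
  exact mem_verts_of_reach hE.isHigh.isSubgraph hE.scale_lt hs ⟨h, h1, rfl⟩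
    (hF.isHigh.connected _ ⟨h, h2, rfl⟩ _ ⟨k, hk, rfl⟩)

theorem IsConnected.isComponent (hX : X.IsConnected) : X.IsComponent 0 X.internal := by
  have hle : ∀ h ∈ X.internal, ((0 : ℕ) : WithBot ℕ) ≤ X.scale h := by
    intro h hh
    obtain ⟨n, hn⟩ := scale_eq_coe_of_mem_internal hh
    rw [hn]
    exact_mod_cast Nat.zero_le n
  have hlt : ∀ l ∈ X.legs X.internal, X.scale l < ((0 : ℕ) : WithBot ℕ) := by
    intro l hl
    rw [scale_eq_bot_of_not_mem_internal hl.2]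
    exact WithBot.bot_lt_coe 0
  refine ⟨⟨⟨fun h hh => hh, fun h hh => ?_⟩, hX.1, fun v _ w _ => hX.2 v w, ?_⟩, hle, hlt⟩
  · intro h0
    exact hh (by rw [X.inv_inv] at h0; exact h0.symm)
  · intro h hh l hl
    exact (hlt l hl).trans_le (hle h hh)

/-- Each component of the lines of scale `≥ i + 1` lies in a component of the lines of
scale `≥ i`. -/
theorem IsComponent.exists_parent {i : ℕ} {E : Set X.HalfEdge} (hE : X.IsComponent (i + 1) E) :
    ∃ F, X.IsComponent i F ∧ E ⊆ F := by
  obtain ⟨e, he⟩ := hE.isHigh.nonempty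
  let A : Set X.HalfEdge := {h | (i : WithBot ℕ) ≤ X.scale h}
  let F : Set X.HalfEdge := {h | h ∈ A ∧ X.Reach A (X.vert e) (X.vert h)}
  have hA : ∀ h ∈ A, X.inv h ∈ A := fun h hh => by
    change (i : WithBot ℕ) ≤ X.scale (X.inv h)
    rw [X.scale_inv]
    exact hh
  have hEA : ∀ h ∈ E, h ∈ A := fun h hh =>
    le_trans (by exact_mod_cast Nat.le_succ i) (hE.le_scale h hh)
  have hsub : X.IsSubgraph F := by
    refine ⟨fun h hh h0 => ?_, fun h hh => ⟨hA h hh.1, hh.2.tail ⟨h, hh.1, rfl, rfl⟩⟩⟩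
    have h1 : (i : WithBot ℕ) ≤ X.scale h := hh.1
    rw [(X.scale_eq_bot_iff h).2 h0] at h1
    exact absurd h1 (not_le.2 (WithBot.bot_lt_coe i))
  have hmono : ∀ w, X.Reach A (X.vert e) w → X.Reach F (X.vert e) w := by
    intro w hw
    induction hw with
    | refl => exact .refl
    | tail hr hs ih =>
      obtain ⟨h, hh, rfl, rfl⟩ := hs
      exact ih.tail ⟨h, ⟨hh, hr⟩, rfl, rfl⟩
  have hlt : ∀ l ∈ X.legs F, X.scale l < (i : WithBot ℕ) := by
    rintro l ⟨⟨k, hk, hkl⟩, hl⟩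
    by_contra hn
    exact hl ⟨not_lt.1 hn, hkl ▸ hk.2⟩
  have hEF : E ⊆ F := fun h hh => ⟨hEA h hh,
    Relation.ReflTransGen.mono (fun _ _ ⟨k, hk, h1, h2⟩ => ⟨k, hEA k hk, h1, h2⟩) _ _
      (hE.isHigh.connected _ ⟨e, he, rfl⟩ _ ⟨h, hh, rfl⟩)⟩
  refine ⟨F, ⟨⟨hsub, ⟨e, hEF he⟩, ?_, fun h hh l hl => (hlt l hl).trans_le hh.1⟩,
    fun h hh => hh.1, hlt⟩, hEF⟩
  rintro _ ⟨h, hh, rfl⟩ _ ⟨k, hk, rfl⟩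
  exact (reach_symm hsub.inv_mem (hmono _ hh.2)).trans (hmono _ hk.2)

end AssignedGraph

/-- A finite rooted tree whose nodes are decorated with assigned graphs. Arrows point to the root:
the root has no outgoing arrow, each other node has exactly one, and all paths lead to the root. -/
structure DecoratedTree : Type 1 where
  Node : Type
  finite_node : Finite Node
  root : Node
  Arrow : Node → Node → Prop
  not_arrow_root : ∀ b, ¬ Arrow root b
  existsUnique_arrow : ∀ a, a ≠ root → ∃! b, Arrow a b
  to_root : ∀ a, Relation.ReflTransGen Arrow a root
  graph : Node → AssignedGraph

namespace DecoratedTree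

attribute [instance] finite_node

/-- Isomorphism of rooted trees that matches the decorations up to isomorphism. -/
structure Iso (T U : DecoratedTree) where
  onNode : T.Node ≃ U.Node
  root_map : onNode T.root = U.root
  arrow_map : ∀ a b, U.Arrow (onNode a) (onNode b) ↔ T.Arrow a b
  graph_map : ∀ a, (T.graph a).IsIso (U.graph (onNode a))

/-- Being isomorphic, as an equivalence relation on decorated trees. -/
def setoid : Setoid DecoratedTree where
  r T U := Nonempty (Iso T U)
  iseqv := by
    refine ⟨fun T => ⟨⟨Equiv.refl _, rfl, fun _ _ => Iff.rfl, fun a => .refl _⟩⟩, ?_, ?_⟩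
    · rintro T U ⟨f⟩
      refine ⟨⟨f.onNode.symm, by rw [← f.root_map, Equiv.symm_apply_apply], fun a b => ?_,
        fun a => ?_⟩⟩
      · rw [← f.arrow_map, Equiv.apply_symm_apply, Equiv.apply_symm_apply]
      · simpa using (f.graph_map (f.onNode.symm a)).symm
    · rintro T U V ⟨f⟩ ⟨g⟩
      refine ⟨⟨f.onNode.trans g.onNode, by simp [f.root_map, g.root_map], fun a b => ?_,
        fun a => (f.graph_map a).trans (g.graph_map _)⟩⟩
      simp [g.arrow_map, f.arrow_map]

variable (T : DecoratedTree)

/-- An arrow joining nodes decorated with two different graphs. -/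
def IsEssential (a : T.Node × T.Node) : Prop :=
  T.Arrow a.1 a.2 ∧ ¬ (T.graph a.1).IsIso (T.graph a.2)

/-- The number of arrows joining nodes decorated with different graphs, plus one. -/
noncomputable def degree : ℕ := Nat.card {a : T.Node × T.Node // T.IsEssential a} + 1

theorem degree_eq_of_iso {T U : DecoratedTree} (f : Iso T U) : T.degree = U.degree := by
  refine congrArg (· + 1) (Nat.card_congr ((Equiv.prodCongr f.onNode f.onNode).subtypeEquiv ?_))
  rintro ⟨a, b⟩
  refine and_congr (f.arrow_map a b).symm (not_congr ⟨fun h => ?_, fun h => ?_⟩)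
  · exact ((f.graph_map a).symm.trans h).trans (f.graph_map b)
  · exact ((f.graph_map a).trans h).trans (f.graph_map b).symm

end DecoratedTree

/-- The Gallavotti-Nicolò tree of a connected assigned graph. -/
noncomputable def gnTree (X : AssignedGraph) (hX : X.IsConnected) : DecoratedTree where
  Node := X.Node
  finite_node := inferInstance
  root := ⟨(0, X.internal), hX.isComponent⟩
  Arrow := AssignedGraph.Node.Arrow
  not_arrow_root b hb := Nat.succ_ne_zero _ hb.1.symm
  existsUnique_arrow := by
    rintro ⟨⟨i, E⟩, hE⟩ hne
    cases i with
    | zero =>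
      refine (hne (Subtype.ext (Prod.ext rfl (Set.Subset.antisymm ?_ ?_)))).elim
      · exact hE.isHigh.isSubgraph.internal
      · obtain ⟨e, he⟩ := hE.isHigh.nonempty
        exact hE.subset le_rfl hX.isComponent he (hE.isHigh.isSubgraph.internal e he)
    | succ i =>
      obtain ⟨F, hF, hEF⟩ := hE.exists_parent
      refine ⟨⟨(i, F), hF⟩, ⟨rfl, hEF⟩, ?_⟩
      rintro ⟨⟨j, G⟩, hG⟩ ⟨hj, hEG⟩
      obtain rfl : i = j := Nat.succ_injective hj
      obtain ⟨e, he⟩ := hE.isHigh.nonempty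
      refine Subtype.ext (Prod.ext rfl (Set.Subset.antisymm ?_ ?_))
      · exact hF.subset le_rfl hG (hEF he) (hEG he)
      · exact hG.subset le_rfl hF (hEG he) (hEF he)
  to_root := by
    rintro ⟨⟨i, E⟩, hE⟩
    induction i generalizing E with
    | zero =>
      obtain ⟨e, he⟩ := hE.isHigh.nonempty
      have : E = X.internal := Set.Subset.antisymm hE.isHigh.isSubgraph.internal
        (hE.subset le_rfl hX.isComponent he (hE.isHigh.isSubgraph.internal e he))
      subst this
      exact .refl
    | succ i ih =>
      obtain ⟨F, hF, hEF⟩ := hE.exists_parent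
      have harrow : AssignedGraph.Node.Arrow (X := X) ⟨(i + 1, E), hE⟩ ⟨(i, F), hF⟩ := ⟨rfl, hEF⟩
      exact Relation.ReflTransGen.head harrow (ih F hF)
  graph := AssignedGraph.Node.graph

/-- The class of assigned graphs under consideration: the allowed valences of vertices (among them
`2` and `4`, so that two- and four-point subgraphs can be shrunk to a vertex), whether only one
particle irreducible graphs are considered or all connected ones, and the ultraviolet cutoff, a
bound on the scales (possibly `⊤`). -/
structure GraphClass where
  valences : Set ℕ
  two_mem : 2 ∈ valences
  four_mem : 4 ∈ valences
  onePIOnly : Prop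
  cutoff : ℕ∞

/-- The graph belongs to the class. -/
structure GraphClass.Mem (𝒢 : GraphClass) (X : AssignedGraph) : Prop where
  connected : X.IsConnected
  onePI : 𝒢.onePIOnly → X.IsOnePI
  valence_mem : ∀ v, X.valence v ∈ 𝒢.valences
  scale_le : ∀ h, ∀ n : ℕ, X.scale h = (n : WithBot ℕ) → (n : ℕ∞) ≤ 𝒢.cutoff

/-- The isomorphism classes of Gallavotti-Nicolò trees of the graphs in the class. -/
def GNTree (𝒢 : GraphClass) : Type 1 :=
  {t : Quotient DecoratedTree.setoid //
    ∃ (X : AssignedGraph) (hX : 𝒢.Mem X), t = Quotient.mk _ (gnTree X hX.connected)}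

namespace GNTree

variable {𝒢 : GraphClass}

/-- The tree of an assigned graph in the class, up to isomorphism. -/
noncomputable def of (X : AssignedGraph) (hX : 𝒢.Mem X) : GNTree 𝒢 :=
  ⟨Quotient.mk _ (gnTree X hX.connected), X, hX, rfl⟩

/-- The number of arrows joining nodes decorated with different graphs, plus one. -/
noncomputable def degree (t : GNTree 𝒢) : ℕ :=
  Quotient.lift DecoratedTree.degree (fun _ _ h => Nonempty.elim h DecoratedTree.degree_eq_of_iso) t.1

end GNTree

/-- An admissible cut of a decorated tree: a nonempty set of arrows joining nodes decorated with
different graphs, such that the graph farther from the root has two or four external legs (and is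
one particle irreducible, if only such graphs are considered), and such that no path towards the
root contains two of the arrows. An arrow is the pair of its nodes, the one farther from the root
first. -/
structure IsAdmissibleCut (𝒢 : GraphClass) (T : DecoratedTree) (C : Finset (T.Node × T.Node)) :
    Prop where
  nonempty : C.Nonempty
  isEssential : ∀ a ∈ C, T.IsEssential a
  numLegs_eq : ∀ a ∈ C, (T.graph a.1).numLegs = 2 ∨ (T.graph a.1).numLegs = 4
  onePI : 𝒢.onePIOnly → ∀ a ∈ C, (T.graph a.1).IsOnePI
  no_path : ∀ a ∈ C, ∀ b ∈ C, a ≠ b → ¬ Relation.ReflTransGen T.Arrow a.2 b.1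

/-- The type of admissible cuts of the tree of an assigned graph. -/
def AdmissibleCut (𝒢 : GraphClass) (X : AssignedGraph) (hX : X.IsConnected) : Type :=
  {C : Finset ((gnTree X hX).Node × (gnTree X hX).Node) // IsAdmissibleCut 𝒢 (gnTree X hX) C}

namespace AdmissibleCut

variable {𝒢 : GraphClass} {X : AssignedGraph} {hX : X.IsConnected}

noncomputable instance : Fintype (AdmissibleCut 𝒢 X hX) :=
  haveI : Finite (AdmissibleCut 𝒢 X hX) :=
    inferInstanceAs (Finite {C : Finset ((gnTree X hX).Node × (gnTree X hX).Node) //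
      IsAdmissibleCut 𝒢 (gnTree X hX) C})
  Fintype.ofFinite _

/-- The root of the subtree that is cut off at the arrow `a`: the node of `a` farther from the
root of the whole tree. -/
def prunedNode (C : AdmissibleCut 𝒢 X hX) (a : C.1) : X.Node := a.1.1

/-- The graph decorating the root of the subtree that is cut off at the arrow `a`. -/
noncomputable def prunedGraph (C : AdmissibleCut 𝒢 X hX) (a : C.1) : AssignedGraph :=
  (C.prunedNode a).graph

/-- The lines of all the subgraphs that decorate the roots of the subtrees that are cut off. -/
def cutLines (C : AdmissibleCut 𝒢 X hX) : Set X.HalfEdge :=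
  ⋃ a : C.1, (C.prunedNode a).lines

theorem isSubgraph_cutLines (C : AdmissibleCut 𝒢 X hX) : X.IsSubgraph C.cutLines :=
  AssignedGraph.isSubgraph_iUnion _ fun a => (C.prunedNode a).isComponent.isHigh.isSubgraph

/-- The graph at the root of the subtree that remains: the subgraphs that decorate the roots of the
subtrees that are cut off are shrunk to vertices. -/
def rootGraph (C : AdmissibleCut 𝒢 X hX) : AssignedGraph :=
  AssignedGraph.shrink C.isSubgraph_cutLines

end AdmissibleCut

/-- The free commutative algebra generated by the Gallavotti-Nicolò trees. -/
abbrev GNAlgebra (𝒢 : GraphClass) (K : Type*) [Field K] : Type _ := MvPolynomial (GNTree 𝒢) K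

/-- The generator given by the tree of an assigned graph. -/
noncomputable def gen {𝒢 : GraphClass} (K : Type*) [Field K] (X : AssignedGraph)
    (hX : 𝒢.Mem X) : GNAlgebra 𝒢 K :=
  MvPolynomial.X (GNTree.of X hX)

/-- The degree `n` part: the span of the products of trees whose degrees add up to `n`. -/
noncomputable def gradedPart (𝒢 : GraphClass) (K : Type*) [Field K] (n : ℕ) :
    Submodule K (GNAlgebra 𝒢 K) :=
  MvPolynomial.weightedHomogeneousSubmodule K GNTree.degree n

end GallavottiNicolo

/-! A Gallavotti–Nicolò tree carries the same information as its graph, because its root is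
decorated with the graph itself (`GNTree.of_eq_of_iff`). High subgraphs that share a vertex are
nested. Hence essential arrows correspond to the high subgraphs other than the whole graph, and two
of them lie on no common path exactly when they cut off disjoint subgraphs. An admissible cut is
thus a nonempty family of disjoint, proper, cuttable high subgraphs (`AdmissibleCut.sum_family`),
the degree is the number of high subgraphs (`degree_gnTree`), and the coproduct is one of
Connes–Kreimer type on graphs.

Every graph that occurs is a subquotient of one fixed `X`: a subgraph `E` in which the lines of `U`
are shrunk. `Subquotient` records this on the half-edges of `X`, so that iterated restriction and
shrinking reduce to operations on sets of lines. Preimage and `Subquotient.lift` are inverse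
bijections between the high subgraphs of `X` that lie in `E` but not in `U` and the high subgraphs
of the subquotient. They preserve cuttability, hence cut families (`Subquotient.sum_cutFamilies`).

For coassociativity, both iterated coproducts reduce, apart from the terms that end in `1`, to a sum
over pairs of cut families `B`, `C`, possibly empty, with each member of `B` inside a member of `C`.
The summand consists of the members of `B`, the members of `C \ B` with `B` shrunk, and `X` with `C`
shrunk. One side chooses `C` and then refines it (`coproduct_prod_quotGen`), the other chooses `B`
and then cuts the quotient (`coproduct_quotGen_internal`).

The coproduct respects the degree because each high subgraph either lies in exactly one member of a
cut or survives in the quotient (`IsCutFamily.ncard_isHigh`). Trees have positive degree, so the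
bialgebra is connected, and the antipode is the geometric series that inverts the identity for
convolution; it is finite in each degree (`exists_hopfAlgebra`). -/

namespace GallavottiNicolo

namespace AssignedGraph

/-! ### Walks, saturated sets of lines, nesting of high subgraphs -/

section Reach

variable {X : AssignedGraph}

theorem Reach.mono {E F : Set X.HalfEdge} (hEF : E ⊆ F) {v w : X.Vertex} (h : X.Reach E v w) :
    X.Reach F v w :=
  Relation.ReflTransGen.mono (fun _ _ ⟨k, hk, h1, h2⟩ => ⟨k, hEF hk, h1, h2⟩) _ _ h

theorem reach_of_mem {E : Set X.HalfEdge} {h : X.HalfEdge} (hh : h ∈ E) :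
    X.Reach E (X.vert h) (X.vert (X.inv h)) :=
  Relation.ReflTransGen.single ⟨h, hh, rfl, rfl⟩

theorem Reach.eq_of_notMem {U : Set X.HalfEdge} {v w : X.Vertex} (h : X.Reach U v w)
    (hv : v ∉ X.verts U) : v = w := by
  induction h using Relation.ReflTransGen.head_induction_on with
  | refl => rfl
  | head hs _ _ =>
    obtain ⟨k, hk, rfl, -⟩ := hs
    exact (hv ⟨k, hk, rfl⟩).elim

/-- Every half-edge of `U` at a vertex of `E` belongs to `E`. -/
def Saturated (U E : Set X.HalfEdge) : Prop := ∀ h ∈ U, X.vert h ∈ X.verts E → h ∈ E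

/-- A walk along `U` that starts in `E` never leaves it: each line of `U` met at a vertex of `E`
belongs to `E` and leads to another vertex of `E`. -/
theorem Reach.inter_and_mem_verts {U E : Set X.HalfEdge} (hE : X.IsSubgraph E)
    (hs : Saturated U E) {v w : X.Vertex} (h : X.Reach U v w) (hv : v ∈ X.verts E) :
    X.Reach (U ∩ E) v w ∧ w ∈ X.verts E := by
  induction h with
  | refl => exact ⟨.refl, hv⟩
  | tail _ hst ih =>
    obtain ⟨k, hk, rfl, rfl⟩ := hst
    have hkE := hs k hk ih.2
    exact ⟨ih.1.tail ⟨k, ⟨hk, hkE⟩, rfl, rfl⟩, _, hE.inv_mem k hkE, rfl⟩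

theorem Reach.mem_verts {U E : Set X.HalfEdge} (hE : X.IsSubgraph E) (hs : Saturated U E)
    {v w : X.Vertex} (h : X.Reach U v w) (hv : v ∈ X.verts E) : w ∈ X.verts E :=
  (h.inter_and_mem_verts hE hs hv).2

theorem Reach.inter {U E : Set X.HalfEdge} (hE : X.IsSubgraph E) (hs : Saturated U E)
    {v w : X.Vertex} (h : X.Reach U v w) (hv : v ∈ X.verts E) : X.Reach (U ∩ E) v w :=
  (h.inter_and_mem_verts hE hs hv).1

/-- The quotient is by the equivalence relation generated by single steps; as `U` is closed under
`inv`, reachability is already symmetric and is that relation. -/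
theorem quot_eq_iff {U : Set X.HalfEdge} (hU : X.IsSubgraph U) {v w : X.Vertex} :
    (Quot.mk (fun v w => ∃ h ∈ U, X.vert h = v ∧ X.vert (X.inv h) = w) v =
      Quot.mk (fun v w => ∃ h ∈ U, X.vert h = v ∧ X.vert (X.inv h) = w) w) ↔ X.Reach U v w := by
  constructor
  · intro h
    have := Quot.eqvGen_exact h
    clear h
    induction this with
    | rel _ _ h => exact Relation.ReflTransGen.single h
    | refl => exact .refl
    | symm _ _ _ ih => exact reach_symm hU.inv_mem ih
    | trans _ _ _ _ _ ih1 ih2 => exact ih1.trans ih2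
  · intro h
    induction h with
    | refl => rfl
    | tail _ hst ih => exact ih.trans (Quot.sound hst)

theorem isSubgraph_empty : X.IsSubgraph (∅ : Set X.HalfEdge) :=
  ⟨fun _ h => h.elim, fun _ h => h.elim⟩

theorem IsSubgraph.mem_of_inv_mem {U : Set X.HalfEdge} (hU : X.IsSubgraph U) {h : X.HalfEdge}
    (hh : X.inv h ∈ U) : h ∈ U := by
  simpa [X.inv_inv] using hU.inv_mem _ hh

/-- A high subgraph is a component at the level given by its lowest line. -/
theorem IsHigh.exists_isComponent {E : Set X.HalfEdge} (hE : X.IsHigh E) :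
    ∃ i, X.IsComponent i E := by
  obtain ⟨h, hh, hmin⟩ := Set.exists_min_image E X.scale (Set.toFinite E) hE.nonempty
  obtain ⟨n, hn⟩ := scale_eq_coe_of_mem_internal (hE.isSubgraph.internal h hh)
  exact ⟨n, hE, fun k hk => hn ▸ hmin k hk, fun l hl => hn ▸ hE.high h hh l hl⟩

/-- High subgraphs that share a vertex are nested. -/
theorem IsHigh.subset_or_subset {E F : Set X.HalfEdge} (hE : X.IsHigh E) (hF : X.IsHigh F)
    {v : X.Vertex} (hvE : v ∈ X.verts E) (hvF : v ∈ X.verts F) : E ⊆ F ∨ F ⊆ E := by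
  obtain ⟨i, hi⟩ := hE.exists_isComponent
  obtain ⟨j, hj⟩ := hF.exists_isComponent
  -- Of two components that meet, the one taken at the lower threshold contains the other.
  rcases le_total i j with hij | hij
  · obtain ⟨k, hk, rfl⟩ := hvF
    refine Or.inr (hi.subset hij hj (mem_of_mem_verts hi.scale_lt hvE ?_) hk)
    exact le_trans (by exact_mod_cast hij) (hj.le_scale k hk)
  · obtain ⟨k, hk, rfl⟩ := hvE
    refine Or.inl (hj.subset hij hi (mem_of_mem_verts hj.scale_lt hvF ?_) hk)
    exact le_trans (by exact_mod_cast hij) (hi.le_scale k hk)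

/-- A connected subgraph that lies in `V` and meets a subgraph saturated in `V` lies in it. -/
theorem IsHigh.subset_of_saturated {A B V : Set X.HalfEdge} (hA : X.IsHigh A)
    (hB : X.IsSubgraph B) (hAV : A ⊆ V) (hs : Saturated V B) {h : X.HalfEdge} (h1 : h ∈ A)
    (h2 : h ∈ B) : A ⊆ B := fun k hk =>
  hs k (hAV hk) (((hA.connected _ ⟨h, h1, rfl⟩ _ ⟨k, hk, rfl⟩).mono hAV).mem_verts hB hs
    ⟨h, h2, rfl⟩)

/-- Disjoint high subgraphs have no vertex in common. -/
theorem IsHigh.saturated_of_disjoint {A B : Set X.HalfEdge} (hA : X.IsHigh A) (hB : X.IsHigh B)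
    (hd : Disjoint A B) : Saturated A B := by
  intro h hh hv
  rcases hA.subset_or_subset hB ⟨h, hh, rfl⟩ hv with h1 | h1
  · exact h1 hh
  · obtain ⟨k, hk⟩ := hB.nonempty
    exact (Set.disjoint_left.1 hd (h1 hk) hk).elim

theorem IsHigh.subset_or_subset_or_disjoint {A B : Set X.HalfEdge} (hA : X.IsHigh A)
    (hB : X.IsHigh B) : A ⊆ B ∨ B ⊆ A ∨ Disjoint A B := by
  by_cases h : Disjoint A B
  · exact Or.inr (Or.inr h)
  · obtain ⟨k, hk1, hk2⟩ := Set.not_disjoint_iff.1 h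
    exact (hA.subset_or_subset hB ⟨k, hk1, rfl⟩ ⟨k, hk2, rfl⟩).imp_right Or.inl

/-- A connected graph has a line, so no vertex is isolated. This lets vertices be recovered from
half-edges in a `Subquotient`. -/
theorem IsConnected.vert_surjective (hX : X.IsConnected) :
    Function.Surjective X.vert := by
  intro v
  obtain ⟨h, -⟩ := hX.1
  rcases Relation.ReflTransGen.cases_head (hX.2 v (X.vert h)) with h0 | ⟨w, ⟨k, -, hk, -⟩, -⟩
  exacts [⟨h, h0.symm⟩, ⟨k, hk⟩]

theorem IsConnected.mem_verts_internal (hX : X.IsConnected) (v : X.Vertex) :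
    v ∈ X.verts X.internal := by
  obtain ⟨h, hh⟩ := hX.1
  rcases Relation.ReflTransGen.cases_head (hX.2 v (X.vert h)) with h0 | ⟨w, ⟨k, hk, hkv, -⟩, -⟩
  exacts [⟨h, hh, h0.symm⟩, ⟨k, hk, hkv⟩]

theorem IsConnected.isHigh_internal (hX : X.IsConnected) : X.IsHigh X.internal :=
  hX.isComponent.isHigh

/-- Each vertex of a high subgraph that is not contained in `V` is joined by lines of `V` to a
half-edge of the subgraph outside of `V`. -/
theorem IsHigh.exists_reach {E V : Set X.HalfEdge} (hE : X.IsHigh E) (hEV : ¬ E ⊆ V)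
    {v : X.Vertex} (hv : v ∈ X.verts E) : ∃ h ∈ E, h ∉ V ∧ X.Reach V v (X.vert h) := by
  obtain ⟨h0, h0E, h0V⟩ := Set.not_subset.1 hEV
  -- Walk towards a half-edge outside `V` and stop at the first one that is not in `V`.
  have := hE.connected v hv (X.vert h0) ⟨h0, h0E, rfl⟩
  clear hv
  induction this using Relation.ReflTransGen.head_induction_on with
  | refl => exact ⟨h0, h0E, h0V, .refl⟩
  | head hst _ ih =>
    obtain ⟨h, hh, rfl, rfl⟩ := hst
    by_cases hV : h ∈ V
    · obtain ⟨k, hk, hkV, hr⟩ := ih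
      exact ⟨k, hk, hkV, Relation.ReflTransGen.head ⟨h, hV, rfl, rfl⟩ hr⟩
    · exact ⟨h, hh, hV, .refl⟩

end Reach

/-! ### Subquotients presented on the half-edges of a fixed graph -/

/-- A presentation of `Y` as a subquotient of `X`: the subgraph with lines `E` in which the lines of
`U` are shrunk. The half-edges of `Y` are identified with half-edges of `X`. -/
structure Subquotient (X : AssignedGraph) (E U : Set X.HalfEdge) (Y : AssignedGraph) where
  toFun : Y.HalfEdge → X.HalfEdge
  injective : Function.Injective toFun
  mem_range_iff : ∀ h, h ∈ Set.range toFun ↔ X.vert h ∈ X.verts E ∧ h ∉ U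
  vert_eq_iff : ∀ h k, Y.vert h = Y.vert k ↔ X.Reach U (X.vert (toFun h)) (X.vert (toFun k))
  inv_of_mem : ∀ h, toFun h ∈ E → toFun (Y.inv h) = X.inv (toFun h)
  inv_of_notMem : ∀ h, toFun h ∉ E → Y.inv h = h
  scale_of_mem : ∀ h, toFun h ∈ E → Y.scale h = X.scale (toFun h)
  vert_surjective : Function.Surjective Y.vert

namespace Subquotient

variable {X Y Z : AssignedGraph} {E U : Set X.HalfEdge}

theorem vert_mem (p : Subquotient X E U Y) (k : Y.HalfEdge) : X.vert (p.toFun k) ∈ X.verts E :=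
  ((p.mem_range_iff _).1 ⟨k, rfl⟩).1

theorem toFun_notMem (p : Subquotient X E U Y) (k : Y.HalfEdge) : p.toFun k ∉ U :=
  ((p.mem_range_iff _).1 ⟨k, rfl⟩).2

theorem exists_toFun_eq (p : Subquotient X E U Y) {h : X.HalfEdge} (h1 : X.vert h ∈ X.verts E)
    (h2 : h ∉ U) : ∃ k, p.toFun k = h :=
  (p.mem_range_iff h).2 ⟨h1, h2⟩

theorem scale_of_notMem (p : Subquotient X E U Y) {k : Y.HalfEdge} (hk : p.toFun k ∉ E) :
    Y.scale k = ⊥ :=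
  (Y.scale_eq_bot_iff k).2 (p.inv_of_notMem k hk)

theorem inv_eq_iff (p : Subquotient X E U Y) (hE : X.IsSubgraph E) (k : Y.HalfEdge) :
    Y.inv k = k ↔ p.toFun k ∉ E := by
  refine ⟨fun h hk => hE.internal _ hk ?_, p.inv_of_notMem k⟩
  rw [← p.inv_of_mem k hk, h]

theorem internal_eq (p : Subquotient X E U Y) (hE : X.IsSubgraph E) :
    Y.internal = p.toFun ⁻¹' E := by
  ext k
  exact (not_congr (p.inv_eq_iff hE k)).trans not_not

/-- Two graphs with the same presentation are isomorphic. -/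
theorem isIso (p : Subquotient X E U Y) (q : Subquotient X E U Z) : Y.IsIso Z := by
  have hrange : Set.range p.toFun = Set.range q.toFun := by
    ext h
    rw [p.mem_range_iff, q.mem_range_iff]
  let e : Y.HalfEdge ≃ Z.HalfEdge := (Equiv.ofInjective _ p.injective).trans
    ((Equiv.setCongr hrange).trans (Equiv.ofInjective _ q.injective).symm)
  have he : ∀ k, q.toFun (e k) = p.toFun k := fun k =>
    congrArg Subtype.val ((Equiv.ofInjective _ q.injective).apply_symm_apply _)
  have hv : ∀ h k, Z.vert (e h) = Z.vert (e k) ↔ Y.vert h = Y.vert k := fun h k => by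
    rw [q.vert_eq_iff, p.vert_eq_iff, he, he]
  -- Vertices are matched through their half-edges; this is well defined because in both graphs two
  -- half-edges share a vertex exactly when they are joined along `U`.
  let g : Y.Vertex → Z.Vertex := fun v => Z.vert (e (Function.surjInv p.vert_surjective v))
  have hg : ∀ h, g (Y.vert h) = Z.vert (e h) := fun h =>
    (hv _ _).2 (Function.surjInv_eq p.vert_surjective _)
  have hgb : Function.Bijective g := by
    constructor
    · intro v w hvw
      obtain ⟨h, rfl⟩ := p.vert_surjective v
      obtain ⟨k, rfl⟩ := p.vert_surjective w
      rw [hg, hg] at hvw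
      exact (hv _ _).1 hvw
    · intro w
      obtain ⟨k, rfl⟩ := q.vert_surjective w
      exact ⟨Y.vert (e.symm k), by rw [hg, Equiv.apply_symm_apply]⟩
  refine ⟨⟨Equiv.ofBijective g hgb, e, fun h => (hg h).symm, fun h => ?_, fun h => ?_⟩⟩
  · by_cases hh : p.toFun h ∈ E
    · apply q.injective
      rw [q.inv_of_mem _ (by rwa [he]), he, he, p.inv_of_mem _ hh]
    · rw [p.inv_of_notMem _ hh, q.inv_of_notMem _ (by rwa [he])]
  · by_cases hh : p.toFun h ∈ E
    · rw [p.scale_of_mem _ hh, q.scale_of_mem _ (by rwa [he]), he]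
    · rw [p.scale_of_notMem hh, q.scale_of_notMem (by rwa [he])]

/-- Walks in a subquotient are walks in the graph that may use the shrunk lines. -/
theorem reach_iff (p : Subquotient X E U Y) {W : Set X.HalfEdge}
    (hW : W ⊆ E) (k l : Y.HalfEdge) :
    Y.Reach (p.toFun ⁻¹' W) (Y.vert k) (Y.vert l) ↔
      X.Reach (U ∪ W) (X.vert (p.toFun k)) (X.vert (p.toFun l)) := by
  constructor
  · suffices h : ∀ w, Y.Reach (p.toFun ⁻¹' W) (Y.vert k) w → ∀ l, Y.vert l = w →
        X.Reach (U ∪ W) (X.vert (p.toFun k)) (X.vert (p.toFun l)) from fun hr => h _ hr l rfl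
    intro w hr
    induction hr with
    | refl => exact fun l hl => ((p.vert_eq_iff k l).1 hl.symm).mono Set.subset_union_left
    | tail _ hst ih =>
      obtain ⟨f, hf, hfv, rfl⟩ := hst
      intro l hl
      refine (ih f hfv).trans (Relation.ReflTransGen.trans (reach_of_mem (Or.inr hf)) ?_)
      rw [← p.inv_of_mem f (hW hf)]
      exact ((p.vert_eq_iff _ _).1 hl.symm).mono Set.subset_union_left
  -- A walk in `X` may pass through vertices without a half-edge of `Y`, so the induction follows
  -- any half-edge of `Y` reachable along `U` from the current vertex.
  · suffices h : ∀ w, X.Reach (U ∪ W) (X.vert (p.toFun k)) w → ∀ l,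
        X.Reach U w (X.vert (p.toFun l)) → Y.Reach (p.toFun ⁻¹' W) (Y.vert k) (Y.vert l) from
      fun hr => h _ hr l .refl
    intro w hr
    induction hr with
    | refl =>
      intro l hl
      rw [(p.vert_eq_iff k l).2 hl]
      exact .refl
    | tail _ hst ih =>
      obtain ⟨h, hh, rfl, rfl⟩ := hst
      intro l hl
      by_cases hU : h ∈ U
      · exact ih l (Relation.ReflTransGen.head ⟨h, hU, rfl, rfl⟩ hl)
      · have hhW := hh.resolve_left hU
        obtain ⟨f, rfl⟩ := p.exists_toFun_eq ⟨h, hW hhW, rfl⟩ hU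
        refine (ih f .refl).tail ⟨f, hhW, rfl, (p.vert_eq_iff _ _).2 ?_⟩
        rwa [p.inv_of_mem f (hW hhW)]

end Subquotient

/-! ### Subgraphs and quotients as subquotients -/

section Constructions

variable {X Y : AssignedGraph} {E U : Set X.HalfEdge}

/-- A graph that is isomorphic to a connected graph is a presentation of it. -/
def Iso.subquotient (f : Iso X Y) (hX : X.IsConnected) : Subquotient X X.internal ∅ Y where
  toFun := f.onHalfEdge.symm
  injective := f.onHalfEdge.symm.injective
  mem_range_iff h := by simp [hX.mem_verts_internal]
  vert_eq_iff h k := by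
    have h1 := f.vert_map (f.onHalfEdge.symm h)
    have h2 := f.vert_map (f.onHalfEdge.symm k)
    rw [Equiv.apply_symm_apply] at h1 h2
    rw [h1, h2, f.onVertex.apply_eq_iff_eq]
    refine ⟨fun h => h ▸ .refl, fun h => h.eq_of_notMem ?_⟩
    rintro ⟨_, h, -⟩
    exact h
  inv_of_mem h _ := by
    rw [Equiv.symm_apply_eq, ← f.inv_map, Equiv.apply_symm_apply]
  inv_of_notMem h hh := by
    have h1 := f.inv_map (f.onHalfEdge.symm h)
    rw [not_not.1 hh, Equiv.apply_symm_apply] at h1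
    exact h1
  scale_of_mem h _ := by
    rw [← f.scale_map, Equiv.apply_symm_apply]
  vert_surjective := fun w => by
    obtain ⟨h, hh⟩ := hX.vert_surjective (f.onVertex.symm w)
    exact ⟨f.onHalfEdge h, by rw [f.vert_map, hh, Equiv.apply_symm_apply]⟩

/-- A connected graph as a presentation of itself. -/
def IsConnected.subquotient (hX : X.IsConnected) : Subquotient X X.internal ∅ X :=
  Iso.subquotient ⟨Equiv.refl _, Equiv.refl _, fun _ => rfl, fun _ => rfl, fun _ => rfl⟩ hX

/-- Saturation keeps walks along `U` inside `A`. Conversely, a vertex of `A` that touches only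
shrunk lines is joined by them to a surviving half-edge of `A`, which has the same vertex in `Y`. -/
theorem Subquotient.vert_mem_verts_iff (p : Subquotient X E U Y) {A : Set X.HalfEdge}
    (hA : X.IsHigh A) (hAE : A ⊆ E) (hAU : ¬ A ⊆ U) (hU : X.IsSubgraph U) (hs : Saturated U A)
    (k : Y.HalfEdge) :
    Y.vert k ∈ Y.verts (p.toFun ⁻¹' A) ↔ X.vert (p.toFun k) ∈ X.verts A := by
  constructor
  · rintro ⟨f, hf, hfk⟩
    exact ((p.vert_eq_iff f k).1 hfk).mem_verts hA.isSubgraph hs ⟨_, hf, rfl⟩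
  · intro hk
    obtain ⟨h, hhA, hhU, hr⟩ := hA.exists_reach hAU hk
    obtain ⟨f, rfl⟩ := p.exists_toFun_eq ⟨h, hAE hhA, rfl⟩ hhU
    exact ⟨f, hhA, (p.vert_eq_iff _ _).2 (reach_symm hU.inv_mem hr)⟩

theorem Subquotient.isSubgraph_preimage (p : Subquotient X E U Y) {W : Set X.HalfEdge}
    (hW : X.IsSubgraph W) (hWE : W ⊆ E) : Y.IsSubgraph (p.toFun ⁻¹' W) := by
  refine ⟨fun k hk h0 => hW.internal _ hk ?_, fun k hk => ?_⟩
  · rw [← p.inv_of_mem k (hWE hk), h0]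
  · change p.toFun (Y.inv k) ∈ W
    rw [p.inv_of_mem k (hWE hk)]
    exact hW.inv_mem _ hk

/-- A subgraph of a subquotient is a subquotient. -/
noncomputable def Subquotient.sub (p : Subquotient X E U Y) {A : Set X.HalfEdge}
    (hA : X.IsHigh A) (hAE : A ⊆ E) (hAU : ¬ A ⊆ U) (hU : X.IsSubgraph U) (hs : Saturated U A)
    (hF : Y.IsSubgraph (p.toFun ⁻¹' A)) : Subquotient X A U (AssignedGraph.sub hF) where
  toFun k := p.toFun k.1
  injective k l h := Subtype.ext (p.injective h)
  mem_range_iff h := by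
    constructor
    · rintro ⟨⟨k, hk⟩, rfl⟩
      exact ⟨(p.vert_mem_verts_iff hA hAE hAU hU hs k).1 hk, p.toFun_notMem k⟩
    · rintro ⟨h1, h2⟩
      obtain ⟨k, rfl⟩ := p.exists_toFun_eq (Set.image_mono hAE h1) h2
      exact ⟨⟨k, (p.vert_mem_verts_iff hA hAE hAU hU hs k).2 h1⟩, rfl⟩
  vert_eq_iff h k := Subtype.ext_iff.trans (p.vert_eq_iff h.1 k.1)
  inv_of_mem k hk := by
    have hk' : k.1 ∈ p.toFun ⁻¹' A := hk
    exact (congrArg (fun l => p.toFun (Subtype.val l)) (dif_pos hk')).trans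
      (p.inv_of_mem k.1 (hAE hk))
  inv_of_notMem k hk := by
    have hk' : k.1 ∉ p.toFun ⁻¹' A := hk
    exact dif_neg hk'
  scale_of_mem k hk := by
    have hk' : k.1 ∈ p.toFun ⁻¹' A := hk
    simp only [AssignedGraph.sub, hk', if_pos]
    exact p.scale_of_mem k.1 (hAE hk)
  vert_surjective := by
    rintro ⟨_, f, hf, rfl⟩
    exact ⟨⟨f, f, hf, rfl⟩, rfl⟩

/-- Shrinking lines of a subquotient gives a subquotient. -/
def Subquotient.shrink (p : Subquotient X E U Y) (hE : X.IsHigh E) {W : Set X.HalfEdge}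
    (hWE : W ⊆ E) (hEW : ¬ E ⊆ U ∪ W) (hF : Y.IsSubgraph (p.toFun ⁻¹' W)) :
    Subquotient X E (U ∪ W) (AssignedGraph.shrink hF) where
  toFun k := p.toFun k.1
  injective k l h := Subtype.ext (p.injective h)
  mem_range_iff h := by
    constructor
    · rintro ⟨⟨k, hk⟩, rfl⟩
      exact ⟨p.vert_mem k, fun h => h.elim (p.toFun_notMem k) hk⟩
    · rintro ⟨h1, h2⟩
      obtain ⟨k, rfl⟩ := p.exists_toFun_eq h1 fun h => h2 (Or.inl h)
      exact ⟨⟨k, fun h => h2 (Or.inr h)⟩, rfl⟩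
  vert_eq_iff h k := (quot_eq_iff hF).trans (p.reach_iff hWE h.1 k.1)
  inv_of_mem k hk := p.inv_of_mem k.1 hk
  inv_of_notMem k hk := Subtype.ext (p.inv_of_notMem k.1 hk)
  scale_of_mem k hk := p.scale_of_mem k.1 hk
  vert_surjective := by
    rintro ⟨v⟩
    obtain ⟨k, rfl⟩ := p.vert_surjective v
    -- Since the shrunk lines do not exhaust `E`, each vertex of the quotient keeps a half-edge.
    obtain ⟨h, hhE, hhV, hr⟩ := hE.exists_reach hEW (p.vert_mem k)
    obtain ⟨l, rfl⟩ := p.exists_toFun_eq ⟨h, hhE, rfl⟩ fun h => hhV (Or.inl h)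
    exact ⟨⟨l, fun h => hhV (Or.inr h)⟩,
      ((quot_eq_iff hF).2 ((p.reach_iff hWE k l).2 hr)).symm⟩

/-- Only the shrunk lines that belong to the subgraph matter. -/
def Subquotient.inter (p : Subquotient X E U Y) (hE : X.IsSubgraph E) (hs : Saturated U E) :
    Subquotient X E (U ∩ E) Y where
  __ := p
  mem_range_iff h := by
    refine (p.mem_range_iff h).trans (and_congr_right fun h1 => not_congr ?_)
    exact ⟨fun h2 => ⟨h2, hs h h2 h1⟩, fun h2 => h2.1⟩
  vert_eq_iff h k := (p.vert_eq_iff h k).trans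
    ⟨fun hr => hr.inter hE hs (p.vert_mem h), fun hr => hr.mono Set.inter_subset_left⟩

/-- A high subgraph as a subquotient. -/
noncomputable def IsConnected.subquotientSub (hX : X.IsConnected) {A : Set X.HalfEdge}
    (hA : X.IsHigh A) : Subquotient X A ∅ (AssignedGraph.sub hA.isSubgraph) :=
  hX.subquotient.sub hA hA.isSubgraph.internal
    (fun h => hA.nonempty.ne_empty (Set.subset_empty_iff.1 h)) isSubgraph_empty
    (fun _ h => h.elim) hA.isSubgraph

/-- A quotient as a subquotient. -/
def IsConnected.subquotientShrink (hX : X.IsConnected) {W : Set X.HalfEdge}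
    (hW : X.IsSubgraph W) (h : ¬ X.internal ⊆ W) :
    Subquotient X X.internal W (AssignedGraph.shrink hW) :=
  -- The general construction produces `∅ ∪ W`; the cast turns it into `W`.
  cast (by rw [Set.empty_union]; rfl) (hX.subquotient.shrink (W := W) hX.isHigh_internal
    hW.internal (by rwa [Set.empty_union]) hW)

end Constructions

/-! ### Subgraphs that may be shrunk -/

/-- The connected subgraph with lines `E` stays connected when any one of its lines is cut. -/
def IsOnePISub (X : AssignedGraph) (E : Set X.HalfEdge) : Prop :=
  ∀ h ∈ E, ∀ v ∈ X.verts E, ∀ w ∈ X.verts E, X.Reach (E \ {h, X.inv h}) v w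

/-- A high subgraph that may be shrunk to a vertex: it has two or four external legs, and it is one
particle irreducible if only such graphs are considered. -/
structure IsCuttable (𝒢 : GraphClass) (X : AssignedGraph) (E : Set X.HalfEdge) : Prop where
  isHigh : X.IsHigh E
  ncard_legs : (X.legs E).ncard = 2 ∨ (X.legs E).ncard = 4
  onePI : 𝒢.onePIOnly → X.IsOnePISub E

/-- The set of lines of a family of disjoint cuttable subgraphs. -/
def IsCutUnion (𝒢 : GraphClass) (X : AssignedGraph) (U : Set X.HalfEdge) : Prop :=
  ∀ h ∈ U, ∃ B, IsCuttable 𝒢 X B ∧ h ∈ B ∧ B ⊆ U ∧ Saturated U B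

/-! ### Transfer of high, irreducible and cuttable subgraphs to subquotients -/

section Transfer

variable {𝒢 : GraphClass} {X Y : AssignedGraph} {E U : Set X.HalfEdge}

theorem isCutUnion_empty : IsCutUnion 𝒢 X ∅ := fun _ h => h.elim

theorem IsCutUnion.isSubgraph (hU : IsCutUnion 𝒢 X U) : X.IsSubgraph U := by
  refine ⟨fun h hh => ?_, fun h hh => ?_⟩
  · obtain ⟨B, hB, hhB, -, -⟩ := hU h hh
    exact hB.isHigh.isSubgraph.internal h hhB
  · obtain ⟨B, hB, hhB, hBU, -⟩ := hU h hh
    exact hBU (hB.isHigh.isSubgraph.inv_mem h hhB)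

/-- A shrunk component that touches `A` is nested with it, and it cannot contain `A`, so it lies
inside `A`. -/
theorem IsHigh.saturated {A : Set X.HalfEdge} (hA : X.IsHigh A) (hU : IsCutUnion 𝒢 X U)
    (hAU : ¬ A ⊆ U) : Saturated U A := by
  intro h hh hv
  obtain ⟨B, hB, hhB, hBU, -⟩ := hU h hh
  rcases hA.subset_or_subset hB.isHigh hv ⟨h, hhB, rfl⟩ with h1 | h1
  · exact (hAU (h1.trans hBU)).elim
  · exact h1 hhB

namespace Subquotient

variable (p : Subquotient X E U Y)
include p

/-- Legs of the preimage come from legs of `A`; their scales are unchanged or drop to `⊥`, so they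
stay below the lines of `A`. -/
theorem isHigh_preimage {A : Set X.HalfEdge} (hA : X.IsHigh A) (hAE : A ⊆ E) (hAU : ¬ A ⊆ U)
    (hU : IsCutUnion 𝒢 X U) : Y.IsHigh (p.toFun ⁻¹' A) := by
  have hs := hA.saturated hU hAU
  refine ⟨p.isSubgraph_preimage hA.isSubgraph hAE, ?_, ?_, ?_⟩
  · obtain ⟨h, hhA, hhU⟩ := Set.not_subset.1 hAU
    obtain ⟨f, rfl⟩ := p.exists_toFun_eq ⟨h, hAE hhA, rfl⟩ hhU
    exact ⟨f, hhA⟩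
  · rintro _ ⟨k, hk, rfl⟩ _ ⟨l, hl, rfl⟩
    exact (p.reach_iff hAE k l).2 ((hA.connected _ ⟨_, hk, rfl⟩ _ ⟨_, hl, rfl⟩).mono
      Set.subset_union_right)
  · rintro f hf l ⟨hlv, hl⟩
    rw [p.scale_of_mem f (hAE hf)]
    have hl' : p.toFun l ∈ X.legs A :=
      ⟨(p.vert_mem_verts_iff hA hAE hAU hU.isSubgraph hs l).1 hlv, hl⟩
    have hlt := hA.high _ hf _ hl'
    by_cases hlE : p.toFun l ∈ E
    · rwa [p.scale_of_mem l hlE]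
    · rw [p.scale_of_notMem hlE]
      exact lt_of_le_of_lt bot_le hlt

/-- The lines of a subgraph of a subquotient together with the shrunk lines that they touch. -/
def lift (F : Set Y.HalfEdge) : Set X.HalfEdge :=
  {h | (∃ f ∈ F, p.toFun f = h) ∨ (h ∈ U ∧ ∃ f ∈ F, X.Reach U (X.vert h) (X.vert (p.toFun f)))}

theorem preimage_lift (F : Set Y.HalfEdge) : p.toFun ⁻¹' (p.lift F) = F := by
  ext k
  constructor
  · rintro (⟨f, hf, hfk⟩ | ⟨hk, -⟩)
    · exact p.injective hfk ▸ hf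
    · exact (p.toFun_notMem k hk).elim
  · exact fun hk => Or.inl ⟨k, hk, rfl⟩

theorem lift_not_subset {F : Set Y.HalfEdge} (hF : F.Nonempty) : ¬ p.lift F ⊆ U := by
  obtain ⟨f, hf⟩ := hF
  exact fun h => p.toFun_notMem f (h (Or.inl ⟨f, hf, rfl⟩))

/-- Shrunk components touching `A` lie in it by saturation, and each shrunk line of `A` is linked
through shrunk lines to a surviving line of `A`. -/
theorem lift_preimage {A : Set X.HalfEdge} (hA : X.IsHigh A) (hAE : A ⊆ E) (hAU : ¬ A ⊆ U)
    (hU : IsCutUnion 𝒢 X U) : p.lift (p.toFun ⁻¹' A) = A := by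
  have hs := hA.saturated hU hAU
  ext h
  constructor
  · rintro (⟨f, hf, rfl⟩ | ⟨hh, f, hf, hr⟩)
    · exact hf
    · exact hs h hh ((reach_symm hU.isSubgraph.inv_mem hr).mem_verts hA.isSubgraph hs
        ⟨_, hf, rfl⟩)
  · intro hh
    by_cases hhU : h ∈ U
    · obtain ⟨k, hk, hkU, hr⟩ := hA.exists_reach hAU ⟨h, hh, rfl⟩
      obtain ⟨f, rfl⟩ := p.exists_toFun_eq ⟨k, hAE hk, rfl⟩ hkU
      exact Or.inr ⟨hhU, f, hk, hr⟩
    · obtain ⟨f, rfl⟩ := p.exists_toFun_eq ⟨h, hAE hh, rfl⟩ hhU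
      exact Or.inl ⟨f, hh, rfl⟩

theorem mem_of_isHigh {F : Set Y.HalfEdge} (hF : Y.IsHigh F)
    {f : Y.HalfEdge} (hf : f ∈ F) : p.toFun f ∈ E := by
  by_contra h
  exact hF.isSubgraph.internal f hf (p.inv_of_notMem f h)

theorem lift_subset (hE : X.IsHigh E) (hU : IsCutUnion 𝒢 X U) (hEU : ¬ E ⊆ U)
    {F : Set Y.HalfEdge} (hF : Y.IsHigh F) : p.lift F ⊆ E := by
  have hs := hE.saturated hU hEU
  rintro h (⟨f, hf, rfl⟩ | ⟨hh, f, hf, hr⟩)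
  · exact p.mem_of_isHigh hF hf
  · exact hs h hh ((reach_symm hU.isSubgraph.inv_mem hr).mem_verts hE.isSubgraph hs
      ⟨_, p.mem_of_isHigh hF hf, rfl⟩)

/-- Each vertex of the lift is joined within it to a surviving line, so connectedness follows from
that of `F`. Scales are compared first with the surviving lines and then with the shrunk ones. -/
theorem isHigh_lift (hE : X.IsHigh E) (hU : IsCutUnion 𝒢 X U) (hEU : ¬ E ⊆ U)
    {F : Set Y.HalfEdge} (hF : Y.IsHigh F) : X.IsHigh (p.lift F) := by
  have hAE := p.lift_subset hE hU hEU hF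
  have hFE : ∀ f ∈ F, p.toFun f ∈ E := fun f hf => p.mem_of_isHigh hF hf
  have hsub : X.IsSubgraph (p.lift F) := by
    refine ⟨fun h hh => hE.isSubgraph.internal h (hAE hh), ?_⟩
    rintro h (⟨f, hf, rfl⟩ | ⟨hh, f, hf, hr⟩)
    · exact Or.inl ⟨_, hF.isSubgraph.inv_mem f hf, p.inv_of_mem f (hFE f hf)⟩
    · refine Or.inr ⟨hU.isSubgraph.inv_mem h hh, f, hf, Relation.ReflTransGen.trans ?_ hr⟩
      exact reach_symm hU.isSubgraph.inv_mem (reach_of_mem hh)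
  have hrep : ∀ v ∈ X.verts (p.lift F), ∃ f ∈ F, X.Reach U v (X.vert (p.toFun f)) := by
    rintro _ ⟨h, ⟨f, hf, rfl⟩ | ⟨hh, f, hf, hr⟩, rfl⟩
    exacts [⟨f, hf, .refl⟩, ⟨f, hf, hr⟩]
  have hs : Saturated U (p.lift F) := fun h hh hv => Or.inr ⟨hh, hrep _ hv⟩
  refine ⟨hsub, ?_, ?_, ?_⟩
  · obtain ⟨f, hf⟩ := hF.nonempty
    exact ⟨_, Or.inl ⟨f, hf, rfl⟩⟩
  · have h1 : ∀ v ∈ X.verts (p.lift F), ∃ f ∈ F, X.Reach (p.lift F) v (X.vert (p.toFun f)) := by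
      intro v hv
      obtain ⟨f, hf, hr⟩ := hrep v hv
      exact ⟨f, hf, (hr.inter hsub hs hv).mono Set.inter_subset_right⟩
    intro v hv w hw
    obtain ⟨f, hf, hvf⟩ := h1 v hv
    obtain ⟨g, hg, hwg⟩ := h1 w hw
    refine hvf.trans (Relation.ReflTransGen.trans ?_ (reach_symm hsub.inv_mem hwg))
    have h2 := hF.connected _ ⟨f, hf, rfl⟩ _ ⟨g, hg, rfl⟩
    rw [← p.preimage_lift F, p.reach_iff hAE] at h2
    refine (h2.inter hsub ?_ ⟨_, Or.inl ⟨f, hf, rfl⟩, rfl⟩).mono Set.inter_subset_right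
    rintro h (hh | hh) hv
    exacts [hs h hh hv, hh]
  · have key : ∀ f ∈ F, ∀ l ∈ X.legs (p.lift F), X.scale l < X.scale (p.toFun f) := by
      rintro f hf l ⟨hlv, hl⟩
      have hlU : l ∉ U := fun h => hl (hs l h hlv)
      obtain ⟨k, rfl⟩ := p.exists_toFun_eq (Set.image_mono hAE hlv) hlU
      by_cases hkE : p.toFun k ∈ E
      · rw [← p.scale_of_mem k hkE, ← p.scale_of_mem f (hFE f hf)]
        refine hF.high f hf k ⟨?_, fun h => hl (Or.inl ⟨k, h, rfl⟩)⟩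
        obtain ⟨g, hg, hr⟩ := hrep _ hlv
        exact ⟨g, hg, ((p.vert_eq_iff k g).2 hr).symm⟩
      · exact hE.high _ (hFE f hf) _ ⟨p.vert_mem k, hkE⟩
    rintro h (⟨f, hf, rfl⟩ | ⟨hh, f, hf, hr⟩) l hl
    · exact key f hf l hl
    -- The surviving half-edge `f` is a leg of the high component `B` of `h`, so its scale lies
    -- between those of `l` and `h`.
    · refine (key f hf l hl).trans ?_
      obtain ⟨B, hB, hhB, hBU, hBs⟩ := hU h hh
      exact hB.isHigh.high h hhB _ ⟨hr.mem_verts hB.isHigh.isSubgraph hBs ⟨h, hhB, rfl⟩,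
        fun h1 => p.toFun_notMem f (hBU h1)⟩

/-- No leg of `E` is shrunk, because saturation would make it a line of `E`. -/
theorem numLegs_eq (hE : X.IsSubgraph E) (hs : Saturated U E) :
    Y.numLegs = (X.legs E).ncard := by
  rw [numLegs, ← Nat.card_coe_set_eq]
  refine Nat.card_congr (Equiv.ofBijective (fun k => ⟨p.toFun k.1, p.vert_mem k.1,
    (p.inv_eq_iff hE k.1).1 k.2⟩) ⟨fun k l h => ?_, ?_⟩)
  · exact Subtype.ext (p.injective (Subtype.ext_iff.1 h))
  · rintro ⟨h, hv, hh⟩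
    obtain ⟨k, rfl⟩ := p.exists_toFun_eq hv fun hU => hh (hs h hU hv)
    exact ⟨⟨k, p.inv_of_notMem k hh⟩, rfl⟩

theorem isConnected (hE : X.IsHigh E) (hEU : ¬ E ⊆ U) : Y.IsConnected := by
  rw [IsConnected, p.internal_eq hE.isSubgraph]
  constructor
  · obtain ⟨h, hh, hhU⟩ := Set.not_subset.1 hEU
    obtain ⟨k, rfl⟩ := p.exists_toFun_eq ⟨h, hh, rfl⟩ hhU
    exact ⟨k, hh⟩
  · intro v w
    obtain ⟨k, rfl⟩ := p.vert_surjective v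
    obtain ⟨l, rfl⟩ := p.vert_surjective w
    exact (p.reach_iff subset_rfl k l).2 ((hE.connected _ (p.vert_mem k) _ (p.vert_mem l)).mono
      Set.subset_union_right)

/-- A subquotient is one particle irreducible if and only if the subgraph is, provided that the
shrunk subgraphs are. -/
theorem isOnePI_iff (hE : X.IsHigh E) (hEU : ¬ E ⊆ U) (hU : IsCutUnion 𝒢 X U)
    (h𝒢 : 𝒢.onePIOnly) : Y.IsOnePI ↔ X.IsOnePISub E := by
  have hs := hE.saturated hU hEU
  have hpre : ∀ k, p.toFun k ∈ E →
      Y.internal \ {k, Y.inv k} = p.toFun ⁻¹' (E \ {p.toFun k, X.inv (p.toFun k)}) := by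
    intro k hk
    rw [p.internal_eq hE.isSubgraph, ← p.inv_of_mem k hk]
    ext l
    simp [p.injective.eq_iff]
  constructor
  · intro hY h hh v hv w hw
    by_cases hhU : h ∈ U
    · obtain ⟨B, hB, hhB, hBU, hBs⟩ := hU h hhU
      have hBE : B ⊆ E := (hE.subset_or_subset hB.isHigh ⟨h, hh, rfl⟩ ⟨h, hhB, rfl⟩).resolve_left
        fun h1 => hEU (h1.trans hBU)
      have hinv := hB.isHigh.isSubgraph.inv_mem h hhB
      have hB' : ∀ v ∈ X.verts B, ∀ w ∈ X.verts B, X.Reach (E \ {h, X.inv h}) v w :=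
        fun v hv w hw => (hB.onePI h𝒢 h hhB v hv w hw).mono (Set.sdiff_subset_sdiff_left hBE)
      have hr := hE.connected v hv w hw
      clear hv hw
      induction hr with
      | refl => exact .refl
      | tail _ hst ih =>
        obtain ⟨k, hk, rfl, rfl⟩ := hst
        refine ih.trans ?_
        by_cases hkB : k ∈ B
        · exact hB' (X.vert k) ⟨k, hkB, rfl⟩ (X.vert (X.inv k))
            ⟨X.inv k, hB.isHigh.isSubgraph.inv_mem k hkB, rfl⟩
        · refine reach_of_mem ⟨hk, ?_⟩
          rintro (rfl | rfl)
          exacts [hkB hhB, hkB hinv]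
    · obtain ⟨k, rfl⟩ := p.exists_toFun_eq ⟨h, hh, rfl⟩ hhU
      have hinvU : X.inv (p.toFun k) ∉ U := fun h => hhU (hU.isSubgraph.mem_of_inv_mem h)
      -- Here the cut line is not shrunk, so walks along shrunk lines avoid it and lead each vertex
      -- to a half-edge of `Y`.
      have key : ∀ v ∈ X.verts E, ∃ l, X.Reach (E \ {p.toFun k, X.inv (p.toFun k)}) v
          (X.vert (p.toFun l)) := by
        intro v hv
        obtain ⟨m, hm, hmU, hr⟩ := hE.exists_reach hEU hv
        obtain ⟨l, rfl⟩ := p.exists_toFun_eq ⟨m, hm, rfl⟩ hmU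
        refine ⟨l, Reach.mono ?_ (hr.inter hE.isSubgraph hs hv)⟩
        intro n hn
        refine ⟨hn.2, ?_⟩
        rintro (rfl | rfl)
        exacts [hhU hn.1, hinvU hn.1]
      obtain ⟨l, hl⟩ := key v hv
      obtain ⟨m, hm⟩ := key w hw
      have hinv : ∀ n ∈ E \ {p.toFun k, X.inv (p.toFun k)},
          X.inv n ∈ E \ {p.toFun k, X.inv (p.toFun k)} := by
        rintro n ⟨hn, hn'⟩
        refine ⟨hE.isSubgraph.inv_mem n hn, ?_⟩
        rintro (h1 | h1)
        · exact hn' (Or.inr (by rw [← h1, X.inv_inv]; rfl))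
        · exact hn' (Or.inl (by rw [← X.inv_inv n, h1, X.inv_inv]))
      refine hl.trans (Relation.ReflTransGen.trans ?_ (reach_symm hinv hm))
      have h1 := hY.2 k ((p.internal_eq hE.isSubgraph).symm ▸ hh) (Y.vert l) (Y.vert m)
      rw [hpre k hh, p.reach_iff Set.sdiff_subset] at h1
      have hsat : Saturated (U ∪ E \ {p.toFun k, X.inv (p.toFun k)}) E := by
        rintro n (hn | hn) hv
        exacts [hs n hn hv, hn.1]
      refine (h1.inter hE.isSubgraph hsat (p.vert_mem l)).mono ?_
      rintro n ⟨hn | hn, hnE⟩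
      · refine ⟨hnE, ?_⟩
        rintro (rfl | rfl)
        exacts [hhU hn, hinvU hn]
      · exact hn
  · intro h
    refine ⟨p.isConnected hE hEU, fun k hk v w => ?_⟩
    have hkE : p.toFun k ∈ E := by
      rw [p.internal_eq hE.isSubgraph] at hk
      exact hk
    obtain ⟨l, rfl⟩ := p.vert_surjective v
    obtain ⟨m, rfl⟩ := p.vert_surjective w
    rw [hpre k hkE, p.reach_iff Set.sdiff_subset]
    exact (h _ hkE _ (p.vert_mem l) _ (p.vert_mem m)).mono Set.subset_union_right

/-- A vertex of a subquotient is a vertex of the graph or a shrunk subgraph. -/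
theorem valence_mem (hX : ∀ v, X.valence v ∈ 𝒢.valences) (hE : X.IsHigh E) (hEU : ¬ E ⊆ U)
    (hU : IsCutUnion 𝒢 X U) (v : Y.Vertex) : Y.valence v ∈ 𝒢.valences := by
  have hs := hE.saturated hU hEU
  obtain ⟨k, rfl⟩ := p.vert_surjective v
  have key : Y.valence (Y.vert k) =
      {h | h ∉ U ∧ X.Reach U (X.vert (p.toFun k)) (X.vert h)}.ncard := by
    rw [valence, ← Nat.card_coe_set_eq]
    refine Nat.card_congr (Equiv.ofBijective (fun l => ⟨p.toFun l.1, p.toFun_notMem l.1,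
      (p.vert_eq_iff _ _).1 l.2.symm⟩) ⟨fun k l h => ?_, ?_⟩)
    · exact Subtype.ext (p.injective (Subtype.ext_iff.1 h))
    · rintro ⟨h, hU', hr⟩
      obtain ⟨l, rfl⟩ := p.exists_toFun_eq (hr.mem_verts hE.isSubgraph hs (p.vert_mem k)) hU'
      exact ⟨⟨l, ((p.vert_eq_iff _ _).2 hr).symm⟩, rfl⟩
  rw [key]
  -- The half-edges at a shrunk vertex are the legs of its component, two or four of them; this is
  -- where `2` and `4` must be allowed valences.
  by_cases hk : X.vert (p.toFun k) ∈ X.verts U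
  · obtain ⟨h, hh, hhk⟩ := hk
    obtain ⟨B, hB, hhB, hBU, hBs⟩ := hU h hh
    have hset : {h | h ∉ U ∧ X.Reach U (X.vert (p.toFun k)) (X.vert h)} = X.legs B := by
      rw [← hhk]
      ext l
      constructor
      · rintro ⟨hl, hr⟩
        exact ⟨hr.mem_verts hB.isHigh.isSubgraph hBs ⟨h, hhB, rfl⟩, fun h1 => hl (hBU h1)⟩
      · rintro ⟨hv, hl⟩
        exact ⟨fun h1 => hl (hBs l h1 hv),
          (hB.isHigh.connected _ ⟨h, hhB, rfl⟩ _ hv).mono hBU⟩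
    rw [hset]
    rcases hB.ncard_legs with h1 | h1 <;> rw [h1]
    exacts [𝒢.two_mem, 𝒢.four_mem]
  · have hset : {h | h ∉ U ∧ X.Reach U (X.vert (p.toFun k)) (X.vert h)} =
        {h | X.vert h = X.vert (p.toFun k)} := by
      ext l
      constructor
      · exact fun h => (h.2.eq_of_notMem hk).symm
      · intro (h : X.vert l = _)
        exact ⟨fun hl => hk ⟨l, hl, h⟩, h ▸ .refl⟩
    rw [hset, ← Nat.card_coe_set_eq]
    exact hX (X.vert (p.toFun k))

/-- Subquotients of graphs in the class belong to the class. -/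
theorem mem (hX : 𝒢.Mem X) (hE : X.IsHigh E) (hE1 : 𝒢.onePIOnly → X.IsOnePISub E)
    (hEU : ¬ E ⊆ U) (hU : IsCutUnion 𝒢 X U) : 𝒢.Mem Y where
  connected := p.isConnected hE hEU
  onePI h𝒢 := (p.isOnePI_iff hE hEU hU h𝒢).2 (hE1 h𝒢)
  valence_mem := p.valence_mem hX.valence_mem hE hEU hU
  scale_le k n hn := by
    by_cases hk : p.toFun k ∈ E
    · rw [p.scale_of_mem k hk] at hn
      exact hX.scale_le _ n hn
    · rw [p.scale_of_notMem hk] at hn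
      exact (WithBot.bot_ne_coe hn).elim

/-- Whether a subgraph may be shrunk can be decided before shrinking other subgraphs. -/
theorem isCuttable_preimage_iff (hE : X.IsHigh E) (hEU : ¬ E ⊆ U) (hU : IsCutUnion 𝒢 X U)
    {A : Set X.HalfEdge} (hA : X.IsHigh A) (hAE : A ⊆ E) (hAU : ¬ A ⊆ U) :
    IsCuttable 𝒢 Y (p.toFun ⁻¹' A) ↔ IsCuttable 𝒢 X A := by
  have hF := p.isHigh_preimage hA hAE hAU hU
  have hs := hA.saturated hU hAU
  have hFe : ¬ p.toFun ⁻¹' A ⊆ ∅ := fun h => hF.nonempty.ne_empty (Set.subset_empty_iff.1 h)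
  -- One graph is presented both over `X`, with `U` shrunk, and over `Y`, with nothing shrunk; legs
  -- and irreducibility are compared through it.
  have q := p.sub hA hAE hAU hU.isSubgraph hs hF.isSubgraph
  have hY := p.isConnected hE hEU
  have q' := hY.subquotientSub hF
  have h1 := q.numLegs_eq hA.isSubgraph hs
  have h1' := q'.numLegs_eq hF.isSubgraph (fun _ h => h.elim)
  have h2 := q.isOnePI_iff hA hAU hU
  have h2' := fun h => q'.isOnePI_iff (𝒢 := 𝒢) hF hFe isCutUnion_empty h
  constructor
  · intro h
    exact ⟨hA, by rw [← h1, h1']; exact h.ncard_legs,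
      fun h𝒢 => (h2 h𝒢).1 ((h2' h𝒢).2 (h.onePI h𝒢))⟩
  · intro h
    exact ⟨hF, by rw [← h1', h1]; exact h.ncard_legs,
      fun h𝒢 => (h2' h𝒢).1 ((h2 h𝒢).2 (h.onePI h𝒢))⟩

end Subquotient

end Transfer

/-! ### Isomorphisms of graphs and of their trees -/

section Iso

variable {X Y : AssignedGraph}

/-- The inverse isomorphism. -/
def Iso.symm (f : Iso X Y) : Iso Y X where
  onVertex := f.onVertex.symm
  onHalfEdge := f.onHalfEdge.symm
  vert_map h := by rw [Equiv.eq_symm_apply, ← f.vert_map, Equiv.apply_symm_apply]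
  inv_map h := by rw [Equiv.eq_symm_apply, ← f.inv_map, Equiv.apply_symm_apply]
  scale_map h := by rw [← f.scale_map, Equiv.apply_symm_apply]

theorem Iso.vert_mem_verts_image_iff (f : Iso X Y) {E : Set X.HalfEdge} {h : X.HalfEdge} :
    Y.vert (f.onHalfEdge h) ∈ Y.verts (f.onHalfEdge '' E) ↔ X.vert h ∈ X.verts E := by
  constructor
  · rintro ⟨_, ⟨k, hk, rfl⟩, hv⟩
    rw [f.vert_map, f.vert_map, f.onVertex.apply_eq_iff_eq] at hv
    exact ⟨k, hk, hv⟩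
  · rintro ⟨k, hk, hv⟩
    exact ⟨_, ⟨k, hk, rfl⟩, by rw [f.vert_map, f.vert_map, hv]⟩

theorem Iso.reach (f : Iso X Y) {E : Set X.HalfEdge} {v w : X.Vertex} (h : X.Reach E v w) :
    Y.Reach (f.onHalfEdge '' E) (f.onVertex v) (f.onVertex w) := by
  induction h with
  | refl => exact .refl
  | tail _ hs ih =>
    obtain ⟨k, hk, rfl, rfl⟩ := hs
    exact ih.tail ⟨_, ⟨k, hk, rfl⟩, f.vert_map k, by rw [f.inv_map, f.vert_map]⟩

theorem Iso.isComponent (f : Iso X Y) {i : ℕ} {E : Set X.HalfEdge} (hE : X.IsComponent i E) :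
    Y.IsComponent i (f.onHalfEdge '' E) := by
  have hlegs : ∀ l ∈ Y.legs (f.onHalfEdge '' E), ∃ k ∈ X.legs E, f.onHalfEdge k = l := by
    rintro l ⟨hv, hl⟩
    obtain ⟨k, rfl⟩ := f.onHalfEdge.surjective l
    exact ⟨k, ⟨f.vert_mem_verts_image_iff.1 hv, fun hk => hl ⟨k, hk, rfl⟩⟩, rfl⟩
  refine ⟨⟨⟨?_, ?_⟩, hE.isHigh.nonempty.image _, ?_, ?_⟩, ?_, ?_⟩
  · rintro _ ⟨h, hh, rfl⟩
    rw [f.inv_map, Ne, f.onHalfEdge.apply_eq_iff_eq]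
    exact hE.isHigh.isSubgraph.internal h hh
  · rintro _ ⟨h, hh, rfl⟩
    exact ⟨_, hE.isHigh.isSubgraph.inv_mem h hh, (f.inv_map h).symm⟩
  · rintro _ ⟨_, ⟨h, hh, rfl⟩, rfl⟩ _ ⟨_, ⟨k, hk, rfl⟩, rfl⟩
    rw [f.vert_map, f.vert_map]
    exact f.reach (hE.isHigh.connected _ ⟨h, hh, rfl⟩ _ ⟨k, hk, rfl⟩)
  · rintro _ ⟨h, hh, rfl⟩ l hl
    obtain ⟨k, hk, rfl⟩ := hlegs l hl
    rw [f.scale_map, f.scale_map]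
    exact hE.isHigh.high h hh k hk
  · rintro _ ⟨h, hh, rfl⟩
    rw [f.scale_map]
    exact hE.le_scale h hh
  · intro l hl
    obtain ⟨k, hk, rfl⟩ := hlegs l hl
    rw [f.scale_map]
    exact hE.scale_lt k hk

theorem Iso.isComponent_image_iff (f : Iso X Y) {i : ℕ} {E : Set X.HalfEdge} :
    Y.IsComponent i (f.onHalfEdge '' E) ↔ X.IsComponent i E := by
  refine ⟨fun h => ?_, f.isComponent⟩
  have := f.symm.isComponent h
  rwa [show f.symm.onHalfEdge = f.onHalfEdge.symm from rfl, Equiv.symm_image_image] at this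

theorem Iso.image_internal (f : Iso X Y) : f.onHalfEdge '' X.internal = Y.internal := by
  ext h
  obtain ⟨k, rfl⟩ := f.onHalfEdge.surjective h
  rw [f.onHalfEdge.injective.mem_set_image]
  refine not_congr ?_
  rw [f.inv_map, f.onHalfEdge.apply_eq_iff_eq]

/-- Through `f`, both subgraphs are presentations over `X` with the same data. -/
theorem Iso.isIso_sub (f : Iso X Y) (hX : X.IsConnected) {E : Set X.HalfEdge} (hE : X.IsHigh E)
    {F : Set Y.HalfEdge} (hF : Y.IsSubgraph F) (h : F = f.onHalfEdge '' E) :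
    (sub hE.isSubgraph).IsIso (sub hF) := by
  have h' : F = (f.subquotient hX).toFun ⁻¹' E := h.trans (f.onHalfEdge.image_eq_preimage_symm E)
  subst h'
  exact (hX.subquotientSub hE).isIso ((f.subquotient hX).sub hE hE.isSubgraph.internal
    (fun h => hE.nonempty.ne_empty (Set.subset_empty_iff.1 h)) isSubgraph_empty
    (fun _ h => h.elim) hF)

/-- Isomorphic graphs have isomorphic trees. -/
noncomputable def Iso.gnTree (f : Iso X Y) (hX : X.IsConnected) (hY : Y.IsConnected) :
    DecoratedTree.Iso (gnTree X hX) (gnTree Y hY) where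
  onNode := ((Equiv.refl ℕ).prodCongr (Equiv.Set.congr f.onHalfEdge)).subtypeEquiv
    fun _ => f.isComponent_image_iff.symm
  root_map := Subtype.ext (Prod.ext rfl f.image_internal)
  arrow_map _ _ := and_congr Iff.rfl (Set.image_subset_image_iff f.onHalfEdge.injective)
  graph_map a := f.isIso_sub hX a.isComponent.isHigh
    (f.isComponent a.isComponent).isHigh.isSubgraph rfl

/-- A connected graph is isomorphic to the graph that decorates the root of its tree. -/
theorem IsConnected.isIso_root (hX : X.IsConnected) :
    X.IsIso ((GallavottiNicolo.gnTree X hX).graph (GallavottiNicolo.gnTree X hX).root) :=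
  hX.subquotient.isIso (hX.subquotientSub hX.isHigh_internal)

/-- An isomorphism of trees matches the roots, and each root is decorated with the whole graph. -/
theorem IsIso.of_gnTree (hX : X.IsConnected) (hY : Y.IsConnected)
    (f : DecoratedTree.Iso (GallavottiNicolo.gnTree X hX) (GallavottiNicolo.gnTree Y hY)) :
    X.IsIso Y := by
  have h := f.graph_map (GallavottiNicolo.gnTree X hX).root
  rw [f.root_map] at h
  exact (hX.isIso_root.trans h).trans hY.isIso_root.symm

/-- An isomorphic copy is a subquotient with nothing shrunk, so `Subquotient.mem` applies. -/
theorem IsIso.mem {𝒢 : GraphClass} (h : X.IsIso Y) (hX : 𝒢.Mem X) : 𝒢.Mem Y := by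
  obtain ⟨f⟩ := h
  refine (f.subquotient hX.connected).mem hX hX.connected.isHigh_internal ?_ ?_ isCutUnion_empty
  · exact fun h𝒢 h hh v _ w _ => (hX.onePI h𝒢).2 h hh v w
  · exact fun h => hX.connected.1.ne_empty (Set.subset_empty_iff.1 h)

end Iso

/-! ### Essential arrows and high subgraphs -/

section Tree

variable {X : AssignedGraph}

theorem card_internal_sub {E : Set X.HalfEdge} (hE : X.IsSubgraph E) :
    (sub hE).internal.ncard = E.ncard := by
  have hmem : ∀ k : (sub hE).HalfEdge, k ∈ (sub hE).internal ↔ k.1 ∈ E := by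
    intro k
    change (sub hE).inv k ≠ k ↔ _
    by_cases hk : k.1 ∈ E
    · rw [show (sub hE).inv k = ⟨X.inv k.1, X.inv k.1, hE.inv_mem _ hk, rfl⟩ from dif_pos hk]
      exact iff_of_true (fun h => hE.internal _ hk (congrArg Subtype.val h)) hk
    · exact iff_of_false (not_not.2 (dif_neg hk)) hk
  refine Set.ncard_congr (fun k _ => k.1) (fun k hk => (hmem k).1 hk)
    (fun k l _ _ h => Subtype.ext h) fun h hh => ?_
  exact ⟨⟨h, h, hh, rfl⟩, (hmem _).2 hh, rfl⟩

/-- Isomorphic graphs have equally many lines, and nested finite sets of equal size coincide.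
Essential arrows can therefore be recognised from the sets of lines alone. -/
theorem Node.isIso_graph_iff {a b : X.Node} (hab : a.lines ⊆ b.lines) :
    a.graph.IsIso b.graph ↔ a.lines = b.lines := by
  constructor
  · rintro ⟨f⟩
    refine Set.eq_of_subset_of_ncard_le hab ?_
    have h1 := card_internal_sub a.isComponent.isHigh.isSubgraph
    have h2 := card_internal_sub b.isComponent.isHigh.isSubgraph
    rw [← h1, ← h2]
    change b.graph.internal.ncard ≤ a.graph.internal.ncard
    rw [← f.image_internal]
    exact Set.ncard_image_le
  · have : ∀ {E F : Set X.HalfEdge} (hE : X.IsSubgraph E) (hF : X.IsSubgraph F), E = F →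
        (sub hE).IsIso (sub hF) := by
      rintro E _ hE hF rfl
      exact .refl _
    exact this _ _

theorem isEssential_iff (hX : X.IsConnected) {a : X.Node × X.Node} :
    (gnTree X hX).IsEssential a ↔ Node.Arrow a.1 a.2 ∧ a.1.lines ≠ a.2.lines :=
  and_congr_right fun h => not_congr (Node.isIso_graph_iff h.2)

theorem IsComponent.eq_of_mem {i : ℕ} {E F : Set X.HalfEdge} (hE : X.IsComponent i E)
    (hF : X.IsComponent i F) {h : X.HalfEdge} (h1 : h ∈ E) (h2 : h ∈ F) : E = F :=
  Set.Subset.antisymm (hF.subset le_rfl hE h2 h1) (hE.subset le_rfl hF h1 h2)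

theorem Node.ext {a b : X.Node} (h1 : a.level = b.level) (h2 : a.lines = b.lines) : a = b :=
  Subtype.ext (Prod.ext h1 h2)

/-- The same subgraph may decorate nodes at several consecutive levels. An essential arrow leaves
only the one nearest the root, since at the others the next node carries the same subgraph. -/
theorem Node.Arrow.eq_of_lines_eq {a b c d : X.Node} (hab : a.Arrow b) (hcd : c.Arrow d)
    (hb : a.lines ≠ b.lines) (hd : c.lines ≠ d.lines) (h : a.lines = c.lines) :
    a = c ∧ b = d := by
  have key : ∀ {a b c d : X.Node}, a.Arrow b → c.Arrow d → a.lines ≠ b.lines →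
      a.lines = c.lines → a.level ≤ c.level := by
    intro a b c d hab hcd hb h
    by_contra! hlt
    obtain ⟨e, he⟩ := a.isComponent.isHigh.nonempty
    have hbl : X.IsComponent b.level a.lines := by
      refine ⟨a.isComponent.isHigh, fun k hk => ?_, fun l hl => ?_⟩
      · refine le_trans ?_ (a.isComponent.le_scale k hk)
        rw [hab.1]
        exact_mod_cast Nat.le_succ _
      · rw [h] at hl
        refine (c.isComponent.scale_lt l hl).trans_le ?_
        rw [hab.1] at hlt
        exact_mod_cast Nat.le_of_lt_succ hlt
    exact hb (hbl.eq_of_mem b.isComponent he (hab.2 he))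
  have h1 : a = c := Node.ext (le_antisymm (key hab hcd hb h) (key hcd hab hd h.symm)) h
  subst h1
  refine ⟨rfl, ?_⟩
  obtain ⟨e, he⟩ := a.isComponent.isHigh.nonempty
  have hl : b.level = d.level := Nat.succ_injective (hab.1.symm.trans hcd.1)
  refine Node.ext hl (b.isComponent.eq_of_mem ?_ (hab.2 he) (hcd.2 he))
  rw [hl]
  exact d.isComponent

/-- Each high subgraph other than the whole graph is cut off by an essential arrow. -/
theorem IsHigh.exists_arrow (hX : X.IsConnected) {E : Set X.HalfEdge} (hE : X.IsHigh E)
    (hne : E ≠ X.internal) : ∃ a b : X.Node, a.Arrow b ∧ a.lines ≠ b.lines ∧ a.lines = E := by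
  classical
  -- At the lowest level where `E` is a component, minimality makes its parent strictly larger.
  have hex := hE.exists_isComponent
  have hfind := Nat.find_spec hex
  have hmin := fun m => @Nat.find_min _ _ hex m
  generalize Nat.find hex = n at hfind hmin
  cases n with
  | zero =>
    refine (hne (Set.Subset.antisymm hE.isSubgraph.internal ?_)).elim
    obtain ⟨e, he⟩ := hE.nonempty
    exact hfind.subset le_rfl hX.isComponent he (hE.isSubgraph.internal e he)
  | succ i =>
    obtain ⟨F, hF, hEF⟩ := hfind.exists_parent
    refine ⟨⟨(i + 1, E), hfind⟩, ⟨(i, F), hF⟩, ⟨rfl, hEF⟩, ?_, rfl⟩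
    rintro (rfl : E = F)
    exact hmin i (Nat.lt_succ_self i) hF

theorem Node.Arrow.ne_internal {a b : X.Node} (hab : a.Arrow b) (h : a.lines ≠ b.lines) :
    a.lines ≠ X.internal := fun h0 =>
  h (Set.Subset.antisymm hab.2 (h0 ▸ b.isComponent.isHigh.isSubgraph.internal))

/-- The degree of the tree of a graph is the number of its high subgraphs. -/
theorem degree_gnTree (hX : X.IsConnected) : (gnTree X hX).degree = {E | X.IsHigh E}.ncard := by
  have hins : {E | X.IsHigh E} = insert X.internal {E | X.IsHigh E ∧ E ≠ X.internal} := by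
    ext E
    by_cases h : E = X.internal
    · subst h
      simp [hX.isHigh_internal]
    · simp [h]
  -- The `+ 1` in the degree accounts for the whole graph, the only high subgraph that no essential
  -- arrow cuts off.
  rw [hins, Set.ncard_insert_of_notMem (by simp), DecoratedTree.degree, ← Nat.card_coe_set_eq]
  congr 1
  refine Nat.card_congr (Equiv.ofBijective (fun a => ⟨AssignedGraph.Node.lines a.1.1,
    AssignedGraph.Node.isComponent a.1.1 |>.isHigh,
    (((isEssential_iff hX).1 a.2).1.ne_internal ((isEssential_iff hX).1 a.2).2)⟩) ⟨?_, ?_⟩)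
  · rintro ⟨⟨a, b⟩, hab⟩ ⟨⟨c, d⟩, hcd⟩ h
    have hab' := (isEssential_iff hX).1 hab
    have hcd' := (isEssential_iff hX).1 hcd
    obtain ⟨h1, h2⟩ := hab'.1.eq_of_lines_eq hcd'.1 hab'.2 hcd'.2 (Subtype.ext_iff.1 h)
    exact Subtype.ext (Prod.ext h1 h2)
  · rintro ⟨E, hE, hne⟩
    obtain ⟨a, b, hab, h, rfl⟩ := hE.exists_arrow hX hne
    exact ⟨⟨(a, b), (isEssential_iff hX).2 ⟨hab, h⟩⟩, rfl⟩

theorem Node.lines_subset_of_path {a b : X.Node} (h : Relation.ReflTransGen Node.Arrow a b) :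
    a.lines ⊆ b.lines := by
  induction h with
  | refl => exact subset_rfl
  | tail _ hs ih => exact ih.trans hs.2

/-- Passing from parent to parent, the path reaches the level of `b` at a component that still
contains the lines of `a`; it must be `b`, since distinct components of one level are disjoint. -/
theorem Node.path_of_subset {a b : X.Node} (hl : b.level ≤ a.level) (h : a.lines ⊆ b.lines) :
    Relation.ReflTransGen Node.Arrow a b := by
  obtain ⟨⟨n, E⟩, hE⟩ := a
  induction n generalizing E with
  | zero =>
    obtain ⟨e, he⟩ := hE.isHigh.nonempty
    have hb : b.level = 0 := Nat.le_zero.1 hl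
    have : (⟨(0, E), hE⟩ : X.Node) = b :=
      Node.ext hb.symm (hE.eq_of_mem (hb ▸ b.isComponent) he (h he))
    rw [this]
  | succ n ih =>
    obtain ⟨e, he⟩ := hE.isHigh.nonempty
    rcases hl.eq_or_lt with hb | hb
    · have hbc := b.isComponent
      rw [hb] at hbc
      have : (⟨(n + 1, E), hE⟩ : X.Node) = b :=
        Node.ext hb.symm (hE.eq_of_mem hbc he (h he))
      rw [this]
    · obtain ⟨F, hF, hEF⟩ := hE.exists_parent
      have hbn : b.level ≤ n := Nat.le_of_lt_succ hb
      have harrow : Node.Arrow (X := X) ⟨(n + 1, E), hE⟩ ⟨(n, F), hF⟩ := ⟨rfl, hEF⟩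
      exact Relation.ReflTransGen.head harrow
        (ih F hF hbn (b.isComponent.subset hbn hF (h he) (hEF he)))

/-- Essential arrows are not on a common path if and only if they cut off disjoint subgraphs. -/
theorem Node.Arrow.disjoint_iff {a b c d : X.Node} (hab : a.Arrow b) (hcd : c.Arrow d)
    (hb : a.lines ≠ b.lines) (hd : c.lines ≠ d.lines) (hne : (a, b) ≠ (c, d)) :
    Disjoint a.lines c.lines ↔ ¬ Relation.ReflTransGen Node.Arrow b c ∧
      ¬ Relation.ReflTransGen Node.Arrow d a := by
  have hlne : a.lines ≠ c.lines := fun h =>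
    hne (Prod.ext_iff.2 (hab.eq_of_lines_eq hcd hb hd h))
  -- A strictly smaller subgraph lies strictly farther from the root, so `b` is at least as far out
  -- as `c`, and the path from `a` towards `c` runs through `b`.
  have key : ∀ {a b c d : X.Node}, a.Arrow b → c.Arrow d → a.lines ⊆ c.lines →
      a.lines ≠ c.lines → Relation.ReflTransGen Node.Arrow b c := by
    intro a b c d hab hcd h1 h2
    obtain ⟨e, he⟩ := a.isComponent.isHigh.nonempty
    have hl : c.level ≤ b.level := by
      by_contra! hlt
      refine h2 (Set.Subset.antisymm h1 (a.isComponent.subset ?_ c.isComponent he (h1 he)))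
      rw [hab.1]
      exact hlt
    exact Node.path_of_subset hl (c.isComponent.subset hl b.isComponent (h1 he) (hab.2 he))
  constructor
  · intro hdis
    constructor
    · intro h
      obtain ⟨e, he⟩ := a.isComponent.isHigh.nonempty
      exact Set.disjoint_left.1 hdis he (Node.lines_subset_of_path h (hab.2 he))
    · intro h
      obtain ⟨e, he⟩ := c.isComponent.isHigh.nonempty
      exact Set.disjoint_left.1 hdis (Node.lines_subset_of_path h (hcd.2 he)) he
  · rintro ⟨h1, h2⟩
    rcases a.isComponent.isHigh.subset_or_subset_or_disjoint c.isComponent.isHigh with h | h | h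
    · exact (h1 (key hab hcd h hlne)).elim
    · exact (h2 (key hcd hab h hlne.symm)).elim
    · exact h

end Tree

/-! ### Families of disjoint cuttable subgraphs -/

/-- A family of disjoint cuttable subgraphs that are properly contained in the subgraph `E` and not
contained in `U`. -/
structure IsCutFamily (𝒢 : GraphClass) (X : AssignedGraph) (E U : Set X.HalfEdge)
    (N : Finset (Set X.HalfEdge)) : Prop where
  isCuttable : ∀ A ∈ N, IsCuttable 𝒢 X A
  subset : ∀ A ∈ N, A ⊆ E
  ne : ∀ A ∈ N, A ≠ E
  not_subset : ∀ A ∈ N, ¬ A ⊆ U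
  disjoint : ∀ A ∈ N, ∀ B ∈ N, A ≠ B → Disjoint A B

/-- The finite set of all cut families. -/
noncomputable def cutFamilies (𝒢 : GraphClass) (X : AssignedGraph) (E U : Set X.HalfEdge) :
    Finset (Finset (Set X.HalfEdge)) :=
  haveI : Fintype (Set X.HalfEdge) := Fintype.ofFinite _
  (Set.toFinite {N | IsCutFamily 𝒢 X E U N}).toFinset

section CutFamily

variable {𝒢 : GraphClass} {X Y : AssignedGraph} {E U : Set X.HalfEdge}

@[simp]
theorem mem_cutFamilies {N : Finset (Set X.HalfEdge)} :
    N ∈ cutFamilies 𝒢 X E U ↔ IsCutFamily 𝒢 X E U N :=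
  Set.Finite.mem_toFinset _

theorem isCutFamily_empty : IsCutFamily 𝒢 X E U ∅ := by
  constructor <;> simp

variable {N : Finset (Set X.HalfEdge)}

theorem IsCutFamily.nonempty (hN : IsCutFamily 𝒢 X E U N) {A : Set X.HalfEdge} (hA : A ∈ N) :
    A.Nonempty := (hN.isCuttable A hA).isHigh.nonempty

theorem IsCutFamily.eq_of_mem (hN : IsCutFamily 𝒢 X E U N) {A B : Set X.HalfEdge} (hA : A ∈ N)
    (hB : B ∈ N) {h : X.HalfEdge} (h1 : h ∈ A) (h2 : h ∈ B) : A = B := by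
  by_contra hne
  exact Set.disjoint_left.1 (hN.disjoint A hA B hB hne) h1 h2

theorem IsCutFamily.eq_of_subset (hN : IsCutFamily 𝒢 X E U N) {A B : Set X.HalfEdge} (hA : A ∈ N)
    (hB : B ∈ N) (hAB : A ⊆ B) : A = B := by
  obtain ⟨h, hh⟩ := hN.nonempty hA
  exact hN.eq_of_mem hA hB hh (hAB hh)

/-- Disjoint high subgraphs share no vertex, so the members are the connected components of their
union. -/
theorem IsCutFamily.saturated (hN : IsCutFamily 𝒢 X E U N) {A : Set X.HalfEdge} (hA : A ∈ N) :
    Saturated (⋃₀ (N : Set (Set X.HalfEdge))) A := by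
  rintro h ⟨B, hB, hh⟩ hv
  by_cases hAB : B = A
  · exact hAB ▸ hh
  · exact (hN.isCuttable B hB).isHigh.saturated_of_disjoint (hN.isCuttable A hA).isHigh
      (hN.disjoint B hB A hA hAB) h hh hv

theorem IsCutFamily.isSubgraph (hN : IsCutFamily 𝒢 X E U N) :
    X.IsSubgraph (⋃₀ (N : Set (Set X.HalfEdge))) := by
  refine ⟨fun h hh => ?_, fun h hh => ?_⟩
  · obtain ⟨A, hA, hhA⟩ := hh
    exact (hN.isCuttable A hA).isHigh.isSubgraph.internal h hhA
  · obtain ⟨A, hA, hhA⟩ := hh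
    exact ⟨A, hA, (hN.isCuttable A hA).isHigh.isSubgraph.inv_mem h hhA⟩

theorem IsCutFamily.sUnion_subset (hN : IsCutFamily 𝒢 X E U N) :
    ⋃₀ (N : Set (Set X.HalfEdge)) ⊆ E :=
  Set.sUnion_subset hN.subset

/-- Members of `N` absorb the components of `U` that they touch. The component of a line is thus the
member of `N` that contains it, or else its old component in `U`. -/
theorem IsCutFamily.isCutUnion (hN : IsCutFamily 𝒢 X E U N) (hU : IsCutUnion 𝒢 X U) :
    IsCutUnion 𝒢 X (U ∪ ⋃₀ (N : Set (Set X.HalfEdge))) := by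
  have key : ∀ A ∈ N, Saturated (U ∪ ⋃₀ (N : Set (Set X.HalfEdge))) A := by
    rintro A hA h (hh | hh) hv
    · exact (hN.isCuttable A hA).isHigh.saturated hU (hN.not_subset A hA) h hh hv
    · exact hN.saturated hA h hh hv
  intro h hh
  by_cases hhN : h ∈ ⋃₀ (N : Set (Set X.HalfEdge))
  · obtain ⟨A, hA, hhA⟩ := hhN
    exact ⟨A, hN.isCuttable A hA, hhA, (Set.subset_sUnion_of_mem hA).trans
      Set.subset_union_right, key A hA⟩
  · obtain ⟨B, hB, hhB, hBU, hBs⟩ := hU h (hh.resolve_right hhN)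
    refine ⟨B, hB, hhB, hBU.trans Set.subset_union_left, ?_⟩
    rintro k (hk | ⟨A, hA, hkA⟩) hv
    · exact hBs k hk hv
    · rcases (hN.isCuttable A hA).isHigh.subset_or_subset hB.isHigh ⟨k, hkA, rfl⟩ hv with h1 | h1
      · exact h1 hkA
      · exact (hhN ⟨A, hA, h1 hhB⟩).elim

/-- If the union covered `E`, connectedness would force all of `E` into a single member, which is a
proper subgraph. -/
theorem IsCutFamily.not_subset_union (hN : IsCutFamily 𝒢 X E U N) (hE : X.IsHigh E)
    (hEU : ¬ E ⊆ U) (hU : IsCutUnion 𝒢 X U) :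
    ¬ E ⊆ U ∪ ⋃₀ (N : Set (Set X.HalfEdge)) := by
  intro hsub
  obtain ⟨h, hh, hhU⟩ := Set.not_subset.1 hEU
  obtain ⟨A, hA, hhA⟩ := (hsub hh).resolve_left hhU
  refine hN.ne A hA (Set.Subset.antisymm (hN.subset A hA) ?_)
  refine hE.subset_of_saturated (hN.isCuttable A hA).isHigh.isSubgraph hsub ?_ hh hhA
  rintro k (hk | hk) hv
  · exact (hN.isCuttable A hA).isHigh.saturated hU (hN.not_subset A hA) k hk hv
  · exact hN.saturated hA k hk hv

theorem IsHigh.not_subset_empty {A : Set X.HalfEdge} (hA : X.IsHigh A) : ¬ A ⊆ ∅ :=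
  fun h => hA.nonempty.ne_empty (Set.subset_empty_iff.1 h)

theorem IsCutFamily.isCutUnion_sUnion (hN : IsCutFamily 𝒢 X E ∅ N) :
    IsCutUnion 𝒢 X (⋃₀ (N : Set (Set X.HalfEdge))) := by
  simpa using hN.isCutUnion isCutUnion_empty

theorem IsCutFamily.not_subset_sUnion (hN : IsCutFamily 𝒢 X E ∅ N) (hE : X.IsHigh E) :
    ¬ E ⊆ ⋃₀ (N : Set (Set X.HalfEdge)) := by
  simpa using hN.not_subset_union hE hE.not_subset_empty isCutUnion_empty

namespace Subquotient

variable (p : Subquotient X E U Y)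

theorem preimage_inj (hU : IsCutUnion 𝒢 X U) {A B : Set X.HalfEdge} (hA : X.IsHigh A)
    (hAE : A ⊆ E) (hAU : ¬ A ⊆ U) (hB : X.IsHigh B) (hBE : B ⊆ E) (hBU : ¬ B ⊆ U)
    (h : p.toFun ⁻¹' A = p.toFun ⁻¹' B) : A = B := by
  rw [← p.lift_preimage hA hAE hAU hU, h, p.lift_preimage hB hBE hBU hU]

-- Since no member lies in `U`, preimages are high and determine the members, so properness in `E`
-- becomes properness in `Y`.
open Classical in
theorem isCutFamily_image_preimage (hE : X.IsHigh E) (hEU : ¬ E ⊆ U) (hU : IsCutUnion 𝒢 X U)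
    (hN : IsCutFamily 𝒢 X E U N) :
    IsCutFamily 𝒢 Y Y.internal ∅ (N.image (p.toFun ⁻¹' ·)) := by
  have hF : ∀ A ∈ N, Y.IsHigh (p.toFun ⁻¹' A) := fun A hA =>
    p.isHigh_preimage (hN.isCuttable A hA).isHigh (hN.subset A hA) (hN.not_subset A hA) hU
  constructor
  · simp only [Finset.mem_image, forall_exists_index, and_imp]
    rintro _ A hA rfl
    exact (p.isCuttable_preimage_iff hE hEU hU (hN.isCuttable A hA).isHigh (hN.subset A hA)
      (hN.not_subset A hA)).2 (hN.isCuttable A hA)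
  · simp only [Finset.mem_image, forall_exists_index, and_imp]
    rintro _ A hA rfl
    exact (hF A hA).isSubgraph.internal
  · simp only [Finset.mem_image, forall_exists_index, and_imp]
    rintro _ A hA rfl h
    rw [p.internal_eq hE.isSubgraph] at h
    exact hN.ne A hA (p.preimage_inj hU (hN.isCuttable A hA).isHigh (hN.subset A hA)
      (hN.not_subset A hA) hE subset_rfl hEU h)
  · simp only [Finset.mem_image, forall_exists_index, and_imp]
    rintro _ A hA rfl
    exact (hF A hA).not_subset_empty
  · simp only [Finset.mem_image, forall_exists_index, and_imp]
    rintro _ A hA rfl _ B hB rfl hne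
    exact (hN.disjoint A hA B hB fun h => hne (h ▸ rfl)).preimage _

open Classical in
theorem isCutFamily_image_lift (hE : X.IsHigh E) (hEU : ¬ E ⊆ U) (hU : IsCutUnion 𝒢 X U)
    {M : Finset (Set Y.HalfEdge)} (hM : IsCutFamily 𝒢 Y Y.internal ∅ M) :
    IsCutFamily 𝒢 X E U (M.image p.lift) := by
  have hA : ∀ F ∈ M, X.IsHigh (p.lift F) := fun F hF =>
    p.isHigh_lift hE hU hEU (hM.isCuttable F hF).isHigh
  have hAE : ∀ F ∈ M, p.lift F ⊆ E := fun F hF =>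
    p.lift_subset hE hU hEU (hM.isCuttable F hF).isHigh
  have hAU : ∀ F ∈ M, ¬ p.lift F ⊆ U := fun F hF =>
    p.lift_not_subset (hM.nonempty hF)
  constructor
  · simp only [Finset.mem_image, forall_exists_index, and_imp]
    rintro _ F hF rfl
    rw [← p.isCuttable_preimage_iff hE hEU hU (hA F hF) (hAE F hF) (hAU F hF), p.preimage_lift]
    exact hM.isCuttable F hF
  · simp only [Finset.mem_image, forall_exists_index, and_imp]
    rintro _ F hF rfl
    exact hAE F hF
  · simp only [Finset.mem_image, forall_exists_index, and_imp]
    rintro _ F hF rfl h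
    refine hM.ne F hF ?_
    rw [← p.preimage_lift F, h, p.internal_eq hE.isSubgraph]
  · simp only [Finset.mem_image, forall_exists_index, and_imp]
    rintro _ F hF rfl
    exact hAU F hF
  · simp only [Finset.mem_image, forall_exists_index, and_imp]
    rintro _ F hF rfl _ G hG rfl hne
    have hd := hM.disjoint F hF G hG fun h => hne (h ▸ rfl)
    -- The lifts are nested or disjoint, and a nesting would descend to the disjoint subgraphs `F`
    -- and `G` of `Y`.
    rcases (hA F hF).subset_or_subset_or_disjoint (hA G hG) with h | h | h
    · have h1 := Set.preimage_mono (f := p.toFun) h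
      rw [p.preimage_lift, p.preimage_lift] at h1
      obtain ⟨f, hf⟩ := hM.nonempty hF
      exact (Set.disjoint_left.1 hd hf (h1 hf)).elim
    · have h1 := Set.preimage_mono (f := p.toFun) h
      rw [p.preimage_lift, p.preimage_lift] at h1
      obtain ⟨f, hf⟩ := hM.nonempty hG
      exact (Set.disjoint_left.1 hd (h1 hf) hf).elim
    · exact h

open Classical in
/-- The cut families of a subquotient are the cut families relative to the shrunk lines. -/
theorem sum_cutFamilies (hE : X.IsHigh E) (hEU : ¬ E ⊆ U) (hU : IsCutUnion 𝒢 X U)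
    {M : Type*} [AddCommMonoid M] (f : Finset (Set Y.HalfEdge) → M) :
    ∑ L ∈ cutFamilies 𝒢 Y Y.internal ∅, f L =
      ∑ N ∈ cutFamilies 𝒢 X E U, f (N.image (p.toFun ⁻¹' ·)) := by
  symm
  refine Finset.sum_bij' (fun N _ => N.image (p.toFun ⁻¹' ·)) (fun L _ => L.image p.lift)
    (fun N hN => ?_) (fun L hL => ?_) (fun N hN => ?_) (fun L hL => ?_) (fun N hN => rfl)
  · rw [mem_cutFamilies] at hN ⊢
    exact p.isCutFamily_image_preimage hE hEU hU hN
  · rw [mem_cutFamilies] at hL ⊢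
    exact p.isCutFamily_image_lift hE hEU hU hL
  · rw [mem_cutFamilies] at hN
    rw [Finset.image_image]
    refine (Finset.image_congr fun A hA => ?_).trans Finset.image_id
    exact p.lift_preimage (hN.isCuttable A hA).isHigh (hN.subset A hA) (hN.not_subset A hA) hU
  · rw [Finset.image_image]
    refine (Finset.image_congr fun F hF => ?_).trans Finset.image_id
    exact p.preimage_lift F

/-- The number of high subgraphs of a subquotient. -/
theorem ncard_isHigh (p : Subquotient X E U Y) (hE : X.IsHigh E) (hEU : ¬ E ⊆ U) (hU : IsCutUnion 𝒢 X U) :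
    {F | Y.IsHigh F}.ncard = {A | X.IsHigh A ∧ A ⊆ E ∧ ¬ A ⊆ U}.ncard := by
  refine Set.ncard_congr (fun F _ => p.lift F) ?_ ?_ ?_
  · exact fun F hF => ⟨p.isHigh_lift hE hU hEU hF, p.lift_subset hE hU hEU hF,
      p.lift_not_subset hF.nonempty⟩
  · intro F G _ _ h
    rw [← p.preimage_lift F, h, p.preimage_lift]
  · rintro A ⟨hA, hAE, hAU⟩
    exact ⟨_, p.isHigh_preimage hA hAE hAU hU, p.lift_preimage hA hAE hAU hU⟩

end Subquotient

/-- The high subgraphs are those of the members of a cut family and those of the quotient. -/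
theorem IsCutFamily.ncard_isHigh (hN : IsCutFamily 𝒢 X X.internal ∅ N) :
    {A | X.IsHigh A}.ncard = ∑ B ∈ N, {A | X.IsHigh A ∧ A ⊆ B ∧ ¬ A ⊆ ∅}.ncard +
      {A | X.IsHigh A ∧ A ⊆ X.internal ∧ ¬ A ⊆ ⋃₀ (N : Set (Set X.HalfEdge))}.ncard := by
  classical
  have hunion : {A | X.IsHigh A} = (⋃ B ∈ N, {A | X.IsHigh A ∧ A ⊆ B ∧ ¬ A ⊆ ∅}) ∪
      {A | X.IsHigh A ∧ A ⊆ X.internal ∧ ¬ A ⊆ ⋃₀ (N : Set (Set X.HalfEdge))} := by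
    ext A
    simp only [Set.mem_ofPred_eq, Set.mem_union, Set.mem_iUnion, exists_prop]
    constructor
    · intro hA
      -- Being connected, `A` lies in the union only if it lies in a single member.
      by_cases hAU : A ⊆ ⋃₀ (N : Set (Set X.HalfEdge))
      · obtain ⟨h, hh⟩ := hA.nonempty
        obtain ⟨B, hB, hhB⟩ := hAU hh
        exact Or.inl ⟨B, hB, hA, hA.subset_of_saturated (hN.isCuttable B hB).isHigh.isSubgraph hAU
          (hN.saturated hB) hh hhB, hA.not_subset_empty⟩
      · exact Or.inr ⟨hA, hA.isSubgraph.internal, hAU⟩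
    · rintro (⟨B, -, hA, -⟩ | ⟨hA, -⟩) <;> exact hA
  have hd : ∀ B ∈ N, ∀ C ∈ N, B ≠ C → Disjoint {A | X.IsHigh A ∧ A ⊆ B ∧ ¬ A ⊆ ∅}
      {A | X.IsHigh A ∧ A ⊆ C ∧ ¬ A ⊆ ∅} := by
    intro B hB C hC hne
    refine Set.disjoint_left.2 ?_
    rintro A ⟨hA, hAB, -⟩ ⟨-, hAC, -⟩
    obtain ⟨h, hh⟩ := hA.nonempty
    exact hne (hN.eq_of_mem hB hC (hAB hh) (hAC hh))
  rw [hunion, Set.ncard_union_eq]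
  · congr 1
    rw [← finsum_mem_coe_finset]
    exact N.finite_toSet.ncard_biUnion (fun _ _ => Set.toFinite _)
      fun B hB C hC hne => hd B hB C hC hne
  · refine Set.disjoint_left.2 fun A hA hA' => ?_
    simp only [Set.mem_iUnion, exists_prop] at hA
    obtain ⟨B, hB, -, hAB, -⟩ := hA
    exact hA'.2.2 (hAB.trans (Set.subset_sUnion_of_mem hB))

end CutFamily

end AssignedGraph

/-! ### Admissible cuts as cut families -/

namespace AdmissibleCut

open AssignedGraph

variable {𝒢 : GraphClass} {X : AssignedGraph} {hX : X.IsConnected}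

theorem arrow (C : AdmissibleCut 𝒢 X hX) {a : X.Node × X.Node} (ha : a ∈ C.1) :
    a.1.Arrow a.2 ∧ a.1.lines ≠ a.2.lines :=
  (isEssential_iff hX).1 (C.2.isEssential a ha)

theorem lines_injOn (C : AdmissibleCut 𝒢 X hX) {a b : X.Node × X.Node} (ha : a ∈ C.1)
    (hb : b ∈ C.1) (h : a.1.lines = b.1.lines) : a = b :=
  Prod.ext_iff.2 ((C.arrow ha).1.eq_of_lines_eq (C.arrow hb).1 (C.arrow ha).2 (C.arrow hb).2 h)

/-- Cuts impose conditions on the decoration as a graph of its own; its presentation over `X` turns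
them into conditions on lines. -/
theorem isCuttable_lines_iff (hX : X.IsConnected) (a : X.Node) : IsCuttable 𝒢 X a.lines ↔
    (a.graph.numLegs = 2 ∨ a.graph.numLegs = 4) ∧ (𝒢.onePIOnly → a.graph.IsOnePI) := by
  have hA := a.isComponent.isHigh
  have p : Subquotient X a.lines ∅ a.graph := hX.subquotientSub hA
  have h1 := p.numLegs_eq hA.isSubgraph fun _ h => h.elim
  have h2 := fun h => p.isOnePI_iff (𝒢 := 𝒢) hA hA.not_subset_empty isCutUnion_empty h
  rw [h1]
  exact ⟨fun h => ⟨h.ncard_legs, fun h𝒢 => (h2 h𝒢).2 (h.onePI h𝒢)⟩,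
    fun h => ⟨hA, h.1, fun h𝒢 => (h2 h𝒢).1 (h.2 h𝒢)⟩⟩

open Classical in
/-- The family of subgraphs that are cut off. -/
noncomputable def family (C : AdmissibleCut 𝒢 X hX) : Finset (Set X.HalfEdge) :=
  C.1.image fun a => Node.lines (X := X) a.1

theorem isCutFamily (C : AdmissibleCut 𝒢 X hX) :
    IsCutFamily 𝒢 X X.internal ∅ C.family := by
  constructor
  · simp only [family, Finset.mem_image, forall_exists_index, and_imp]
    rintro _ a ha rfl
    exact (isCuttable_lines_iff hX _).2 ⟨C.2.numLegs_eq a ha, fun h => C.2.onePI h a ha⟩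
  · simp only [family, Finset.mem_image, forall_exists_index, and_imp]
    rintro _ a ha rfl
    exact (Node.isComponent (X := X) a.1).isHigh.isSubgraph.internal
  · simp only [family, Finset.mem_image, forall_exists_index, and_imp]
    rintro _ a ha rfl
    exact (C.arrow ha).1.ne_internal (C.arrow ha).2
  · simp only [family, Finset.mem_image, forall_exists_index, and_imp]
    rintro _ a ha rfl
    exact (Node.isComponent (X := X) a.1).isHigh.not_subset_empty
  · simp only [family, Finset.mem_image, forall_exists_index, and_imp]
    rintro _ a ha rfl _ b hb rfl hne
    have hab : a ≠ b := fun h => hne (h ▸ rfl)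
    exact ((C.arrow ha).1.disjoint_iff (C.arrow hb).1 (C.arrow ha).2 (C.arrow hb).2 hab).2
      ⟨C.2.no_path a ha b hb hab, C.2.no_path b hb a ha hab.symm⟩

theorem cutLines_eq (C : AdmissibleCut 𝒢 X hX) :
    C.cutLines = ⋃₀ (C.family : Set (Set X.HalfEdge)) := by
  ext h
  simp only [cutLines, Set.mem_iUnion, Set.mem_sUnion, family, Finset.coe_image]
  constructor
  · rintro ⟨a, ha⟩
    exact ⟨_, ⟨a.1, a.2, rfl⟩, ha⟩
  · rintro ⟨_, ⟨a, ha, rfl⟩, hh⟩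
    exact ⟨⟨a, ha⟩, hh⟩

/-- An essential arrow is determined by the lines that it cuts off. -/
theorem family_injective : Function.Injective (family : AdmissibleCut 𝒢 X hX → _) := by
  have key : ∀ C D : AdmissibleCut 𝒢 X hX, C.family = D.family → C.1 ⊆ D.1 := by
    intro C D h a ha
    have h1 : Node.lines (X := X) a.1 ∈ D.family := h ▸ Finset.mem_image_of_mem _ ha
    obtain ⟨b, hb, hba⟩ := Finset.mem_image.1 h1
    obtain ⟨h2, h3⟩ := (C.arrow ha).1.eq_of_lines_eq (D.arrow hb).1 (C.arrow ha).2 (D.arrow hb).2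
      hba.symm
    have : a = b := Prod.ext h2 h3
    exact this ▸ hb
  intro C D h
  exact Subtype.ext (Finset.Subset.antisymm (key C D h) (key D C h.symm))

/-- Each member is cut off by an essential arrow, and disjointness keeps these arrows off a common
path. -/
theorem exists_family_eq {N : Finset (Set X.HalfEdge)} (hN : IsCutFamily 𝒢 X X.internal ∅ N)
    (hne : N.Nonempty) : ∃ C : AdmissibleCut 𝒢 X hX, C.family = N := by
  classical
  have : Nonempty X.Node := ⟨(gnTree X hX).root⟩
  choose! a b hab hne' hlines using fun A hA =>
    (hN.isCuttable A hA).isHigh.exists_arrow hX (hN.ne A hA)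
  have hinj : ∀ A ∈ N, ∀ B ∈ N, (a A, b A) ≠ (a B, b B) → A ≠ B := by
    rintro A - B - h rfl
    exact h rfl
  have hcut : IsAdmissibleCut 𝒢 (gnTree X hX) (N.image fun A => (a A, b A)) := by
    constructor
    · exact hne.image _
    · simp only [Finset.mem_image, forall_exists_index, and_imp]
      rintro _ A hA rfl
      exact (isEssential_iff hX).2 ⟨hab A hA, hne' A hA⟩
    · simp only [Finset.mem_image, forall_exists_index, and_imp]
      rintro _ A hA rfl
      exact ((isCuttable_lines_iff hX (a A)).1 ((hlines A hA).symm ▸ hN.isCuttable A hA)).1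
    · simp only [Finset.mem_image, forall_exists_index, and_imp]
      rintro h𝒢 _ A hA rfl
      exact ((isCuttable_lines_iff hX (a A)).1 ((hlines A hA).symm ▸ hN.isCuttable A hA)).2 h𝒢
    · simp only [Finset.mem_image, forall_exists_index, and_imp]
      rintro _ A hA rfl _ B hB rfl h
      refine (((hab A hA).disjoint_iff (hab B hB) (hne' A hA) (hne' B hB) h).1 ?_).1
      rw [hlines A hA, hlines B hB]
      exact hN.disjoint A hA B hB (hinj A hA B hB h)
  refine ⟨⟨_, hcut⟩, ?_⟩
  change (N.image fun A => (a A, b A)).image (fun a => Node.lines (X := X) a.1) = N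
  rw [Finset.image_image]
  exact (Finset.image_congr fun A hA => hlines A hA).trans Finset.image_id

open Classical in
/-- A sum over admissible cuts is a sum over nonempty families of disjoint cuttable subgraphs. -/
theorem sum_family {M : Type*} [AddCommMonoid M] (f : Finset (Set X.HalfEdge) → M) :
    ∑ C : AdmissibleCut 𝒢 X hX, f C.family =
      ∑ N ∈ (cutFamilies 𝒢 X X.internal ∅).erase ∅, f N := by
  refine Finset.sum_bij (fun C _ => C.family) (fun C _ => ?_) (fun C _ D _ h => family_injective h)
    (fun N hN => ?_) (fun C _ => rfl)
  · rw [Finset.mem_erase, mem_cutFamilies]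
    exact ⟨(C.2.nonempty.image _).ne_empty, C.isCutFamily⟩
  · rw [Finset.mem_erase, mem_cutFamilies] at hN
    obtain ⟨C, hC⟩ := exists_family_eq (hX := hX) hN.2 (Finset.nonempty_iff_ne_empty.2 hN.1)
    exact ⟨C, Finset.mem_univ _, hC⟩

theorem prod_family {M : Type*} [CommMonoid M] (C : AdmissibleCut 𝒢 X hX)
    (f : Set X.HalfEdge → M) :
    ∏ a : C.1, f (C.prunedNode a).lines = ∏ A ∈ C.family, f A := by
  classical
  exact (Finset.prod_coe_sort C.1 fun a => f (Node.lines (X := X) a.1)).trans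
    (Finset.prod_image fun a ha b hb h => C.lines_injOn ha hb h).symm

end AdmissibleCut

open AssignedGraph

/-! ### Generators indexed by subquotients, coproduct and counit -/

section Generators

variable {𝒢 : GraphClass} {K : Type*} [Field K] {X Y : AssignedGraph}

/-- A graph can be read off from the root of its tree, and isomorphisms of graphs act on components
level by level. -/
theorem GNTree.of_eq_of_iff (hX : 𝒢.Mem X) (hY : 𝒢.Mem Y) :
    GNTree.of X hX = GNTree.of Y hY ↔ X.IsIso Y := by
  refine Subtype.ext_iff.trans (Quotient.eq.trans ⟨?_, ?_⟩)
  · rintro ⟨f⟩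
    exact IsIso.of_gnTree hX.connected hY.connected f
  · rintro ⟨f⟩
    exact ⟨f.gnTree hX.connected hY.connected⟩

theorem GNTree.exists_eq_of (t : GNTree 𝒢) : ∃ (X : AssignedGraph) (hX : 𝒢.Mem X),
    t = GNTree.of X hX := by
  obtain ⟨t, X, hX, rfl⟩ := t
  exact ⟨X, hX, rfl⟩

theorem GNTree.degree_of (hX : 𝒢.Mem X) : (GNTree.of X hX).degree = {E | X.IsHigh E}.ncard :=
  degree_gnTree hX.connected

open Classical in
/-- The generator given by the tree of a graph, and zero for graphs that are not in the class. -/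
noncomputable def treeGen (𝒢 : GraphClass) (K : Type*) [Field K] (X : AssignedGraph) :
    GNAlgebra 𝒢 K :=
  if hX : 𝒢.Mem X then gen K X hX else 0

theorem treeGen_of_mem (hX : 𝒢.Mem X) : treeGen 𝒢 K X = gen K X hX := dif_pos hX

theorem treeGen_congr (h : X.IsIso Y) : treeGen 𝒢 K X = treeGen 𝒢 K Y := by
  by_cases hX : 𝒢.Mem X
  · rw [treeGen_of_mem hX, treeGen_of_mem (h.mem hX), gen, gen,
      (GNTree.of_eq_of_iff hX (h.mem hX)).2 h]
  · rw [treeGen, treeGen, dif_neg hX, dif_neg fun hY => hX (h.symm.mem hY)]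

open Classical in
/-- The generator given by the subgraph `E` in which the lines of `U` are shrunk. -/
noncomputable def quotGen (𝒢 : GraphClass) (K : Type*) [Field K] {X : AssignedGraph}
    (E U : Set X.HalfEdge) : GNAlgebra 𝒢 K :=
  if h : ∃ Y, Nonempty (Subquotient X E U Y) then treeGen 𝒢 K h.choose else 0

variable {E U : Set X.HalfEdge}

/-- The graph chosen in `quotGen` is immaterial, because all presentations of `E` and `U` are
isomorphic. Equalities between generators thus become equalities between sets of lines. -/
theorem AssignedGraph.Subquotient.quotGen_eq (p : Subquotient X E U Y) :
    quotGen 𝒢 K E U = treeGen 𝒢 K Y := by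
  have h : ∃ Y, Nonempty (Subquotient X E U Y) := ⟨Y, ⟨p⟩⟩
  rw [quotGen, dif_pos h]
  exact treeGen_congr (h.choose_spec.some.isIso p)

/-- Shrink `U` in all of `X` first, then restrict to what is left of `E`. -/
theorem AssignedGraph.IsConnected.exists_subquotient (hX : X.IsConnected) (hE : X.IsHigh E)
    (hU : IsCutUnion 𝒢 X U) (hEU : ¬ E ⊆ U) : ∃ Y, Nonempty (Subquotient X E U Y) := by
  have p := hX.subquotientShrink hU.isSubgraph fun h =>
    hEU (Set.Subset.trans hE.isSubgraph.internal h)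
  exact ⟨_, ⟨p.sub hE hE.isSubgraph.internal hEU hU.isSubgraph (hE.saturated hU hEU)
    (p.isSubgraph_preimage hE.isSubgraph hE.isSubgraph.internal)⟩⟩

/-- Shrunk components outside `E` do not touch it, by saturation. -/
theorem quotGen_inter (hX : X.IsConnected) (hE : X.IsHigh E) (hU : IsCutUnion 𝒢 X U)
    (hEU : ¬ E ⊆ U) : quotGen 𝒢 K E (U ∩ E) = quotGen 𝒢 K E U := by
  obtain ⟨Y, ⟨p⟩⟩ := hX.exists_subquotient hE hU hEU
  rw [p.quotGen_eq, (p.inter hE.isSubgraph (hE.saturated hU hEU)).quotGen_eq]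

/-- The sum over all cuts of the tree of a graph, including the empty one. -/
noncomputable def cutSum (𝒢 : GraphClass) (K : Type*) [Field K] (X : AssignedGraph) :
    GNAlgebra 𝒢 K ⊗[K] GNAlgebra 𝒢 K :=
  ∑ N ∈ cutFamilies 𝒢 X X.internal ∅, (∏ A ∈ N, quotGen 𝒢 K A ∅) ⊗ₜ[K]
    quotGen 𝒢 K X.internal (⋃₀ (N : Set (Set X.HalfEdge)))

/-- The cuts of a subquotient in terms of the graph. -/
theorem AssignedGraph.Subquotient.cutSum_eq (p : Subquotient X E U Y) (hE : X.IsHigh E)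
    (hEU : ¬ E ⊆ U) (hU : IsCutUnion 𝒢 X U) :
    cutSum 𝒢 K Y = ∑ N ∈ cutFamilies 𝒢 X E U, (∏ A ∈ N, quotGen 𝒢 K A U) ⊗ₜ[K]
      quotGen 𝒢 K E (U ∪ ⋃₀ (N : Set (Set X.HalfEdge))) := by
  classical
  have hY := p.isConnected hE hEU
  rw [cutSum, p.sum_cutFamilies hE hEU hU]
  refine Finset.sum_congr rfl fun N hN => ?_
  rw [mem_cutFamilies] at hN
  congr 1
  · rw [Finset.prod_image]
    · refine Finset.prod_congr rfl fun A hA => ?_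
      have hAh := (hN.isCuttable A hA).isHigh
      have hF := p.isHigh_preimage hAh (hN.subset A hA) (hN.not_subset A hA) hU
      rw [(hY.subquotientSub hF).quotGen_eq, (p.sub hAh (hN.subset A hA) (hN.not_subset A hA)
        hU.isSubgraph (hAh.saturated hU (hN.not_subset A hA)) hF.isSubgraph).quotGen_eq]
    · exact fun A hA B hB h => p.preimage_inj hU (hN.isCuttable A hA).isHigh (hN.subset A hA)
        (hN.not_subset A hA) (hN.isCuttable B hB).isHigh (hN.subset B hB) (hN.not_subset B hB) h
  · have hset : ⋃₀ ((N.image (p.toFun ⁻¹' ·) : Finset (Set Y.HalfEdge)) : Set (Set Y.HalfEdge)) =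
        p.toFun ⁻¹' (⋃₀ (N : Set (Set X.HalfEdge))) := by
      ext k
      simp
    have hW := p.isSubgraph_preimage hN.isSubgraph hN.sUnion_subset
    have hEW := hN.not_subset_union hE hEU hU
    have hYW : ¬ Y.internal ⊆ p.toFun ⁻¹' (⋃₀ (N : Set (Set X.HalfEdge))) := by
      rw [p.internal_eq hE.isSubgraph]
      intro h
      refine hEW fun e he => ?_
      by_cases heU : e ∈ U
      · exact Or.inl heU
      · obtain ⟨k, rfl⟩ := p.exists_toFun_eq ⟨e, he, rfl⟩ heU
        exact Or.inr (h he)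
    -- Shrinking the family in `Y` is the same as shrinking `U` and the family together in `X`.
    rw [hset, (hY.subquotientShrink hW hYW).quotGen_eq,
      (p.shrink hE hN.sUnion_subset hEW hW).quotGen_eq]

/-- Both graphs are presentations of `X` with nothing shrunk, so both sums are given by the same
formula over `X`. -/
theorem cutSum_congr (hX : X.IsConnected) (h : X.IsIso Y) : cutSum 𝒢 K X = cutSum 𝒢 K Y := by
  obtain ⟨f⟩ := h
  have hI := hX.isHigh_internal
  rw [hX.subquotient.cutSum_eq hI hI.not_subset_empty isCutUnion_empty,
    (f.subquotient hX).cutSum_eq hI hI.not_subset_empty isCutUnion_empty]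

/-- The coproduct of the tree of a graph. -/
noncomputable def treeCoproduct (𝒢 : GraphClass) (K : Type*) [Field K] (X : AssignedGraph) :
    GNAlgebra 𝒢 K ⊗[K] GNAlgebra 𝒢 K :=
  treeGen 𝒢 K X ⊗ₜ[K] 1 + cutSum 𝒢 K X

/-- The coproduct. -/
noncomputable def coproduct (𝒢 : GraphClass) (K : Type*) [Field K] :
    GNAlgebra 𝒢 K →ₐ[K] GNAlgebra 𝒢 K ⊗[K] GNAlgebra 𝒢 K :=
  MvPolynomial.aeval fun t => treeCoproduct 𝒢 K t.exists_eq_of.choose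

/-- On a generator, `coproduct` uses some chosen graph with the given tree; that graph is unique up
to isomorphism, and the formula is invariant. -/
theorem coproduct_treeGen (hX : 𝒢.Mem X) :
    coproduct 𝒢 K (treeGen 𝒢 K X) = treeGen 𝒢 K X ⊗ₜ[K] 1 + cutSum 𝒢 K X := by
  obtain ⟨hY, h⟩ := (GNTree.of X hX).exists_eq_of.choose_spec
  rw [GNTree.of_eq_of_iff] at h
  rw [treeGen_of_mem hX, gen, coproduct, MvPolynomial.aeval_X, treeCoproduct,
    ← treeGen_congr h, ← cutSum_congr hX.connected h, treeGen_of_mem hX, gen]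

/-- The counit. -/
noncomputable def counit (𝒢 : GraphClass) (K : Type*) [Field K] : GNAlgebra 𝒢 K →ₐ[K] K :=
  MvPolynomial.aeval fun _ => 0

theorem counit_treeGen : counit 𝒢 K (treeGen 𝒢 K X) = 0 := by
  rw [treeGen]
  split_ifs
  · rw [gen, counit, MvPolynomial.aeval_X]
  · exact map_zero _

theorem counit_quotGen : counit 𝒢 K (quotGen 𝒢 K E U) = 0 := by
  rw [quotGen]
  split_ifs
  · exact counit_treeGen
  · exact map_zero _

theorem coproduct_quotGen (hX : 𝒢.Mem X) (hE : X.IsHigh E) (hE1 : 𝒢.onePIOnly → X.IsOnePISub E)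
    (hEU : ¬ E ⊆ U) (hU : IsCutUnion 𝒢 X U) :
    coproduct 𝒢 K (quotGen 𝒢 K E U) = quotGen 𝒢 K E U ⊗ₜ[K] 1 +
      ∑ N ∈ cutFamilies 𝒢 X E U, (∏ A ∈ N, quotGen 𝒢 K A U) ⊗ₜ[K]
        quotGen 𝒢 K E (U ∪ ⋃₀ (N : Set (Set X.HalfEdge))) := by
  obtain ⟨Y, ⟨p⟩⟩ := hX.connected.exists_subquotient hE hU hEU
  rw [p.quotGen_eq, coproduct_treeGen (p.mem hX hE hE1 hEU hU), p.cutSum_eq hE hEU hU]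

theorem quotGen_internal_empty (hX : X.IsConnected) :
    quotGen 𝒢 K X.internal ∅ = treeGen 𝒢 K X := hX.subquotient.quotGen_eq

/-- The empty family has the empty product on the left and nothing shrunk on the right. -/
theorem cutSum_eq_add_erase [DecidableEq (Finset (Set X.HalfEdge))] (hX : X.IsConnected) :
    cutSum 𝒢 K X = 1 ⊗ₜ[K] treeGen 𝒢 K X +
      ∑ N ∈ (cutFamilies 𝒢 X X.internal ∅).erase ∅, (∏ A ∈ N, quotGen 𝒢 K A ∅) ⊗ₜ[K]
        quotGen 𝒢 K X.internal (⋃₀ (N : Set (Set X.HalfEdge))) := by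
  rw [cutSum, ← Finset.add_sum_erase _ _ (mem_cutFamilies.2 isCutFamily_empty)]
  simp [quotGen_internal_empty hX]

end Generators

/-! ### Coassociativity and counit -/

section Coassociativity

variable {𝒢 : GraphClass} {K : Type*} [Field K] {X : AssignedGraph}

/-- Each member of the first family is contained in a member of the second one. -/
def Refines (B C : Finset (Set X.HalfEdge)) : Prop := ∀ A ∈ B, ∃ g ∈ C, A ⊆ g

open Classical in
/-- The cut families of a member of a cut family, and the family that consists of the member. -/
noncomputable def localFamilies (𝒢 : GraphClass) (X : AssignedGraph) (g : Set X.HalfEdge) :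
    Finset (Finset (Set X.HalfEdge)) :=
  insert {g} (cutFamilies 𝒢 X g ∅)

theorem mem_localFamilies {g : Set X.HalfEdge} {B : Finset (Set X.HalfEdge)} :
    B ∈ localFamilies 𝒢 X g ↔ B = {g} ∨ IsCutFamily 𝒢 X g ∅ B := by
  rw [localFamilies, Finset.mem_insert, mem_cutFamilies]

theorem subset_of_mem_localFamilies {g A : Set X.HalfEdge} {B : Finset (Set X.HalfEdge)}
    (hB : B ∈ localFamilies 𝒢 X g) (hA : A ∈ B) : A ⊆ g := by
  rcases mem_localFamilies.1 hB with rfl | hB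
  · exact (Finset.mem_singleton.1 hA).subset
  · exact hB.subset A hA

theorem isCuttable_of_mem_localFamilies {g A : Set X.HalfEdge} {B : Finset (Set X.HalfEdge)}
    (hg : IsCuttable 𝒢 X g) (hB : B ∈ localFamilies 𝒢 X g) (hA : A ∈ B) : IsCuttable 𝒢 X A := by
  rcases mem_localFamilies.1 hB with rfl | hB
  · exact (Finset.mem_singleton.1 hA) ▸ hg
  · exact hB.isCuttable A hA

variable {C : Finset (Set X.HalfEdge)}

/-- Pieces chosen in different members of `C` are disjoint, and all are proper because the members
of `C` are. -/
theorem isCutFamily_biUnion [DecidableEq (Set X.HalfEdge)] (hC : IsCutFamily 𝒢 X X.internal ∅ C)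
    {q : ∀ g ∈ C, Finset (Set X.HalfEdge)} (hq : ∀ g hg, q g hg ∈ localFamilies 𝒢 X g) :
    IsCutFamily 𝒢 X X.internal ∅ (C.attach.biUnion fun g => q g.1 g.2) := by
  have hcut : ∀ A ∈ C.attach.biUnion (fun g => q g.1 g.2), IsCuttable 𝒢 X A := by
    simp only [Finset.mem_biUnion, Finset.mem_attach, true_and, forall_exists_index]
    rintro A ⟨g, hg⟩ hA
    exact isCuttable_of_mem_localFamilies (hC.isCuttable g hg) (hq g hg) hA
  refine ⟨hcut, fun A hA => (hcut A hA).isHigh.isSubgraph.internal, ?_,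
    fun A hA => (hcut A hA).isHigh.not_subset_empty, ?_⟩
  · simp only [Finset.mem_biUnion, Finset.mem_attach, true_and, forall_exists_index]
    rintro _ ⟨g, hg⟩ hA rfl
    exact hC.ne g hg (Set.Subset.antisymm (hC.subset g hg)
      (subset_of_mem_localFamilies (hq g hg) hA))
  · simp only [Finset.mem_biUnion, Finset.mem_attach, true_and, forall_exists_index]
    rintro A ⟨g, hg⟩ hA B ⟨k, hk⟩ hB hne
    by_cases hgk : g = k
    · subst hgk
      rcases mem_localFamilies.1 (hq g hg) with h | h
      · rw [h, Finset.mem_singleton] at hA hB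
        exact (hne (hA.trans hB.symm)).elim
      · exact h.disjoint A hA B hB hne
    · exact (hC.disjoint g hg k hk hgk).mono (subset_of_mem_localFamilies (hq g hg) hA)
        (subset_of_mem_localFamilies (hq k hk) hB)

/-- If `g` belongs to `B`, disjointness leaves no other member inside it, which gives `{g}`;
otherwise all members inside `g` are proper. -/
theorem filter_mem_localFamilies [DecidableEq (Set X.HalfEdge)] {B : Finset (Set X.HalfEdge)}
    [DecidableRel (α := Set X.HalfEdge) (· ⊆ ·)]
    (hB : IsCutFamily 𝒢 X X.internal ∅ B) {g : Set X.HalfEdge} :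
    B.filter (· ⊆ g) ∈ localFamilies 𝒢 X g := by
  rw [mem_localFamilies]
  by_cases hg : g ∈ B
  · left
    ext A
    simp only [Finset.mem_filter, Finset.mem_singleton]
    constructor
    · exact fun h => hB.eq_of_subset h.1 hg h.2
    · rintro rfl
      exact ⟨hg, subset_rfl⟩
  · right
    have hmem : ∀ A ∈ B.filter (· ⊆ g), A ∈ B ∧ A ⊆ g := fun A hA => Finset.mem_filter.1 hA
    exact ⟨fun A hA => hB.isCuttable A (hmem A hA).1, fun A hA => (hmem A hA).2,
      fun A hA h => hg (h ▸ (hmem A hA).1), fun A hA => hB.not_subset A (hmem A hA).1,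
      fun A hA A' hA' => hB.disjoint A (hmem A hA).1 A' (hmem A' hA').1⟩

open Classical in
/-- To choose a cut family in each member of a cut family is to choose a finer cut family. -/
theorem sum_pi_localFamilies (hC : IsCutFamily 𝒢 X X.internal ∅ C) {M : Type*} [AddCommMonoid M]
    (f : Finset (Set X.HalfEdge) → M) :
    ∑ q ∈ C.pi (localFamilies 𝒢 X), f (C.attach.biUnion fun g => q g.1 g.2) =
      ∑ B ∈ (cutFamilies 𝒢 X X.internal ∅).filter (Refines · C), f B := by
  -- The members of `C` are disjoint, so the choice made in `g` is recovered from the union as the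
  -- sets that lie in `g`.
  refine Finset.sum_bij' (fun q _ => C.attach.biUnion fun g => q g.1 g.2)
    (fun B _ g _ => B.filter (· ⊆ g)) (fun q hq => ?_) (fun B hB => ?_) (fun q hq => ?_)
    (fun B hB => ?_) (fun _ _ => rfl)
  · rw [Finset.mem_pi] at hq
    rw [Finset.mem_filter, mem_cutFamilies]
    refine ⟨isCutFamily_biUnion hC hq, fun A hA => ?_⟩
    simp only [Finset.mem_biUnion, Finset.mem_attach, true_and] at hA
    obtain ⟨⟨g, hg⟩, hA⟩ := hA
    exact ⟨g, hg, subset_of_mem_localFamilies (hq g hg) hA⟩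
  · rw [Finset.mem_filter, mem_cutFamilies] at hB
    exact Finset.mem_pi.2 fun g _ => filter_mem_localFamilies hB.1
  · rw [Finset.mem_pi] at hq
    funext g hg
    ext A
    simp only [Finset.mem_filter, Finset.mem_biUnion, Finset.mem_attach, true_and]
    constructor
    · rintro ⟨⟨⟨k, hk⟩, hA⟩, hAg⟩
      obtain ⟨h, hh⟩ := (isCuttable_of_mem_localFamilies (hC.isCuttable k hk) (hq k hk)
        hA).isHigh.nonempty
      obtain rfl := hC.eq_of_mem hk hg (subset_of_mem_localFamilies (hq k hk) hA hh) (hAg hh)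
      exact hA
    · exact fun hA => ⟨⟨⟨g, hg⟩, hA⟩, subset_of_mem_localFamilies (hq g hg) hA⟩
  · rw [Finset.mem_filter, mem_cutFamilies] at hB
    ext A
    simp only [Finset.mem_filter, Finset.mem_biUnion, Finset.mem_attach, true_and]
    constructor
    · rintro ⟨_, hA, _⟩
      exact hA
    · intro hA
      obtain ⟨g, hg, hAg⟩ := hB.2 A hA
      exact ⟨⟨g, hg⟩, hA, hAg⟩

variable {B : Finset (Set X.HalfEdge)}

theorem Refines.sUnion_eq [DecidableEq (Set X.HalfEdge)] (h : Refines B C) :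
    ⋃₀ (B : Set (Set X.HalfEdge)) ∪ ⋃₀ ((C \ B : Finset (Set X.HalfEdge)) : Set (Set X.HalfEdge)) =
      ⋃₀ (C : Set (Set X.HalfEdge)) := by
  ext e
  constructor
  · rintro (⟨A, hA, he⟩ | ⟨A, hA, he⟩)
    · obtain ⟨g, hg, hAg⟩ := h A hA
      exact ⟨g, hg, hAg he⟩
    · exact ⟨A, (Finset.mem_sdiff.1 hA).1, he⟩
  · rintro ⟨A, hA, he⟩
    by_cases hAB : A ∈ B
    · exact Or.inl ⟨A, hAB, he⟩
    · exact Or.inr ⟨A, Finset.mem_sdiff.2 ⟨hA, hAB⟩, he⟩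

/-- If `B` covered `g`, connectedness would put `g` into a single member of `B`, which lies in a
member of `C`; this must be `g` again, so `g` would belong to `B`. -/
theorem Refines.not_subset (h : Refines B C) (hB : IsCutFamily 𝒢 X X.internal ∅ B)
    (hC : IsCutFamily 𝒢 X X.internal ∅ C) {g : Set X.HalfEdge} (hg : g ∈ C) (hgB : g ∉ B) :
    ¬ g ⊆ ⋃₀ (B : Set (Set X.HalfEdge)) := by
  intro hsub
  obtain ⟨e, he⟩ := hC.nonempty hg
  obtain ⟨A, hA, heA⟩ := hsub he
  have hgA := (hC.isCuttable g hg).isHigh.subset_of_saturated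
    (hB.isCuttable A hA).isHigh.isSubgraph hsub (hB.saturated hA) he heA
  obtain ⟨k, hk, hAk⟩ := h A hA
  obtain rfl := hC.eq_of_subset hg hk (hgA.trans hAk)
  exact hgB ((Set.Subset.antisymm hgA hAk) ▸ hA)

open Classical in
/-- The cut families that are coarser than a given one are the cut families of the quotient. -/
theorem sum_refines (hB : IsCutFamily 𝒢 X X.internal ∅ B) {M : Type*} [AddCommMonoid M]
    (f : Finset (Set X.HalfEdge) → M) :
    ∑ C ∈ (cutFamilies 𝒢 X X.internal ∅).filter (Refines B ·), f (C \ B) =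
      ∑ N ∈ cutFamilies 𝒢 X X.internal (⋃₀ (B : Set (Set X.HalfEdge))), f N := by
  -- Going back, one adds to `N` the members of `B` that no member of `N` absorbs; these are the
  -- sets common to `B` and `C`.
  refine Finset.sum_bij' (fun C _ => C \ B)
    (fun N _ => N ∪ B.filter fun A => ∀ g ∈ N, ¬ A ⊆ g) (fun C hC => ?_) (fun N hN => ?_)
    (fun C hC => ?_) (fun N hN => ?_) (fun _ _ => rfl)
  · rw [Finset.mem_filter, mem_cutFamilies] at hC
    rw [mem_cutFamilies]
    have hmem : ∀ g ∈ C \ B, g ∈ C ∧ g ∉ B := fun g hg => Finset.mem_sdiff.1 hg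
    exact ⟨fun g hg => hC.1.isCuttable g (hmem g hg).1, fun g hg => hC.1.subset g (hmem g hg).1,
      fun g hg => hC.1.ne g (hmem g hg).1,
      fun g hg => hC.2.not_subset hB hC.1 (hmem g hg).1 (hmem g hg).2,
      fun g hg k hk => hC.1.disjoint g (hmem g hg).1 k (hmem k hk).1⟩
  · rw [mem_cutFamilies] at hN
    rw [Finset.mem_filter, mem_cutFamilies]
    have hmem : ∀ g ∈ N ∪ B.filter (fun A => ∀ g ∈ N, ¬ A ⊆ g),
        g ∈ N ∨ (g ∈ B ∧ ∀ k ∈ N, ¬ g ⊆ k) := fun g hg =>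
      (Finset.mem_union.1 hg).imp_right fun h => Finset.mem_filter.1 h
    have hd : ∀ g ∈ N, ∀ A ∈ B, (∀ k ∈ N, ¬ A ⊆ k) → Disjoint g A := by
      intro g hg A hA h
      rcases (hN.isCuttable g hg).isHigh.subset_or_subset_or_disjoint
        (hB.isCuttable A hA).isHigh with h1 | h1 | h1
      · exact (hN.not_subset g hg (h1.trans (Set.subset_sUnion_of_mem hA))).elim
      · exact (h g hg h1).elim
      · exact h1
    have hcut : ∀ g ∈ N ∪ B.filter (fun A => ∀ g ∈ N, ¬ A ⊆ g), IsCuttable 𝒢 X g := fun g hg =>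
      (hmem g hg).elim (hN.isCuttable g) fun h => hB.isCuttable g h.1
    refine ⟨⟨hcut, fun g hg => (hcut g hg).isHigh.isSubgraph.internal,
      fun g hg => (hmem g hg).elim (hN.ne g) fun h => hB.ne g h.1,
      fun g hg => (hcut g hg).isHigh.not_subset_empty, fun g hg k hk hne => ?_⟩, fun A hA => ?_⟩
    · rcases hmem g hg with h1 | h1 <;> rcases hmem k hk with h2 | h2
      · exact hN.disjoint g h1 k h2 hne
      · exact hd g h1 k h2.1 h2.2
      · exact (hd k h2 g h1.1 h1.2).symm
      · exact hB.disjoint g h1.1 k h2.1 hne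
    · by_cases h : ∃ g ∈ N, A ⊆ g
      · obtain ⟨g, hg, hAg⟩ := h
        exact ⟨g, Finset.mem_union_left _ hg, hAg⟩
      · push Not at h
        exact ⟨A, Finset.mem_union_right _ (Finset.mem_filter.2 ⟨hA, h⟩), subset_rfl⟩
  · rw [Finset.mem_filter, mem_cutFamilies] at hC
    ext g
    simp only [Finset.mem_union, Finset.mem_sdiff, Finset.mem_filter]
    constructor
    · rintro (h | ⟨hg, h⟩)
      · exact h.1
      · obtain ⟨k, hk, hgk⟩ := hC.2 g hg
        by_cases hkB : k ∈ B
        · exact (hB.eq_of_subset hg hkB hgk) ▸ hk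
        · exact (h k ⟨hk, hkB⟩ hgk).elim
    · intro hg
      by_cases hgB : g ∈ B
      · refine Or.inr ⟨hgB, fun k hk hgk => hk.2 ?_⟩
        exact (hC.1.eq_of_subset hg hk.1 hgk) ▸ hgB
      · exact Or.inl ⟨hg, hgB⟩
  · rw [mem_cutFamilies] at hN
    ext g
    simp only [Finset.mem_union, Finset.mem_sdiff, Finset.mem_filter]
    constructor
    · rintro ⟨h | h, hgB⟩
      · exact h
      · exact (hgB h.1).elim
    · exact fun hg => ⟨Or.inl hg, fun hgB => hN.not_subset g hg (Set.subset_sUnion_of_mem hgB)⟩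

theorem prod_tmul_prod {R A B ι : Type*} [CommSemiring R] [CommSemiring A] [CommSemiring B]
    [Algebra R A] [Algebra R B] (s : Finset ι) (f : ι → A) (g : ι → B) :
    ∏ i ∈ s, f i ⊗ₜ[R] g i = (∏ i ∈ s, f i) ⊗ₜ[R] (∏ i ∈ s, g i) := by
  classical
  induction s using Finset.induction_on with
  | empty => simp [Algebra.TensorProduct.one_def]
  | insert i s hi ih =>
    rw [Finset.prod_insert hi, Finset.prod_insert hi, Finset.prod_insert hi, ih,
      Algebra.TensorProduct.tmul_mul_tmul]

-- The term with `1` on the right is treated as the family `{g}` with its quotient replaced by `1`,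
-- so that the coproduct of a product expands into a single sum.
open Classical in
theorem coproduct_quotGen_eq_sum_localFamilies (hX : 𝒢.Mem X) {g : Set X.HalfEdge}
    (hg : IsCuttable 𝒢 X g) : coproduct 𝒢 K (quotGen 𝒢 K g ∅) =
      ∑ B ∈ localFamilies 𝒢 X g, (∏ A ∈ B, quotGen 𝒢 K A ∅) ⊗ₜ[K]
        (if g ∈ B then 1 else quotGen 𝒢 K g (⋃₀ (B : Set (Set X.HalfEdge)))) := by
  have hnot : {g} ∉ cutFamilies 𝒢 X g ∅ := fun h =>
    (mem_cutFamilies.1 h).ne g (Finset.mem_singleton_self g) rfl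
  rw [coproduct_quotGen hX hg.isHigh hg.onePI hg.isHigh.not_subset_empty isCutUnion_empty,
    localFamilies, Finset.sum_insert hnot]
  congr 1
  · simp
  · refine Finset.sum_congr rfl fun B hB => ?_
    rw [if_neg fun h => (mem_cutFamilies.1 hB).ne g h rfl, Set.empty_union]

-- Expanding the product selects a local family in each `g ∈ C`, and their union is `B`. The members
-- that select themselves contribute `1`, so only `C \ B` remains in the second factor.
open Classical in
theorem coproduct_prod_quotGen (hX : 𝒢.Mem X) {C : Finset (Set X.HalfEdge)}
    (hC : IsCutFamily 𝒢 X X.internal ∅ C) : coproduct 𝒢 K (∏ A ∈ C, quotGen 𝒢 K A ∅) =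
      ∑ B ∈ (cutFamilies 𝒢 X X.internal ∅).filter (Refines · C), (∏ A ∈ B, quotGen 𝒢 K A ∅) ⊗ₜ[K]
        ∏ g ∈ C \ B, quotGen 𝒢 K g (⋃₀ (B : Set (Set X.HalfEdge))) := by
  rw [map_prod, Finset.prod_congr rfl fun g hg =>
    coproduct_quotGen_eq_sum_localFamilies hX (hC.isCuttable g hg), Finset.prod_sum,
    ← sum_pi_localFamilies hC]
  refine Finset.sum_congr rfl fun q hq => ?_
  rw [Finset.mem_pi] at hq
  rw [prod_tmul_prod]
  have hself : ∀ g (hg : g ∈ C) k (hk : k ∈ C), ∀ A ∈ q k hk, ∀ e ∈ A, e ∈ g → k = g :=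
    fun g hg k hk A hA e he heg =>
      hC.eq_of_mem hk hg (subset_of_mem_localFamilies (hq k hk) hA he) heg
  have hne : ∀ k (hk : k ∈ C), ∀ A ∈ q k hk, A.Nonempty := fun k hk A hA =>
    (isCuttable_of_mem_localFamilies (hC.isCuttable k hk) (hq k hk) hA).isHigh.nonempty
  have hcut := isCutFamily_biUnion hC hq
  have href : Refines (C.attach.biUnion fun g => q g.1 g.2) C := by
    intro A hA
    simp only [Finset.mem_biUnion, Finset.mem_attach, true_and] at hA
    obtain ⟨⟨g, hg⟩, hA⟩ := hA
    exact ⟨g, hg, subset_of_mem_localFamilies (hq g hg) hA⟩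
  congr 1
  · rw [Finset.prod_biUnion]
    rintro ⟨g, hg⟩ - ⟨k, hk⟩ - hgk
    refine Finset.disjoint_left.2 fun A hA hA' => hgk ?_
    obtain ⟨e, he⟩ := hne g hg A hA
    exact Subtype.ext (hself k hk g hg A hA e he (subset_of_mem_localFamilies (hq k hk) hA' he))
  · rw [← Finset.filter_notMem_eq_sdiff, Finset.prod_filter, ← Finset.prod_attach C]
    refine Finset.prod_congr rfl ?_
    rintro ⟨g, hg⟩ -
    have hiff : g ∈ C.attach.biUnion (fun g => q g.1 g.2) ↔ g ∈ q g hg := by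
      simp only [Finset.mem_biUnion, Finset.mem_attach, true_and]
      constructor
      · rintro ⟨⟨k, hk⟩, hgk⟩
        obtain ⟨e, he⟩ := hC.nonempty hg
        obtain rfl := hself g hg k hk g hgk e he he
        exact hgk
      · exact fun h => ⟨⟨g, hg⟩, h⟩
    by_cases h : g ∈ q g hg
    · rw [if_pos h, if_neg (not_not.2 (hiff.2 h))]
    · have hgB := fun h' => h (hiff.1 h')
      -- Only the part of `B` inside `g` matters for the quotient of `g`, and it is the family
      -- selected in `g`.
      rw [if_neg h, if_pos hgB, ← quotGen_inter hX.connected (hC.isCuttable g hg).isHigh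
        hcut.isCutUnion_sUnion (href.not_subset hcut hC hg hgB)]
      congr 1
      ext e
      simp only [Set.mem_sUnion, Set.mem_inter_iff, Finset.mem_coe, Finset.mem_biUnion,
        Finset.mem_attach, true_and]
      constructor
      · rintro ⟨A, hA, he⟩
        exact ⟨⟨A, ⟨⟨g, hg⟩, hA⟩, he⟩, subset_of_mem_localFamilies (hq g hg) hA he⟩
      · rintro ⟨⟨A, ⟨⟨k, hk⟩, hA⟩, he⟩, heg⟩
        obtain rfl := hself g hg k hk A hA e he heg
        exact ⟨A, hA, he⟩

-- Cut families of the quotient by `B` are the differences `C \ B` for coarser `C`, and `B` together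
-- with `C \ B` covers the same lines as `C`.
open Classical in
theorem coproduct_quotGen_internal (hX : 𝒢.Mem X) {B : Finset (Set X.HalfEdge)}
    (hB : IsCutFamily 𝒢 X X.internal ∅ B) :
    coproduct 𝒢 K (quotGen 𝒢 K X.internal (⋃₀ (B : Set (Set X.HalfEdge)))) =
      quotGen 𝒢 K X.internal (⋃₀ (B : Set (Set X.HalfEdge))) ⊗ₜ[K] 1 +
      ∑ C ∈ (cutFamilies 𝒢 X X.internal ∅).filter (Refines B ·),
        (∏ g ∈ C \ B, quotGen 𝒢 K g (⋃₀ (B : Set (Set X.HalfEdge)))) ⊗ₜ[K]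
          quotGen 𝒢 K X.internal (⋃₀ (C : Set (Set X.HalfEdge))) := by
  have hI := hX.connected.isHigh_internal
  rw [coproduct_quotGen hX hI (fun h h1 h2 v _ w _ => (hX.onePI h).2 h1 h2 v w)
    (hB.not_subset_sUnion hI) hB.isCutUnion_sUnion, ← sum_refines hB]
  congr 1
  refine Finset.sum_congr rfl fun C hC => ?_
  rw [(Finset.mem_filter.1 hC).2.sUnion_eq]

theorem GNTree.exists_X_eq (t : GNTree 𝒢) : ∃ X : AssignedGraph, 𝒢.Mem X ∧
    (MvPolynomial.X t : GNAlgebra 𝒢 K) = treeGen 𝒢 K X := by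
  obtain ⟨X, hX, rfl⟩ := t.exists_eq_of
  exact ⟨X, hX, (treeGen_of_mem hX).symm⟩

/-- On generators, apart from the terms that end in `1`, both sides are double sums over pairs with
`Refines B C`, taken in opposite orders. -/
theorem coproduct_coassoc (𝒢 : GraphClass) (K : Type*) [Field K] :
    (Algebra.TensorProduct.assoc K K K (GNAlgebra 𝒢 K) (GNAlgebra 𝒢 K)
      (GNAlgebra 𝒢 K)).toAlgHom.comp
        ((Algebra.TensorProduct.map (coproduct 𝒢 K) (AlgHom.id K (GNAlgebra 𝒢 K))).comp
          (coproduct 𝒢 K)) =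
      (Algebra.TensorProduct.map (AlgHom.id K (GNAlgebra 𝒢 K)) (coproduct 𝒢 K)).comp
        (coproduct 𝒢 K) := by
  classical
  refine MvPolynomial.algHom_ext fun t => ?_
  obtain ⟨X, hX, ht⟩ := t.exists_X_eq (K := K)
  rw [ht]
  simp only [AlgHom.comp_apply, coproduct_treeGen hX, map_add, Algebra.TensorProduct.map_tmul,
    cutSum, map_sum, AlgHom.id_apply, map_one, TensorProduct.add_tmul, TensorProduct.sum_tmul]
  have hl : ∀ C ∈ cutFamilies 𝒢 X X.internal ∅,
      (Algebra.TensorProduct.assoc K K K (GNAlgebra 𝒢 K) (GNAlgebra 𝒢 K) (GNAlgebra 𝒢 K)).toAlgHom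
        (coproduct 𝒢 K (∏ A ∈ C, quotGen 𝒢 K A ∅) ⊗ₜ[K]
          quotGen 𝒢 K X.internal (⋃₀ (C : Set (Set X.HalfEdge)))) =
      ∑ B ∈ (cutFamilies 𝒢 X X.internal ∅).filter (Refines · C), (∏ A ∈ B, quotGen 𝒢 K A ∅) ⊗ₜ[K]
        ((∏ g ∈ C \ B, quotGen 𝒢 K g (⋃₀ (B : Set (Set X.HalfEdge)))) ⊗ₜ[K]
          quotGen 𝒢 K X.internal (⋃₀ (C : Set (Set X.HalfEdge)))) := by
    intro C hC
    rw [coproduct_prod_quotGen hX (mem_cutFamilies.1 hC), TensorProduct.sum_tmul, map_sum]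
    rfl
  have hr : ∀ B ∈ cutFamilies 𝒢 X X.internal ∅,
      (∏ A ∈ B, quotGen 𝒢 K A ∅) ⊗ₜ[K]
        coproduct 𝒢 K (quotGen 𝒢 K X.internal (⋃₀ (B : Set (Set X.HalfEdge)))) =
      (∏ A ∈ B, quotGen 𝒢 K A ∅) ⊗ₜ[K]
        (quotGen 𝒢 K X.internal (⋃₀ (B : Set (Set X.HalfEdge))) ⊗ₜ[K] (1 : GNAlgebra 𝒢 K)) +
      ∑ C ∈ (cutFamilies 𝒢 X X.internal ∅).filter (Refines B ·), (∏ A ∈ B, quotGen 𝒢 K A ∅) ⊗ₜ[K]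
        ((∏ g ∈ C \ B, quotGen 𝒢 K g (⋃₀ (B : Set (Set X.HalfEdge)))) ⊗ₜ[K]
          quotGen 𝒢 K X.internal (⋃₀ (C : Set (Set X.HalfEdge)))) := by
    intro B hB
    rw [coproduct_quotGen_internal hX (mem_cutFamilies.1 hB), TensorProduct.tmul_add,
      TensorProduct.tmul_sum]
  rw [Finset.sum_congr rfl hl, Finset.sum_congr rfl hr, Finset.sum_add_distrib, ← add_assoc,
    Finset.sum_comm' (s' := fun B => (cutFamilies 𝒢 X X.internal ∅).filter (Refines B ·))
      (t' := cutFamilies 𝒢 X X.internal ∅)]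
  · rfl
  · intro C B
    simp only [Finset.mem_filter]
    tauto

/-- The counit kills every tree, so only the empty family, with left factor `1`, survives. -/
theorem counit_left (𝒢 : GraphClass) (K : Type*) [Field K] :
    (Algebra.TensorProduct.map (counit 𝒢 K) (AlgHom.id K (GNAlgebra 𝒢 K))).comp (coproduct 𝒢 K) =
      (Algebra.TensorProduct.lid K (GNAlgebra 𝒢 K)).symm := by
  classical
  refine MvPolynomial.algHom_ext fun t => ?_
  obtain ⟨X, hX, ht⟩ := t.exists_X_eq (K := K)
  rw [ht, AlgHom.comp_apply, coproduct_treeGen hX, cutSum_eq_add_erase hX.connected, map_add,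
    map_add, map_sum, Finset.sum_eq_zero]
  · simp [counit_treeGen]
  · intro N hN
    obtain ⟨A, hA⟩ := Finset.nonempty_iff_ne_empty.2 (Finset.mem_erase.1 hN).1
    rw [Algebra.TensorProduct.map_tmul, map_prod, Finset.prod_eq_zero hA counit_quotGen,
      TensorProduct.zero_tmul]

/-- Every term of `cutSum` has a tree on the right, which the counit kills; only the term with right
factor `1` survives. -/
theorem counit_right (𝒢 : GraphClass) (K : Type*) [Field K] :
    (Algebra.TensorProduct.map (AlgHom.id K (GNAlgebra 𝒢 K)) (counit 𝒢 K)).comp (coproduct 𝒢 K) =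
      (Algebra.TensorProduct.rid K K (GNAlgebra 𝒢 K)).symm := by
  refine MvPolynomial.algHom_ext fun t => ?_
  obtain ⟨X, hX, ht⟩ := t.exists_X_eq (K := K)
  rw [ht, AlgHom.comp_apply, coproduct_treeGen hX, cutSum, map_add, map_sum, Finset.sum_eq_zero]
  · simp
  · intro N hN
    rw [Algebra.TensorProduct.map_tmul, counit_quotGen, TensorProduct.tmul_zero]

end Coassociativity

/-! ### The grading of the tensor square -/

section GradedBialgebra

variable {K A : Type*} [CommRing K] [Ring A] [Algebra K A] (𝒜 : ℕ → Submodule K A)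

/-- The degree `n` part of the tensor square of a graded module. -/
def tensorPart (n : ℕ) : Submodule K (A ⊗[K] A) :=
  ⨆ p ∈ Finset.HasAntidiagonal.antidiagonal n, LinearMap.range (TensorProduct.map
    (𝒜 p.1).subtype (𝒜 p.2).subtype)

variable {𝒜}

theorem tensorPart_le {n : ℕ} {S : Submodule K (A ⊗[K] A)}
    (h : ∀ i j, i + j = n → ∀ x ∈ 𝒜 i, ∀ y ∈ 𝒜 j, x ⊗ₜ[K] y ∈ S) : tensorPart 𝒜 n ≤ S := by
  refine iSup₂_le fun p hp => ?_
  rintro _ ⟨z, rfl⟩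
  induction z with
  | zero => simp
  | add x y hx hy =>
    rw [map_add]
    exact S.add_mem hx hy
  | tmul x y => exact h p.1 p.2 (Finset.HasAntidiagonal.mem_antidiagonal.1 hp) x x.2 y y.2

theorem tmul_mem_tensorPart {i j n : ℕ} (hn : i + j = n) {x y : A} (hx : x ∈ 𝒜 i) (hy : y ∈ 𝒜 j) :
    x ⊗ₜ[K] y ∈ tensorPart 𝒜 n :=
  Submodule.mem_iSup_of_mem (i, j) (Submodule.mem_iSup_of_mem (Finset.HasAntidiagonal.mem_antidiagonal.2 hn)
    ⟨(⟨x, hx⟩ : 𝒜 i) ⊗ₜ[K] (⟨y, hy⟩ : 𝒜 j), rfl⟩)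

theorem mul_mem_tensorPart [SetLike.GradedMul 𝒜] {m n : ℕ} {x y : A ⊗[K] A}
    (hx : x ∈ tensorPart 𝒜 m) (hy : y ∈ tensorPart 𝒜 n) : x * y ∈ tensorPart 𝒜 (m + n) := by
  have h1 : tensorPart 𝒜 m ≤ (tensorPart 𝒜 (m + n)).comap (LinearMap.mulRight K y) := by
    refine tensorPart_le fun i j hij a ha b hb => ?_
    have h2 : tensorPart 𝒜 n ≤ (tensorPart 𝒜 (m + n)).comap (LinearMap.mulLeft K (a ⊗ₜ[K] b)) := by
      refine tensorPart_le fun k l hkl c hc d hd => ?_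
      rw [Submodule.mem_comap, LinearMap.mulLeft_apply, Algebra.TensorProduct.tmul_mul_tmul]
      exact tmul_mem_tensorPart (by omega) (SetLike.mul_mem_graded ha hc)
        (SetLike.mul_mem_graded hb hd)
    exact h2 hy
  exact h1 hx

end GradedBialgebra

/-! ### The antipode of a connected graded bialgebra -/

section Antipode

open WithConv

variable {K A : Type*} [Field K] [Ring A] [B : Bialgebra K A] {𝒜 : ℕ → Submodule K A}

/-- In degree `n`, a convolution product involves its factors only on pairs of degrees with sum `n`.
-/
theorem convMul_congr_of_mem {n : ℕ} {f g f' g' : WithConv (A →ₗ[K] A)} {x : A}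
    (hx : Coalgebra.comul (R := K) x ∈ tensorPart 𝒜 n)
    (h : ∀ i j, i + j = n → ∀ a ∈ 𝒜 i, ∀ b ∈ 𝒜 j, f a * g b = f' a * g' b) :
    (f * g) x = (f' * g') x := by
  have hle : tensorPart 𝒜 n ≤
      LinearMap.eqLocus (LinearMap.mul' K A ∘ₗ TensorProduct.map f.ofConv g.ofConv)
        (LinearMap.mul' K A ∘ₗ TensorProduct.map f'.ofConv g'.ofConv) :=
    tensorPart_le fun i j hij a ha b hb => by
      rw [LinearMap.mem_eqLocus, LinearMap.comp_apply, LinearMap.comp_apply,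
        TensorProduct.map_tmul, TensorProduct.map_tmul, LinearMap.mul'_apply, LinearMap.mul'_apply]
      exact h i j hij a ha b hb
  exact hle hx

theorem convMul_mem [SetLike.GradedMul 𝒜] {n : ℕ} {f g : WithConv (A →ₗ[K] A)} {x : A}
    (hx : Coalgebra.comul (R := K) x ∈ tensorPart 𝒜 n)
    (hf : ∀ i, ∀ a ∈ 𝒜 i, f a ∈ 𝒜 i) (hg : ∀ i, ∀ a ∈ 𝒜 i, g a ∈ 𝒜 i) : (f * g) x ∈ 𝒜 n := by
  have hle : tensorPart 𝒜 n ≤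
      (𝒜 n).comap (LinearMap.mul' K A ∘ₗ TensorProduct.map f.ofConv g.ofConv) :=
    tensorPart_le fun i j hij a ha b hb => by
      rw [Submodule.mem_comap, LinearMap.comp_apply, TensorProduct.map_tmul, LinearMap.mul'_apply,
        ← hij]
      exact SetLike.mul_mem_graded (hf i a ha) (hg j b hb)
  exact hle hx

variable (hΔ : ∀ n, ∀ x ∈ 𝒜 n, Coalgebra.comul (R := K) x ∈ tensorPart 𝒜 n)
  (h0 : ∀ x ∈ 𝒜 0, algebraMap K A (Coalgebra.counit (R := K) x) = x)
  (hε : ∀ n, n ≠ 0 → ∀ x ∈ 𝒜 n, Coalgebra.counit (R := K) x = 0)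

/-- The difference of the unit of the convolution product and the identity. -/
noncomputable def augmentation (K A : Type*) [Field K] [Ring A] [Bialgebra K A] :
    WithConv (A →ₗ[K] A) :=
  1 - toConv LinearMap.id

theorem augmentation_apply (x : A) :
    augmentation K A x = algebraMap K A (Coalgebra.counit (R := K) x) - x := rfl

/-- The partial sums of the geometric series for the antipode. -/
noncomputable def partialAntipode (K A : Type*) [Field K] [Ring A] [Bialgebra K A] (n : ℕ) :
    WithConv (A →ₗ[K] A) :=
  ∑ k ∈ Finset.range (n + 1), augmentation K A ^ k

-- By `h0` the augmentation vanishes in degree zero, so each convolution factor uses up at least one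
-- unit of degree.
include hΔ h0 in
theorem augmentation_pow_eq_zero {k n : ℕ} (hn : n < k) {x : A} (hx : x ∈ 𝒜 n) :
    (augmentation K A ^ k) x = 0 := by
  induction k generalizing n x with
  | zero => exact absurd hn (Nat.not_lt_zero n)
  | succ k ih =>
    rw [pow_succ']
    refine (convMul_congr_of_mem (f' := 0) (g' := 0) (hΔ n x hx) fun i j hij a ha b hb => ?_).trans
      (by rw [mul_zero]; rfl)
    rw [ofConv_zero, LinearMap.zero_apply, zero_mul]
    rcases Nat.eq_zero_or_pos i with rfl | hi
    · rw [augmentation_apply, h0 a ha, sub_self, zero_mul]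
    · rw [ih (by omega) hb, mul_zero]

include h0 hε in
theorem algebraMap_counit_mem (n : ℕ) {x : A} (hx : x ∈ 𝒜 n) :
    algebraMap K A (Coalgebra.counit (R := K) x) ∈ 𝒜 n := by
  rcases eq_or_ne n 0 with rfl | hn
  · rwa [h0 x hx]
  · rw [hε n hn x hx, map_zero]
    exact zero_mem _

include hΔ h0 hε in
theorem augmentation_pow_mem [SetLike.GradedMul 𝒜] (k n : ℕ) {x : A} (hx : x ∈ 𝒜 n) :
    (augmentation K A ^ k) x ∈ 𝒜 n := by
  induction k generalizing n x with
  | zero => exact algebraMap_counit_mem h0 hε n hx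
  | succ k ih =>
    rw [pow_succ']
    exact convMul_mem (hΔ n x hx)
      (fun i a ha => sub_mem (algebraMap_counit_mem h0 hε i ha) ha) fun i a ha => ih i ha

theorem partialAntipode_apply (n : ℕ) (x : A) :
    partialAntipode K A n x = ∑ k ∈ Finset.range (n + 1), (augmentation K A ^ k) x := by
  rw [partialAntipode, ofConv_sum, LinearMap.sum_apply]

-- In degree `i` the powers beyond the `i`-th vanish, so the partial sums stabilise.
include hΔ h0 in
theorem partialAntipode_eq {i n : ℕ} (hin : i ≤ n) {x : A} (hx : x ∈ 𝒜 i) :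
    partialAntipode K A n x = partialAntipode K A i x := by
  rw [partialAntipode_apply, partialAntipode_apply]
  refine (Finset.sum_subset (Finset.range_mono (by omega)) fun k _ hk => ?_).symm
  exact augmentation_pow_eq_zero hΔ h0 (by simpa using hk) hx

/-- The identity is `1 - augmentation`, so the geometric sum telescopes. -/
theorem partialAntipode_mul_id (n : ℕ) :
    partialAntipode K A n * toConv LinearMap.id = 1 - augmentation K A ^ (n + 1) := by
  rw [← geom_sum_mul_neg, partialAntipode, augmentation, sub_sub_cancel]

theorem id_mul_partialAntipode (n : ℕ) :
    toConv LinearMap.id * partialAntipode K A n = 1 - augmentation K A ^ (n + 1) := by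
  rw [← mul_neg_geom_sum, partialAntipode, augmentation, sub_sub_cancel]

include hΔ h0 hε in
/-- A connected graded bialgebra has an antipode, which preserves the degree. -/
theorem exists_hopfAlgebra [SetLike.GradedMul 𝒜] [DirectSum.Decomposition 𝒜] :
    ∃ hopf : HopfAlgebra K A, hopf.toBialgebra = B ∧
      ∀ n, ∀ x ∈ 𝒜 n, hopf.antipode x ∈ 𝒜 n := by
  -- In degree `i` the partial sum up to `i` is already the whole geometric series.
  let S : A →ₗ[K] A := DirectSum.toModule K ℕ A
    (fun i => (partialAntipode K A i).ofConv ∘ₗ (𝒜 i).subtype) ∘ₗ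
      (DirectSum.decomposeLinearEquiv 𝒜).toLinearMap
  have hS : ∀ i, ∀ x ∈ 𝒜 i, S x = partialAntipode K A i x := by
    intro i x hx
    change DirectSum.toModule K ℕ A _ (DirectSum.decomposeLinearEquiv 𝒜 ((⟨x, hx⟩ : 𝒜 i) : A)) = _
    rw [DirectSum.decomposeLinearEquiv_apply_coe, DirectSum.toModule_lof]
    rfl
  have hS' : ∀ n i, i ≤ n → ∀ x ∈ 𝒜 i, S x = partialAntipode K A n x := by
    intro n i hin x hx
    rw [hS i x hx, partialAntipode_eq hΔ h0 hin hx]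
  -- The exponent `n + 1` exceeds the degree, so the telescoping error vanishes.
  have hone : ∀ n, ∀ x ∈ 𝒜 n, (1 - augmentation K A ^ (n + 1) : WithConv (A →ₗ[K] A)) x =
      (1 : WithConv (A →ₗ[K] A)) x := by
    intro n x hx
    change (1 : WithConv (A →ₗ[K] A)) x - (augmentation K A ^ (n + 1)) x = _
    rw [augmentation_pow_eq_zero hΔ h0 (Nat.lt_succ_self n) hx, sub_zero]
  have hleft : (toConv S * toConv LinearMap.id : WithConv (A →ₗ[K] A)) = 1 := by
    refine WithConv.ext (DirectSum.decompose_lhom_ext 𝒜 fun n => LinearMap.ext fun x => ?_)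
    refine Eq.trans ?_ (hone n x x.2)
    rw [← partialAntipode_mul_id]
    refine convMul_congr_of_mem (hΔ n x x.2) fun i j hij a ha b _ => ?_
    exact congrArg (· * b) (hS' n i (by omega) a ha)
  have hright : (toConv LinearMap.id * toConv S : WithConv (A →ₗ[K] A)) = 1 := by
    refine WithConv.ext (DirectSum.decompose_lhom_ext 𝒜 fun n => LinearMap.ext fun x => ?_)
    refine Eq.trans ?_ (hone n x x.2)
    rw [← id_mul_partialAntipode]
    refine convMul_congr_of_mem (hΔ n x x.2) fun i j hij a _ b hb => ?_
    exact congrArg (a * ·) (hS' n j (by omega) b hb)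
  refine ⟨{ B with
    antipode := S
    mul_antipode_rTensor_comul := congrArg ofConv hleft
    mul_antipode_lTensor_comul := congrArg ofConv hright }, rfl, fun n x hx => ?_⟩
  change S x ∈ 𝒜 n
  rw [hS n x hx, partialAntipode_apply]
  exact sum_mem fun k _ => augmentation_pow_mem hΔ h0 hε k n hx

end Antipode

/-! ### The grading by the number of high subgraphs -/

section Grading

variable {𝒢 : GraphClass} {K : Type*} [Field K] {X : AssignedGraph} {E U : Set X.HalfEdge}

instance : SetLike.GradedMonoid (gradedPart 𝒢 K) :=
  MvPolynomial.WeightedHomogeneousSubmodule.gradedMonoid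

theorem treeGen_mem_gradedPart (hX : 𝒢.Mem X) :
    treeGen 𝒢 K X ∈ gradedPart 𝒢 K {A | X.IsHigh A}.ncard := by
  rw [treeGen_of_mem hX, ← GNTree.degree_of hX]
  exact MvPolynomial.isWeightedHomogeneous_X K GNTree.degree (GNTree.of X hX)

theorem quotGen_mem_gradedPart (hX : 𝒢.Mem X) (hE : X.IsHigh E)
    (hE1 : 𝒢.onePIOnly → X.IsOnePISub E) (hEU : ¬ E ⊆ U) (hU : IsCutUnion 𝒢 X U) :
    quotGen 𝒢 K E U ∈ gradedPart 𝒢 K {A | X.IsHigh A ∧ A ⊆ E ∧ ¬ A ⊆ U}.ncard := by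
  obtain ⟨Y, ⟨p⟩⟩ := hX.connected.exists_subquotient hE hU hEU
  rw [p.quotGen_eq, ← p.ncard_isHigh hE hEU hU]
  exact treeGen_mem_gradedPart (p.mem hX hE hE1 hEU hU)

theorem GraphClass.Mem.isOnePISub_internal (hX : 𝒢.Mem X)
    (h𝒢 : 𝒢.onePIOnly) : X.IsOnePISub X.internal :=
  fun h hh v _ w _ => (hX.onePI h𝒢).2 h hh v w

/-- A cut splits the high subgraphs into those inside its members and those that survive in the
quotient, so the degrees of the two factors add up. -/
theorem cutSum_mem_tensorPart (hX : 𝒢.Mem X) :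
    cutSum 𝒢 K X ∈ tensorPart (gradedPart 𝒢 K) {A | X.IsHigh A}.ncard := by
  refine Submodule.sum_mem _ fun N hN => ?_
  rw [mem_cutFamilies] at hN
  refine tmul_mem_tensorPart hN.ncard_isHigh.symm ?_ ?_
  · exact MvPolynomial.IsWeightedHomogeneous.prod N _ _ fun A hA =>
      quotGen_mem_gradedPart hX (hN.isCuttable A hA).isHigh (hN.isCuttable A hA).onePI
        (hN.isCuttable A hA).isHigh.not_subset_empty isCutUnion_empty
  · exact quotGen_mem_gradedPart hX hX.connected.isHigh_internal hX.isOnePISub_internal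
      (hN.not_subset_sUnion hX.connected.isHigh_internal) hN.isCutUnion_sUnion

theorem one_mem_gradedPart : (1 : GNAlgebra 𝒢 K) ∈ gradedPart 𝒢 K 0 :=
  SetLike.GradedOne.one_mem

theorem one_mem_tensorPart :
    (1 : GNAlgebra 𝒢 K ⊗[K] GNAlgebra 𝒢 K) ∈ tensorPart (gradedPart 𝒢 K) 0 := by
  rw [Algebra.TensorProduct.one_def]
  exact tmul_mem_tensorPart (add_zero 0) one_mem_gradedPart one_mem_gradedPart

theorem coproduct_X_mem (t : GNTree 𝒢) :
    coproduct 𝒢 K (MvPolynomial.X t) ∈ tensorPart (gradedPart 𝒢 K) t.degree := by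
  obtain ⟨X, hX, rfl⟩ := t.exists_eq_of
  rw [GNTree.degree_of hX]
  have h : (MvPolynomial.X (GNTree.of X hX) : GNAlgebra 𝒢 K) = treeGen 𝒢 K X :=
    (treeGen_of_mem hX).symm
  rw [h, coproduct_treeGen hX]
  exact add_mem (tmul_mem_tensorPart (add_zero _) (treeGen_mem_gradedPart hX) one_mem_gradedPart)
    (cutSum_mem_tensorPart hX)

theorem coproduct_monomial_mem (d : GNTree 𝒢 →₀ ℕ) :
    coproduct 𝒢 K (MvPolynomial.monomial d 1) ∈
      tensorPart (gradedPart 𝒢 K) (Finsupp.weight GNTree.degree d) := by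
  induction d using Finsupp.induction_linear with
  | zero =>
    rw [map_zero, MvPolynomial.monomial_zero', map_one, map_one]
    exact one_mem_tensorPart
  | add d e hd he =>
    rw [map_add, ← one_mul (1 : K), ← MvPolynomial.monomial_mul, map_mul]
    exact mul_mem_tensorPart hd he
  | single t n =>
    induction n with
    | zero =>
      rw [Finsupp.single_zero, map_zero, MvPolynomial.monomial_zero', map_one, map_one]
      exact one_mem_tensorPart
    | succ n ih =>
      rw [Finsupp.single_add, map_add, ← one_mul (1 : K), ← MvPolynomial.monomial_mul, map_mul]
      refine mul_mem_tensorPart ih ?_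
      rw [Finsupp.weight_single, one_smul]
      exact coproduct_X_mem t

theorem coproduct_mem {n : ℕ} {x : GNAlgebra 𝒢 K} (hx : x ∈ gradedPart 𝒢 K n) :
    coproduct 𝒢 K x ∈ tensorPart (gradedPart 𝒢 K) n := by
  induction (show x.IsWeightedHomogeneous GNTree.degree n from hx) using
    MvPolynomial.IsWeightedHomogeneous.induction_on with
  | zero => exact (map_zero (coproduct 𝒢 K)).symm ▸ zero_mem _
  | add p q hp hq ihp ihq => exact (map_add (coproduct 𝒢 K) p q).symm ▸ add_mem (ihp hp) (ihq hq)
  | monomial d r hr =>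
    rw [← mul_one r, ← smul_eq_mul, ← MvPolynomial.smul_monomial, map_smul, ← hr]
    exact Submodule.smul_mem _ r (coproduct_monomial_mem d)

theorem GNTree.degree_ne_zero (t : GNTree 𝒢) : t.degree ≠ 0 := by
  obtain ⟨⟨T⟩, hT⟩ := t
  exact Nat.succ_ne_zero _

theorem counit_apply (x : GNAlgebra 𝒢 K) : counit 𝒢 K x = MvPolynomial.constantCoeff x :=
  MvPolynomial.aeval_zero' x

/-- All trees have positive degree, so only constants have degree zero. -/
theorem algebraMap_counit_of_mem {x : GNAlgebra 𝒢 K} (hx : x ∈ gradedPart 𝒢 K 0) :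
    algebraMap K (GNAlgebra 𝒢 K) (counit 𝒢 K x) = x := by
  rw [counit_apply]
  refine (MvPolynomial.weightedHomogeneousComponent_zero x GNTree.degree_ne_zero).symm.trans ?_
  exact MvPolynomial.IsWeightedHomogeneous.weightedHomogeneousComponent_same hx

theorem counit_eq_zero_of_mem {n : ℕ} (hn : n ≠ 0) {x : GNAlgebra 𝒢 K}
    (hx : x ∈ gradedPart 𝒢 K n) : counit 𝒢 K x = 0 := by
  rw [counit_apply]
  by_contra h
  exact hn ((hx h).symm.trans (map_zero _))

end Grading

/-! ### The coproduct formula in terms of admissible cuts -/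

section Cuts

variable {𝒢 : GraphClass} {K : Type*} [Field K] {X : AssignedGraph}

theorem AdmissibleCut.isCuttable_lines (hX : X.IsConnected) (C : AdmissibleCut 𝒢 X hX)
    (a : C.1) : IsCuttable 𝒢 X (C.prunedNode a).lines :=
  C.isCutFamily.isCuttable _ (Finset.mem_image_of_mem _ a.2)

theorem AdmissibleCut.mem_prunedGraph (hX : 𝒢.Mem X) (C : AdmissibleCut 𝒢 X hX.connected)
    (a : C.1) : 𝒢.Mem (C.prunedGraph a) := by
  have hA := C.isCuttable_lines hX.connected a
  exact (hX.connected.subquotientSub hA.isHigh).mem hX hA.isHigh hA.onePI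
    hA.isHigh.not_subset_empty isCutUnion_empty

theorem AdmissibleCut.not_internal_subset (hX : X.IsConnected) (C : AdmissibleCut 𝒢 X hX) :
    ¬ X.internal ⊆ C.cutLines := by
  rw [C.cutLines_eq]
  exact C.isCutFamily.not_subset_sUnion hX.isHigh_internal

theorem AdmissibleCut.mem_rootGraph (hX : 𝒢.Mem X) (C : AdmissibleCut 𝒢 X hX.connected) :
    𝒢.Mem C.rootGraph := by
  have h := C.not_internal_subset hX.connected
  refine (hX.connected.subquotientShrink C.isSubgraph_cutLines h).mem hX
    hX.connected.isHigh_internal hX.isOnePISub_internal h ?_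
  rw [C.cutLines_eq]
  exact C.isCutFamily.isCutUnion_sUnion

/-- The nonempty cut families are the admissible cuts, and the empty one supplies the term with left
factor `1`. -/
theorem coproduct_gen (hX : 𝒢.Mem X) : coproduct 𝒢 K (gen K X hX) =
    gen K X hX ⊗ₜ[K] 1 + 1 ⊗ₜ[K] gen K X hX + ∑ C : AdmissibleCut 𝒢 X hX.connected,
      (∏ a : C.1, gen K (C.prunedGraph a) (C.mem_prunedGraph hX a)) ⊗ₜ[K]
        gen K C.rootGraph (C.mem_rootGraph hX) := by
  classical
  rw [← treeGen_of_mem hX, coproduct_treeGen hX, cutSum_eq_add_erase hX.connected, ← add_assoc,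
    ← AdmissibleCut.sum_family (hX := hX.connected)]
  congr 1
  refine Finset.sum_congr rfl fun C _ => ?_
  rw [← C.prod_family, ← C.cutLines_eq]
  congr 1
  · refine Finset.prod_congr rfl fun a _ => ?_
    rw [← treeGen_of_mem (C.mem_prunedGraph hX a)]
    exact (hX.connected.subquotientSub (C.isCuttable_lines hX.connected a).isHigh).quotGen_eq
  · rw [← treeGen_of_mem (C.mem_rootGraph hX)]
    exact (hX.connected.subquotientShrink C.isSubgraph_cutLines
      (C.not_internal_subset hX.connected)).quotGen_eq

end Cuts

end GallavottiNicolo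

open GallavottiNicolo in
theorem mainTheorem2 (K : Type*) [Field K] (𝒢 : GraphClass) :
    -- there are a coproduct and a counit
    ∃ (Δ : GNAlgebra 𝒢 K →ₐ[K] GNAlgebra 𝒢 K ⊗[K] GNAlgebra 𝒢 K) (ε : GNAlgebra 𝒢 K →ₐ[K] K),
      -- given on generators by the stated formulas
      (∀ (X : AssignedGraph) (hX : 𝒢.Mem X), ε (gen K X hX) = 0) ∧
      (∀ (X : AssignedGraph) (hX : 𝒢.Mem X),
        ∃ (hpruned : ∀ (C : AdmissibleCut 𝒢 X hX.connected) (a : C.1), 𝒢.Mem (C.prunedGraph a))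
          (hroot : ∀ C : AdmissibleCut 𝒢 X hX.connected, 𝒢.Mem C.rootGraph),
          Δ (gen K X hX) = gen K X hX ⊗ₜ[K] 1 + 1 ⊗ₜ[K] gen K X hX +
            ∑ C : AdmissibleCut 𝒢 X hX.connected,
              (∏ a : C.1, gen K (C.prunedGraph a) (hpruned C a)) ⊗ₜ[K]
                gen K C.rootGraph (hroot C)) ∧
      -- for which the algebra is a Hopf algebra
      ∃ (hcoassoc : (Algebra.TensorProduct.assoc K K K (GNAlgebra 𝒢 K) (GNAlgebra 𝒢 K)
            (GNAlgebra 𝒢 K)).toAlgHom.comp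
              ((Algebra.TensorProduct.map Δ (AlgHom.id K (GNAlgebra 𝒢 K))).comp Δ) =
            (Algebra.TensorProduct.map (AlgHom.id K (GNAlgebra 𝒢 K)) Δ).comp Δ)
        (hleft : (Algebra.TensorProduct.map ε (AlgHom.id K (GNAlgebra 𝒢 K))).comp Δ =
            (Algebra.TensorProduct.lid K (GNAlgebra 𝒢 K)).symm)
        (hright : (Algebra.TensorProduct.map (AlgHom.id K (GNAlgebra 𝒢 K)) ε).comp Δ =
            (Algebra.TensorProduct.rid K K (GNAlgebra 𝒢 K)).symm)
        (hopf : HopfAlgebra K (GNAlgebra 𝒢 K)),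
        hopf.toBialgebra = Bialgebra.ofAlgHom Δ ε hcoassoc hleft hright ∧
        -- graded by the number of arrows joining nodes with different graphs, plus one
        DirectSum.IsInternal (gradedPart 𝒢 K) ∧
        SetLike.GradedMonoid (gradedPart 𝒢 K) ∧
        (∀ n, ∀ x ∈ gradedPart 𝒢 K n,
          Δ x ∈ ⨆ p ∈ Finset.HasAntidiagonal.antidiagonal n, LinearMap.range (TensorProduct.map
            (gradedPart 𝒢 K p.1).subtype (gradedPart 𝒢 K p.2).subtype)) ∧
        (∀ n, ∀ x ∈ gradedPart 𝒢 K n, hopf.antipode x ∈ gradedPart 𝒢 K n) := by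
  have hdec : DirectSum.Decomposition (gradedPart 𝒢 K) :=
    MvPolynomial.weightedDecomposition K GNTree.degree
  obtain ⟨hopf, hopf_eq, hantipode⟩ := exists_hopfAlgebra (𝒜 := gradedPart 𝒢 K)
    (B := Bialgebra.ofAlgHom (coproduct 𝒢 K) (counit 𝒢 K) (coproduct_coassoc 𝒢 K)
      (counit_left 𝒢 K) (counit_right 𝒢 K))
    (fun _ _ hx => coproduct_mem hx) (fun _ hx => algebraMap_counit_of_mem hx)
    (fun _ hn _ hx => counit_eq_zero_of_mem hn hx)
  refine ⟨coproduct 𝒢 K, counit 𝒢 K, fun X hX => ?_, fun X hX => ⟨fun C => C.mem_prunedGraph hX,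
    fun C => C.mem_rootGraph hX, coproduct_gen hX⟩, coproduct_coassoc 𝒢 K, counit_left 𝒢 K,
    counit_right 𝒢 K, hopf, hopf_eq, hdec.isInternal, inferInstance, fun _ _ hx => coproduct_mem hx,
    hantipode⟩
  rw [← treeGen_of_mem hX, counit_treeGen]
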